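/- **Setting.** Fix real numbers $q_0>0$, $\sigma$ and a time $t$. For $\mathbf v=(v_1,v_2)^T\in\mathbb C^2$ put $\mathbf v^{\perp}=(v_2^*,-v_1^*)^T$, and let $\|\cdot\|$ be the Euclidean norm. For $z\in\mathbb C\setminus\{0,\pm q_0\}$ let $$k=\tfrac12\Big(z+\frac{q_0^2}{z}\Big),\quad \lambda=\tfrac12\Big(z-\frac{q_0^2}{z}\Big),\quad \hat\rho(z)=\frac{z^2}{z^2-q_0^2},\quad \mathbf J=\operatorname{diag}(1,-1,-1),\quad \mathbf Q=\begin{pmatrix}0&-\mathbf q^\dagger\\ \mathbf q&\mathbf 0\end{pmatrix},$$ $$\hat{\mathbf Y}_\pm(z)=\begin{pmatrix} i\hat\rho & 0 & \hat\rho q_0/z\\ i\hat\rho\,\mathbf q_\pm/z & \mathbf q_\pm^\perp/q_0 & \hat\rho\,\mathbf q_\pm/q_0\end{pmatrix},\qquad \mathbf\Delta=\operatorname{diag}(\delta_1,\delta_2,-\delta_1),$$ $\delta_1=\lambda x+2\lambda[k+\sigma(3k^2-\lambda^2)]t$, $\delta_2=-kx-(\lambda^2+k^2+4\sigma k^3)t$.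 Let $\mathbf q(x,t)\in\mathbb C^2$ be such that $\mathbf q(\cdot,t)$ is differentiable with $\mathbf q_x(\cdot,t)\in L^1(\mathbb R)$, $\mathbf q(x,t)\to\mathbf q_\pm$ as $x\to\pm\infty$ with $\|\mathbf q_\pm\|=q_0$, and $(1+|x|)(\mathbf q(x,t)-\mathbf q_\pm)\in L^1(\mathbb R^\pm_x)$. For $z\in\mathbb R\setminus\{0,\pm q_0\}$ let $\psi_\pm(z;x,t)$ be the $3\times3$ matrix (Jost) solutions of $\psi_x=(ik\mathbf J+i\mathbf Q)\psi$ with $\psi_\pm=\hat{\mathbf Y}_\pm e^{i\mathbf\Delta}+o(1)$ as $x\to\pm\infty$, let $\mathbf H(z)=(h_{ij}(z))$ be the scattering matrix, $\psi_+=\psi_-\mathbf H$, and $\mathbf S=\mathbf H^{-1}=(s_{ij})$. The coefficients $s_{33},h_{11}$ are extended to the closed upper half-plane without $\{0,\pm q_0\}$, and $s_{11},h_{33}$ to the closed lower half-plane without $\{0,\pm q_0\}$, as functions that are continuous there and holomorphic in the open half-plane. **Proposition.** Assume $\mathbf q_+^\dagger\mathbf q_-=0$. Then $\mathbf q_+=\mathbf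 q_-^\perp e^{-i\vartheta}$ for some $\vartheta\in\mathbb R$; the integral $$\vartheta_1=\int_{\mathbb R}[\mathbf q_+^\dagger\mathbf q(x,t)][\mathbf q^\dagger(x,t)\mathbf q_-]\,dx=\frac{\mathbf q_+^\dagger\mathbf q_-^\perp}{q_0^2}\int_{\mathbb R}[(\mathbf q_-^\perp)^\dagger\mathbf q(x,t)][\mathbf q^\dagger(x,t)\mathbf q_-]\,dx$$ converges absolutely; the Jost solutions, the scattering matrices and the stated extensions exist; and they satisfy the following. As $z\to\infty$, $$s_{33}(z)=\frac{i\vartheta_1}{q_0^2z}+O\Big(\frac1{z^2}\Big)\ (\operatorname{Im}z\ge0),\qquad h_{33}(z)=-\frac{i\vartheta_1^*}{q_0^2z}+O\Big(\frac1{z^2}\Big)\ (\operatorname{Im}z\le0),$$ $$s_{22}(z)=O\Big(\frac1z\Big),\quad h_{22}(z)=O\Big(\frac1z\Big)\ (z\in\mathbb R),$$ and as $z\to0$, $$s_{11}(z)=\frac{i\vartheta_1}{q_0^4}z+O(z^2)\ (\operatorname{Im}z\le0),\qquad h_{11}(z)=-\frac{i\vartheta_1^*}{q_0^4}z+O(z^2)\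 (\operatorname{Im}z\ge0),$$ $$s_{22}(z)=O(z),\quad h_{22}(z)=O(z)\ (z\in\mathbb R).$$ -/

import Mathlib

open Filter Topology Asymptotics MeasureTheory Complex

noncomputable section

namespace CoupledHirota

/-- Two-component complex vectors with the Euclidean norm; `inner ℂ v w` is `v† w`. -/
abbrev Vec2 := EuclideanSpace ℂ (Fin 2)

abbrev Mat3 := Matrix (Fin 3) (Fin 3) ℂ

/-- `v^⊥ = (v₂, -v₁)†`. -/
def perp (v : Vec2) : Vec2 := !₂[star (v 1), -star (v 0)]

/-- `J = diag(1, -1, -1)`. -/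
def matJ : Mat3 := Matrix.diagonal ![1, -1, -1]

/-- The block matrix with rows `(0, -v†)` and `(v, 0)`. -/
def matQ (v : Vec2) : Mat3 :=
  !![0, -star (v 0), -star (v 1);
     v 0, 0, 0;
     v 1, 0, 0]

/-- `k(z) = (z + q₀²/z)/2`. -/
def kOf (q₀ : ℝ) (z : ℂ) : ℂ := (z + (q₀ : ℂ) ^ 2 / z) / 2

/-- `λ(z) = (z - q₀²/z)/2`. -/
def lamOf (q₀ : ℝ) (z : ℂ) : ℂ := (z - (q₀ : ℂ) ^ 2 / z) / 2

/-- `ρ̂(z) = z²/(z² - q₀²)`. -/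
def rhoHat (q₀ : ℝ) (z : ℂ) : ℂ := z ^ 2 / (z ^ 2 - (q₀ : ℂ) ^ 2)

/-- The matrix `X = i k(z) J + i Q` of the scattering problem `ψ_x = X ψ`, where `v` is the
value of the potential. -/
def matX (q₀ : ℝ) (v : Vec2) (z : ℂ) : Mat3 := (I * kOf q₀ z) • matJ + I • matQ v

/-- The eigenvector matrix `Ŷ` of the scattering problem with constant potential `v`. -/
def matY (q₀ : ℝ) (v : Vec2) (z : ℂ) : Mat3 :=
  !![I * rhoHat q₀ z, 0, rhoHat q₀ z * q₀ / z;
     I * rhoHat q₀ z * v 0 / z, perp v 0 / q₀, rhoHat q₀ z * v 0 / q₀;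
     I * rhoHat q₀ z * v 1 / z, perp v 1 / q₀, rhoHat q₀ z * v 1 / q₀]

/-- `δ₁ = λ x + 2 λ [k + σ (3 k² - λ²)] t`. -/
def delta₁ (q₀ σ : ℝ) (z : ℂ) (x t : ℝ) : ℂ :=
  lamOf q₀ z * x
    + 2 * lamOf q₀ z * (kOf q₀ z + σ * (3 * kOf q₀ z ^ 2 - lamOf q₀ z ^ 2)) * t

/-- `δ₂ = -k x - (λ² + k² + 4 σ k³) t`. -/
def delta₂ (q₀ σ : ℝ) (z : ℂ) (x t : ℝ) : ℂ :=
  -kOf q₀ z * x - (lamOf q₀ z ^ 2 + kOf q₀ z ^ 2 + 4 * σ * kOf q₀ z ^ 3) * t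

/-- `e^{iΔ}` with `Δ = diag(δ₁, δ₂, -δ₁)`. -/
def expDelta (q₀ σ : ℝ) (z : ℂ) (x t : ℝ) : Mat3 :=
  Matrix.diagonal ![Complex.exp (I * delta₁ q₀ σ z x t), Complex.exp (I * delta₂ q₀ σ z x t),
    Complex.exp (-(I * delta₁ q₀ σ z x t))]

/-- The set `{0, q₀, -q₀}` of exceptional spectral values. -/
def exceptional (q₀ : ℝ) : Set ℂ := {0, (q₀ : ℂ), -(q₀ : ℂ)}

/-- The continuous spectrum `ℝ \ {0, ±q₀}`. -/
def realSpectrum (q₀ : ℝ) : Set ℝ := {z | (z : ℂ) ∉ exceptional q₀}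

/-- `ψ z x` is the matrix Jost solution at time `t` normalized along `l` (`atTop` for `ψ₊`, `atBot`
for `ψ₋`) by the boundary vector `qb`: `ψ_x = X ψ` and `ψ = Ŷ e^{iΔ} + o(1)`. -/
structure IsJost (q₀ σ : ℝ) (q : ℝ → ℝ → Vec2) (t : ℝ) (l : Filter ℝ) (qb : Vec2)
    (ψ : ℝ → ℝ → Mat3) : Prop where
  ode : ∀ z ∈ realSpectrum q₀, ∀ x : ℝ, ∀ i j : Fin 3,
    HasDerivAt (fun y : ℝ => ψ z y i j) ((matX q₀ (q x t) z * ψ z x) i j) x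
  boundary : ∀ z ∈ realSpectrum q₀,
    Tendsto (fun x : ℝ => ψ z x - matY q₀ qb z * expDelta q₀ σ z x t) l (𝓝 0)

/-- `F` extends `f` from `ℝ \ {0, ±q₀}` continuously to the closed half-plane `{0 ≤ Im z}`
without `{0, ±q₀}`, and holomorphically to its interior. -/
structure ExtendsToUpper (q₀ : ℝ) (f : ℝ → ℂ) (F : ℂ → ℂ) : Prop where
  holo : DifferentiableOn ℂ F {z : ℂ | 0 < z.im}
  cont : ContinuousOn F ({z : ℂ | 0 ≤ z.im} \ exceptional q₀)
  boundary : ∀ z ∈ realSpectrum q₀, F z = f z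

/-- The same for the lower half-plane. -/
structure ExtendsToLower (q₀ : ℝ) (f : ℝ → ℂ) (F : ℂ → ℂ) : Prop where
  holo : DifferentiableOn ℂ F {z : ℂ | z.im < 0}
  cont : ContinuousOn F ({z : ℂ | z.im ≤ 0} \ exceptional q₀)
  boundary : ∀ z ∈ realSpectrum q₀, F z = f z

/-- Scattering data of the potential `q` at time `t`: the Jost solutions `ψ±`, the scattering matrix
`H` with `ψ₊ = ψ₋ H`, its inverse `S`, and the continuations `s₁₁, h₃₃` to the lower and
`s₃₃, h₁₁` to the upper half-plane. -/
structure ScatteringData (q₀ σ : ℝ) (q : ℝ → ℝ → Vec2) (t : ℝ) (qm qp : Vec2) where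
  ψm : ℝ → ℝ → Mat3
  ψp : ℝ → ℝ → Mat3
  H : ℝ → Mat3
  S : ℝ → Mat3
  s₁₁ : ℂ → ℂ
  s₃₃ : ℂ → ℂ
  h₁₁ : ℂ → ℂ
  h₃₃ : ℂ → ℂ
  jost_minus : IsJost q₀ σ q t atBot qm ψm
  jost_plus : IsJost q₀ σ q t atTop qp ψp
  scattering : ∀ z ∈ realSpectrum q₀, ∀ x : ℝ, ψp z x = ψm z x * H z
  inverse : ∀ z ∈ realSpectrum q₀, H z * S z = 1 ∧ S z * H z = 1
  s₁₁_ext : ExtendsToLower q₀ (fun z => S z 0 0) s₁₁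
  s₃₃_ext : ExtendsToUpper q₀ (fun z => S z 2 2) s₃₃
  h₁₁_ext : ExtendsToUpper q₀ (fun z => H z 0 0) h₁₁
  h₃₃_ext : ExtendsToLower q₀ (fun z => H z 2 2) h₃₃

/-- `ϑ₁ = ∫ (q₊† q)(q† q₋) dx`. -/
def thetaOne (q : ℝ → ℝ → Vec2) (t : ℝ) (qm qp : Vec2) : ℂ :=
  ∫ x : ℝ, inner ℂ qp (q x t) * inner ℂ (q x t) qm

end CoupledHirota

end

/-!
The columns of the Jost solutions that decay in a half-plane are Neumann series of Volterra
equations in which the spectral parameter enters through a bounded semigroup; this gives their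
holomorphy and their expansions as `z → ∞`. For real `z` the form `u† J v` is constant along
pairs of solutions, so the diagonal scattering coefficients are values of this form on a solution
normalized at `-∞` and one normalized at `+∞`. The reflection `x ↦ -x` exchanges the two
normalizations, and the inversion `z ↦ q₀² / z`, under which `k` is invariant, exchanges the
behaviour at `0` and at `∞`, so the expansions at `∞` of the solutions normalized at `-∞` suffice.
As `q₊ ⟂ q₋`, the leading terms cancel, and `ϑ₁` is what remains at order `1 / z`. The extensions
are determined by their boundary values on the real axis.
-/

noncomputable section

namespace CoupledHirota

section Integration

variable {F : Type*} [NormedAddCommGroup F] [NormedSpace ℝ F]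

theorem hasDerivAt_integral_Iic [CompleteSpace F] {f : ℝ → F} (hf : Continuous f)
    (hi : ∀ x, IntegrableOn f (Set.Iic x)) (x : ℝ) :
    HasDerivAt (fun x => ∫ y in Set.Iic x, f y) (f x) x := by
  have hsplit : (fun x => ∫ y in Set.Iic x, f y)
      = fun x => (∫ y in Set.Iic 0, f y) + ∫ y in (0 : ℝ)..x, f y := by
    ext x
    rw [← intervalIntegral.integral_Iic_sub_Iic (hi 0) (hi x), add_sub_cancel]
  rw [hsplit]
  exact (hf.integral_hasStrictDerivAt 0 x).hasDerivAt.const_add _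

theorem aestronglyMeasurable_deriv_of_differentiableAt {α E : Type*} [MeasurableSpace α]
    {μ : Measure α} [NormedAddCommGroup E] [NormedSpace ℂ E] {F : ℂ → α → E} {z₀ : ℂ}
    (hm : ∀ᶠ z in 𝓝 z₀, AEStronglyMeasurable (F z) μ)
    (hd : ∀ᵐ y ∂μ, DifferentiableAt ℂ (fun z => F z y) z₀) :
    AEStronglyMeasurable (fun y => deriv (fun z => F z y) z₀) μ := by
  have hm' : ∀ᶠ z in 𝓝[≠] z₀, AEStronglyMeasurable (fun y => slope (fun z => F z y) z₀ z) μ := by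
    filter_upwards [hm.filter_mono nhdsWithin_le_nhds] with z hz
    simp only [slope_def_module]
    exact (hz.sub hm.self_of_nhds).const_smul (z - z₀)⁻¹
  obtain ⟨u, hu, hum⟩ := exists_seq_forall_of_frequently hm'.frequently
  refine aestronglyMeasurable_of_tendsto_ae atTop hum ?_
  filter_upwards [hd] with y hy
  exact (hasDerivAt_iff_tendsto_slope.1 hy.hasDerivAt).comp hu

theorem differentiableOn_integral_of_dominated {α E : Type*} [MeasurableSpace α] {μ : Measure α}
    [NormedAddCommGroup E] [NormedSpace ℂ E] {F : ℂ → α → E} {bound : α → ℝ} {U : Set ℂ}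
    (hU : IsOpen U) (hm : ∀ z ∈ U, AEStronglyMeasurable (F z) μ)
    (hd : ∀ᵐ y ∂μ, DifferentiableOn ℂ (fun z => F z y) U)
    (hb : ∀ᵐ y ∂μ, ∀ z ∈ U, ‖F z y‖ ≤ bound y) (hbi : Integrable bound μ) :
    DifferentiableOn ℂ (fun z => ∫ y, F z y ∂μ) U := by
  intro z₀ hz₀
  obtain ⟨r, hr, hrU⟩ := Metric.isOpen_iff.1 hU z₀ hz₀
  have hball : ∀ z ∈ Metric.ball z₀ (r / 2), Metric.closedBall z (r / 4) ⊆ U := fun z hz w hw =>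
    hrU (by
      rw [Metric.mem_ball] at hz ⊢
      linarith [dist_triangle w z z₀, Metric.mem_closedBall.1 hw])
  have hdiff : ∀ᵐ y ∂μ, ∀ z ∈ Metric.ball z₀ (r / 2), DifferentiableAt ℂ (fun z => F z y) z := by
    filter_upwards [hd] with y hy z hz
    exact hy.differentiableAt
      (hU.mem_nhds (hball z hz (Metric.mem_closedBall_self (by positivity))))
  have hz₀' : z₀ ∈ Metric.ball z₀ (r / 2) := Metric.mem_ball_self (by positivity)
  have hm' : ∀ᶠ z in 𝓝 z₀, AEStronglyMeasurable (F z) μ := by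
    filter_upwards [hU.mem_nhds hz₀] with z hz using hm z hz
  refine (hasDerivAt_integral_of_dominated_loc_of_deriv_le (𝕜 := ℂ)
    (F' := fun z y => deriv (fun z => F z y) z) (bound := fun y => bound y / (r / 4))
    (Metric.ball_mem_nhds z₀ (half_pos hr)) hm'
    (Integrable.mono' hbi (hm z₀ hz₀) (hb.mono fun y hy => hy z₀ hz₀))
    (aestronglyMeasurable_deriv_of_differentiableAt hm' (hdiff.mono fun y hy => hy z₀ hz₀'))
    ?_ (hbi.div_const _)
    (hdiff.mono fun y hy z hz => (hy z hz).hasDerivAt)).2.differentiableAt.differentiableWithinAt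
  filter_upwards [hd, hb] with y hy hby z hz
  exact Complex.norm_deriv_le_of_forall_mem_sphere_norm_le (by positivity)
    (hy.diffContOnCl_ball (hball z hz))
    fun w hw => hby w (hball z hz (Metric.sphere_subset_closedBall hw))

end Integration

section OperatorExponential

variable {E : Type*} [NormedAddCommGroup E] [NormedSpace ℂ E] [CompleteSpace E]

theorem exp_add_smul (A : E →L[ℂ] E) (s t : ℝ) :
    NormedSpace.exp ((s + t) • A) = NormedSpace.exp (s • A) * NormedSpace.exp (t • A) := by
  let := NormedAlgebra.restrictScalars ℚ ℂ (E →L[ℂ] E)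
  rw [add_smul]
  exact NormedSpace.exp_add_of_commute (((Commute.refl A).smul_left s).smul_right t)

theorem continuous_exp_smul (A : E →L[ℂ] E) : Continuous fun s : ℝ => NormedSpace.exp (s • A) :=
  continuous_iff_continuousAt.2 fun s => (hasDerivAt_exp_smul_const A s).continuousAt

theorem hasDerivAt_exp_smul_apply (A : E →L[ℂ] E) {u : ℝ → E} {u' : E} {s : ℝ}
    (hu : HasDerivAt u u' s) :
    HasDerivAt (fun s : ℝ => NormedSpace.exp (s • A) (u s))
      (A (NormedSpace.exp (s • A) (u s)) + NormedSpace.exp (s • A) u') s :=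
  ((ContinuousLinearMap.restrictScalarsL ℂ E E ℝ ℝ).hasFDerivAt.comp_hasDerivAt s
    (hasDerivAt_exp_smul_const' A s)).clm_apply hu

theorem exp_apply_of_eigenvector {A : E →L[ℂ] E} {v : E} {c : ℂ} (h : A v = c • v) :
    NormedSpace.exp A v = Complex.exp c • v := by
  have hpow : ∀ n : ℕ, (A ^ n) v = c ^ n • v := fun n => by
    induction n with
    | zero => rw [pow_zero, pow_zero, one_smul, one_apply_eq_self]
    | succ n ih =>
      rw [pow_succ', mul_apply_eq_comp, ih, map_smul, h, smul_smul, pow_succ]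
  have hA := (ContinuousLinearMap.apply ℂ E v).hasSum
    (NormedSpace.exp_series_hasSum_exp' (𝕂 := ℂ) A)
  have hc := (NormedSpace.exp_series_hasSum_exp' (𝕂 := ℂ) c).smul_const v
  rw [← Complex.exp_eq_exp_ℂ] at hc
  refine hA.unique (hc.congr_fun fun n => ?_)
  simp only [ContinuousLinearMap.apply_apply, smul_apply, hpow, smul_smul, smul_eq_mul]

end OperatorExponential

section Volterra

variable {E : Type*} [NormedAddCommGroup E] [NormedSpace ℂ E]

/-- `∫_{-∞}^x ‖B‖`. -/
def cumNorm (B : ℝ → E →L[ℂ] E) (x : ℝ) : ℝ := ∫ y in Set.Iic x, ‖B y‖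

/-- The weight in which the Volterra operator of a kernel bounded by `M ‖B‖` contracts by the
factor `1/2`. -/
def volterraWeight (B : ℝ → E →L[ℂ] E) (M x : ℝ) : ℝ := Real.exp (2 * M * cumNorm B x)

/-- The operator `f ↦ ∫_{-∞}^x e^{(x-y)A} B(y) f(y) dy`, whose fixed points up to a constant
solve `w' = (A + B) w`. -/
def volterraOp (A : E →L[ℂ] E) (B : ℝ → E →L[ℂ] E) (f : ℝ → E) (x : ℝ) : E :=
  ∫ y in Set.Iic x, NormedSpace.exp ((x - y) • A) (B y (f y))

/-- The Neumann series of `w = a + volterraOp A B w`: the solution of `w' = (A + B) w` with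
`w(-∞) = a`, for `a` in the kernel of `A`. -/
def volterraSol (A : E →L[ℂ] E) (B : ℝ → E →L[ℂ] E) (a : E) (x : ℝ) : E :=
  ∑' n, (volterraOp A B)^[n] (fun _ => a) x

/-- The hypotheses under which `w' = (A + B) w` is solved from `-∞`: the semigroup generated by `A`
is bounded by `M` and the perturbation `B` is integrable at `-∞`. -/
structure IsIntegrablePerturbation (A : E →L[ℂ] E) (B : ℝ → E →L[ℂ] E) (M : ℝ) : Prop where
  norm_exp_le : ∀ s : ℝ, 0 ≤ s → ‖NormedSpace.exp (s • A)‖ ≤ M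
  continuous : Continuous B
  integrableOn : ∀ x, IntegrableOn B (Set.Iic x)

variable {A : E →L[ℂ] E} {B : ℝ → E →L[ℂ] E} {a : E} {M K : ℝ} {f : ℝ → E}

theorem cumNorm_nonneg (x : ℝ) : 0 ≤ cumNorm B x :=
  integral_nonneg fun _ => norm_nonneg _

theorem volterraWeight_nonneg (x : ℝ) : 0 ≤ volterraWeight B M x :=
  (Real.exp_pos _).le

theorem volterraOp_iterate_succ (g : ℝ → E) (n : ℕ) :
    (volterraOp A B)^[n + 1] g = volterraOp A B ((volterraOp A B)^[n] g) :=
  Function.iterate_succ_apply' _ _ _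

theorem tendsto_volterraWeight : Tendsto (volterraWeight B M) atBot (𝓝 1) := by
  have hcum : Tendsto (cumNorm B) atBot (𝓝 0) := tendsto_integral_Iic_zero tendsto_id
  have := (Real.continuous_exp.tendsto _).comp (hcum.const_mul (2 * M))
  rwa [mul_zero, Real.exp_zero] at this

theorem hasSum_geometric_volterraWeight (x : ℝ) :
    HasSum (fun n : ℕ => ‖a‖ * (1 / 2) ^ n * volterraWeight B M x)
      (‖a‖ * 2 * volterraWeight B M x) :=
  (hasSum_geometric_two.mul_left _).mul_right _

namespace IsIntegrablePerturbation

theorem bound_nonneg (h : IsIntegrablePerturbation A B M) : 0 ≤ M :=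
  (norm_nonneg _).trans (h.norm_exp_le 0 le_rfl)

theorem hasDerivAt_cumNorm (h : IsIntegrablePerturbation A B M) (x : ℝ) :
    HasDerivAt (cumNorm B) ‖B x‖ x :=
  hasDerivAt_integral_Iic h.continuous.norm (fun x => (h.integrableOn x).norm) x

theorem monotone_cumNorm (h : IsIntegrablePerturbation A B M) : Monotone (cumNorm B) :=
  monotone_of_hasDerivAt_nonneg h.hasDerivAt_cumNorm fun _ => norm_nonneg _

theorem one_le_volterraWeight (h : IsIntegrablePerturbation A B M) (x : ℝ) :
    1 ≤ volterraWeight B M x :=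
  Real.one_le_exp (mul_nonneg (mul_nonneg zero_le_two h.bound_nonneg) (cumNorm_nonneg x))

theorem monotone_volterraWeight (h : IsIntegrablePerturbation A B M) :
    Monotone (volterraWeight B M) := fun _ _ hxy =>
  Real.exp_le_exp.2 (mul_le_mul_of_nonneg_left (h.monotone_cumNorm hxy)
    (mul_nonneg zero_le_two h.bound_nonneg))

theorem hasDerivAt_volterraWeight (h : IsIntegrablePerturbation A B M) (x : ℝ) :
    HasDerivAt (volterraWeight B M) (2 * (M * (‖B x‖ * volterraWeight B M x))) x :=
  ((h.hasDerivAt_cumNorm x).const_mul (2 * M)).exp.congr_deriv (by rw [volterraWeight]; ring)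

theorem continuous_volterraWeight (h : IsIntegrablePerturbation A B M) :
    Continuous (volterraWeight B M) :=
  continuous_iff_continuousAt.2 fun x => (h.hasDerivAt_volterraWeight x).continuousAt

theorem integrableOn_mul_volterraWeight (h : IsIntegrablePerturbation A B M) (x : ℝ) :
    IntegrableOn (fun y => M * (‖B y‖ * volterraWeight B M y)) (Set.Iic x) := by
  refine Integrable.const_mul (Integrable.mono' ((h.integrableOn x).norm.mul_const
    (volterraWeight B M x)) (h.continuous.norm.mul h.continuous_volterraWeight).aestronglyMeasurable
    ((ae_restrict_iff' measurableSet_Iic).2 (Eventually.of_forall fun y hy => ?_))) M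
  rw [Pi.mul_apply, Real.norm_of_nonneg (mul_nonneg (norm_nonneg _) (volterraWeight_nonneg y))]
  exact mul_le_mul_of_nonneg_left (h.monotone_volterraWeight hy) (norm_nonneg _)

theorem integral_mul_volterraWeight (h : IsIntegrablePerturbation A B M) (x : ℝ) :
    ∫ y in Set.Iic x, M * (‖B y‖ * volterraWeight B M y)
      = (volterraWeight B M x - 1) / 2 := by
  have := integral_Iic_of_hasDerivAt_of_tendsto'
    (fun y (_ : y ∈ Set.Iic x) => h.hasDerivAt_volterraWeight y)
    ((h.integrableOn_mul_volterraWeight x).const_mul 2) (tendsto_volterraWeight (M := M))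
  rw [integral_const_mul] at this
  linarith

theorem norm_exp_apply_le (h : IsIntegrablePerturbation A B M)
    (hf : ∀ y, ‖f y‖ ≤ K * volterraWeight B M y) {x y : ℝ} (hxy : y ≤ x) :
    ‖NormedSpace.exp ((x - y) • A) (B y (f y))‖ ≤ K * (M * (‖B y‖ * volterraWeight B M y)) :=
  calc ‖NormedSpace.exp ((x - y) • A) (B y (f y))‖ ≤ M * ‖B y (f y)‖ :=
        ContinuousLinearMap.le_of_opNorm_le _ (h.norm_exp_le _ (sub_nonneg.2 hxy)) _
    _ ≤ M * (‖B y‖ * (K * volterraWeight B M y)) :=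
        mul_le_mul_of_nonneg_left ((B y).le_opNorm_of_le (hf y)) h.bound_nonneg
    _ = K * (M * (‖B y‖ * volterraWeight B M y)) := by ring

theorem ae_norm_exp_apply_le (h : IsIntegrablePerturbation A B M)
    (hf : ∀ y, ‖f y‖ ≤ K * volterraWeight B M y) (x : ℝ) :
    ∀ᵐ y ∂volume.restrict (Set.Iic x), ‖NormedSpace.exp ((x - y) • A) (B y (f y))‖
      ≤ K * (M * (‖B y‖ * volterraWeight B M y)) :=
  (ae_restrict_iff' measurableSet_Iic).2 (Eventually.of_forall fun _ hy =>
    h.norm_exp_apply_le hf hy)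

theorem norm_volterraOp_le (h : IsIntegrablePerturbation A B M)
    (hf : ∀ y, ‖f y‖ ≤ K * volterraWeight B M y) (x : ℝ) :
    ‖volterraOp A B f x‖ ≤ K * ((volterraWeight B M x - 1) / 2) := by
  rw [← h.integral_mul_volterraWeight, ← integral_const_mul]
  exact norm_integral_le_of_norm_le ((h.integrableOn_mul_volterraWeight x).const_mul K)
    (h.ae_norm_exp_apply_le hf x)

theorem norm_iterate_le (h : IsIntegrablePerturbation A B M) (n : ℕ) (x : ℝ) :
    ‖(volterraOp A B)^[n] (fun _ => a) x‖ ≤ ‖a‖ * (1 / 2) ^ n * volterraWeight B M x := by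
  induction n generalizing x with
  | zero =>
    rw [pow_zero, mul_one]
    exact le_mul_of_one_le_right (norm_nonneg a) (h.one_le_volterraWeight x)
  | succ n ih =>
    rw [volterraOp_iterate_succ]
    calc ‖volterraOp A B ((volterraOp A B)^[n] fun _ => a) x‖
        ≤ ‖a‖ * (1 / 2) ^ n * ((volterraWeight B M x - 1) / 2) := h.norm_volterraOp_le ih x
      _ ≤ ‖a‖ * (1 / 2) ^ n * (volterraWeight B M x / 2) := by gcongr; linarith
      _ = ‖a‖ * (1 / 2) ^ (n + 1) * volterraWeight B M x := by ring

theorem norm_volterraSol_le (h : IsIntegrablePerturbation A B M) (x : ℝ) :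
    ‖volterraSol A B a x‖ ≤ ‖a‖ * 2 * volterraWeight B M x :=
  tsum_of_norm_bounded (hasSum_geometric_volterraWeight x) fun n => h.norm_iterate_le n x

variable [CompleteSpace E]

theorem aestronglyMeasurable_exp_apply (h : IsIntegrablePerturbation A B M) (hf : Continuous f)
    (x : ℝ) : AEStronglyMeasurable (fun y => NormedSpace.exp ((x - y) • A) (B y (f y)))
      (volume.restrict (Set.Iic x)) :=
  (((continuous_exp_smul A).comp (continuous_const.sub continuous_id)).clm_apply
    (h.continuous.clm_apply hf)).aestronglyMeasurable

theorem integrableOn_exp_apply (h : IsIntegrablePerturbation A B M) (hf : Continuous f)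
    (hfb : ∀ y, ‖f y‖ ≤ K * volterraWeight B M y) (x : ℝ) :
    IntegrableOn (fun y => NormedSpace.exp ((x - y) • A) (B y (f y))) (Set.Iic x) :=
  Integrable.mono' ((h.integrableOn_mul_volterraWeight x).const_mul K)
    (h.aestronglyMeasurable_exp_apply hf x) (h.ae_norm_exp_apply_le hfb x)

theorem hasDerivAt_volterraOp (h : IsIntegrablePerturbation A B M) (hf : Continuous f)
    (hfb : ∀ y, ‖f y‖ ≤ K * volterraWeight B M y) (x : ℝ) :
    HasDerivAt (volterraOp A B f) (A (volterraOp A B f x) + B x (f x)) x := by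
  have hsplit : ∀ x y s : ℝ, NormedSpace.exp ((x - y) • A) (B y (f y))
      = NormedSpace.exp ((x - s) • A) (NormedSpace.exp ((s - y) • A) (B y (f y))) := fun x y s => by
    rw [← sub_add_sub_cancel x s y, exp_add_smul, mul_apply_eq_comp]
  have hi : ∀ x, IntegrableOn (fun y => NormedSpace.exp ((0 - y) • A) (B y (f y))) (Set.Iic x) :=
    fun x => by
      simp only [hsplit 0 _ x]
      exact ContinuousLinearMap.integrable_comp _ (h.integrableOn_exp_apply hf hfb x)
  have hop : volterraOp A B f = fun x => NormedSpace.exp (x • A)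
      (∫ y in Set.Iic x, NormedSpace.exp ((0 - y) • A) (B y (f y))) := by
    ext x
    rw [← ContinuousLinearMap.integral_comp_comm _ (hi x)]
    simp only [volterraOp, hsplit x _ 0, sub_zero]
  have hcont : Continuous fun y => NormedSpace.exp ((0 - y) • A) (B y (f y)) :=
    ((continuous_exp_smul A).comp (continuous_const.sub continuous_id)).clm_apply
      (h.continuous.clm_apply hf)
  rw [hop]
  refine (hasDerivAt_exp_smul_apply A (hasDerivAt_integral_Iic hcont hi x)).congr_deriv ?_
  have hcancel := hsplit x x 0
  rw [sub_self, zero_smul, NormedSpace.exp_zero, one_apply_eq_self, sub_zero] at hcancel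
  rw [← hcancel]

theorem continuous_iterate (h : IsIntegrablePerturbation A B M) (n : ℕ) :
    Continuous ((volterraOp A B)^[n] fun _ => a) := by
  induction n with
  | zero => exact continuous_const
  | succ n ih =>
    rw [volterraOp_iterate_succ]
    exact continuous_iff_continuousAt.2 fun x =>
      (h.hasDerivAt_volterraOp ih (h.norm_iterate_le n) x).continuousAt

theorem hasSum_volterraSol (h : IsIntegrablePerturbation A B M) (x : ℝ) :
    HasSum (fun n => (volterraOp A B)^[n] (fun _ => a) x) (volterraSol A B a x) :=
  (Summable.of_norm_bounded (hasSum_geometric_volterraWeight x).summable fun n =>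
    h.norm_iterate_le n x).hasSum

theorem continuous_volterraSol (h : IsIntegrablePerturbation A B M) :
    Continuous (volterraSol A B a) := by
  refine continuous_iff_continuousAt.2 fun x => ContinuousOn.continuousAt (s := Set.Iic (x + 1)) ?_
    (Iic_mem_nhds (lt_add_one x))
  refine continuousOn_tsum (fun n => (h.continuous_iterate n).continuousOn)
    (hasSum_geometric_volterraWeight (a := a) (B := B) (M := M) (x + 1)).summable fun n y hy =>
      (h.norm_iterate_le n y).trans ?_
  gcongr
  exact h.monotone_volterraWeight hy

theorem volterraSol_eq (h : IsIntegrablePerturbation A B M) (x : ℝ) :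
    volterraSol A B a x = a + volterraOp A B (volterraSol A B a) x := by
  have hint : HasSum (fun n => volterraOp A B ((volterraOp A B)^[n] fun _ => a) x)
      (volterraOp A B (volterraSol A B a) x) := by
    refine hasSum_integral_of_dominated_convergence
      (fun n y => ‖a‖ * (1 / 2) ^ n * (M * (‖B y‖ * volterraWeight B M y)))
      (fun n => h.aestronglyMeasurable_exp_apply (h.continuous_iterate n) x)
      (fun n => h.ae_norm_exp_apply_le (h.norm_iterate_le n) x)
      (Eventually.of_forall fun y => (summable_geometric_two.mul_left _).mul_right _) ?_
      (Eventually.of_forall fun y => ((NormedSpace.exp ((x - y) • A)).comp (B y)).hasSum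
        (h.hasSum_volterraSol y))
    simp only [tsum_mul_right]
    exact (h.integrableOn_mul_volterraWeight x).const_mul _
  rw [volterraSol, (h.hasSum_volterraSol x).summable.tsum_eq_zero_add]
  simp only [volterraOp_iterate_succ]
  rw [hint.tsum_eq, Function.iterate_zero_apply]

theorem norm_volterraSol_sub_le (h : IsIntegrablePerturbation A B M) (x : ℝ) :
    ‖volterraSol A B a x - a‖ ≤ ‖a‖ * (volterraWeight B M x - 1) := by
  rw [h.volterraSol_eq, add_sub_cancel_left]
  exact (h.norm_volterraOp_le h.norm_volterraSol_le x).trans_eq (by ring)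

theorem tendsto_volterraSol (h : IsIntegrablePerturbation A B M) :
    Tendsto (volterraSol A B a) atBot (𝓝 a) := by
  rw [tendsto_iff_norm_sub_tendsto_zero]
  refine squeeze_zero (fun _ => norm_nonneg _) h.norm_volterraSol_sub_le ?_
  simpa only [sub_self, mul_zero] using
    ((tendsto_volterraWeight (B := B) (M := M)).sub_const 1).const_mul ‖a‖

theorem hasDerivAt_volterraSol (h : IsIntegrablePerturbation A B M) (ha : A a = 0) (x : ℝ) :
    HasDerivAt (volterraSol A B a)
      (A (volterraSol A B a x) + B x (volterraSol A B a x)) x := by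
  have hder := (h.hasDerivAt_volterraOp h.continuous_volterraSol
    (h.norm_volterraSol_le (a := a)) x).const_add a
  rw [← funext h.volterraSol_eq] at hder
  refine hder.congr_deriv ?_
  have hA : A (volterraOp A B (volterraSol A B a) x) = A (volterraSol A B a x) := by
    conv_rhs => rw [h.volterraSol_eq, map_add, ha, zero_add]
  rw [hA]

end IsIntegrablePerturbation

section Parameter

variable {A : ℂ → E →L[ℂ] E} {B : ℝ → E →L[ℂ] E} {a : ℂ → E} {M K : ℝ} {U : Set ℂ}

theorem norm_iterate_le_of_norm_le (h : ∀ z ∈ U, IsIntegrablePerturbation (A z) B M)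
    (hK : ∀ z ∈ U, ‖a z‖ ≤ K) (n : ℕ) {z : ℂ} (hz : z ∈ U) (x : ℝ) :
    ‖(volterraOp (A z) B)^[n] (fun _ => a z) x‖ ≤ K * (1 / 2) ^ n * volterraWeight B M x :=
  ((h z hz).norm_iterate_le n x).trans (by
    have := volterraWeight_nonneg (B := B) (M := M) x
    gcongr
    exact hK z hz)

variable [CompleteSpace E]

theorem differentiableOn_exp_smul (hA : DifferentiableOn ℂ A U) (s : ℝ) :
    DifferentiableOn ℂ (fun z => NormedSpace.exp (s • A z)) U := fun z hz =>
  (NormedSpace.exp_analytic (𝕂 := ℂ) (s • A z)).differentiableAt.comp_differentiableWithinAt z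
    ((hA z hz).const_smul s)

theorem continuousOn_exp_smul (hA : ContinuousOn A U) (s : ℝ) :
    ContinuousOn (fun z => NormedSpace.exp (s • A z)) U := fun z hz =>
  (NormedSpace.exp_analytic (𝕂 := ℂ) (s • A z)).continuousAt.comp_continuousWithinAt
    (f := fun z => s • A z) ((hA z hz).const_smul s)

theorem differentiableOn_volterraOp_iterate (hU : IsOpen U)
    (h : ∀ z ∈ U, IsIntegrablePerturbation (A z) B M) (hK : ∀ z ∈ U, ‖a z‖ ≤ K)
    (hA : DifferentiableOn ℂ A U) (ha : DifferentiableOn ℂ a U) (n : ℕ) (x : ℝ) :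
    DifferentiableOn ℂ (fun z => (volterraOp (A z) B)^[n] (fun _ => a z) x) U := by
  rcases U.eq_empty_or_nonempty with rfl | ⟨z₀, hz₀⟩
  · exact differentiableOn_empty
  induction n generalizing x with
  | zero => exact ha
  | succ n ih =>
    simp only [volterraOp_iterate_succ]
    refine differentiableOn_integral_of_dominated hU
      (fun z hz => (h z hz).aestronglyMeasurable_exp_apply ((h z hz).continuous_iterate n) x)
      (Eventually.of_forall fun y => (differentiableOn_exp_smul hA _).clm_apply
        ((B y).differentiable.comp_differentiableOn (ih y)))
      ((ae_restrict_iff' measurableSet_Iic).2 (Eventually.of_forall fun y hy z hz =>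
        (h z hz).norm_exp_apply_le (norm_iterate_le_of_norm_le h hK n hz) hy))
      (((h z₀ hz₀).integrableOn_mul_volterraWeight x).const_mul _)

theorem differentiableOn_volterraSol (hU : IsOpen U)
    (h : ∀ z ∈ U, IsIntegrablePerturbation (A z) B M) (hK : ∀ z ∈ U, ‖a z‖ ≤ K)
    (hA : DifferentiableOn ℂ A U) (ha : DifferentiableOn ℂ a U) (x : ℝ) :
    DifferentiableOn ℂ (fun z => volterraSol (A z) B (a z) x) U :=
  Complex.differentiableOn_tsum_of_summable_norm
    ((summable_geometric_two.mul_left K).mul_right (volterraWeight B M x))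
    (fun n => differentiableOn_volterraOp_iterate hU h hK hA ha n x) hU
    fun n _ hz => norm_iterate_le_of_norm_le h hK n hz x

theorem continuousOn_volterraOp_iterate
    (h : ∀ z ∈ U, IsIntegrablePerturbation (A z) B M) (hK : ∀ z ∈ U, ‖a z‖ ≤ K)
    (hA : ContinuousOn A U) (ha : ContinuousOn a U) (n : ℕ) (x : ℝ) :
    ContinuousOn (fun z => (volterraOp (A z) B)^[n] (fun _ => a z) x) U := by
  rcases U.eq_empty_or_nonempty with rfl | ⟨z₀, hz₀⟩
  · exact continuousOn_empty _
  induction n generalizing x with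
  | zero => exact ha
  | succ n ih =>
    simp only [volterraOp_iterate_succ]
    refine continuousOn_of_dominated
      (fun z hz => (h z hz).aestronglyMeasurable_exp_apply ((h z hz).continuous_iterate n) x)
      (fun z hz => (h z hz).ae_norm_exp_apply_le (norm_iterate_le_of_norm_le h hK n hz) x)
      (((h z₀ hz₀).integrableOn_mul_volterraWeight x).const_mul _)
      (Eventually.of_forall fun y => (continuousOn_exp_smul hA _).clm_apply
        ((B y).continuous.comp_continuousOn (ih y)))

theorem continuousOn_volterraSol
    (h : ∀ z ∈ U, IsIntegrablePerturbation (A z) B M) (hK : ∀ z ∈ U, ‖a z‖ ≤ K)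
    (hA : ContinuousOn A U) (ha : ContinuousOn a U) (x : ℝ) :
    ContinuousOn (fun z => volterraSol (A z) B (a z) x) U :=
  continuousOn_tsum (fun n => continuousOn_volterraOp_iterate h hK hA ha n x)
    ((summable_geometric_two.mul_left K).mul_right (volterraWeight B M x))
    fun n _ hz => norm_iterate_le_of_norm_le h hK n hz x

end Parameter

end Volterra

section Eigenbasis

variable {E : Type*} [NormedAddCommGroup E] [NormedSpace ℂ E] [CompleteSpace E] {ι : Type*}
  [Fintype ι] {A : E →L[ℂ] E} {e : ι → E} {φ : ι → E →L[ℂ] ℂ} {c : ι → ℂ}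

theorem norm_exp_smul_le_of_eigenbasis (hA : ∀ j, A (e j) = c j • e j)
    (he : ∀ u, ∑ j, φ j u • e j = u) (hc : ∀ j, (c j).re ≤ 0) {s : ℝ} (hs : 0 ≤ s) :
    ‖NormedSpace.exp (s • A)‖ ≤ ∑ j, ‖φ j‖ * ‖e j‖ := by
  refine ContinuousLinearMap.opNorm_le_bound _ (by positivity) fun u => ?_
  have hexp : ∀ j, NormedSpace.exp (s • A) (e j) = Complex.exp (s * c j) • e j := fun j =>
    exp_apply_of_eigenvector (by
      rw [smul_apply, hA, ← Complex.coe_smul, smul_smul])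
  have hle : ∀ j, ‖Complex.exp (s * c j)‖ ≤ 1 := fun j => by
    rw [Complex.norm_exp, Real.exp_le_one_iff, Complex.re_ofReal_mul]
    exact mul_nonpos_of_nonneg_of_nonpos hs (hc j)
  calc ‖NormedSpace.exp (s • A) u‖ = ‖∑ j, φ j u • Complex.exp (s * c j) • e j‖ := by
        conv_lhs => rw [← he u, map_sum]
        simp only [map_smul, hexp]
    _ ≤ ∑ j, ‖φ j u • Complex.exp (s * c j) • e j‖ := norm_sum_le _ _
    _ ≤ ∑ j, ‖φ j‖ * ‖u‖ * (1 * ‖e j‖) := Finset.sum_le_sum fun j _ => by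
        rw [norm_smul, norm_smul]
        gcongr
        exacts [(φ j).le_opNorm u, hle j]
    _ = (∑ j, ‖φ j‖ * ‖e j‖) * ‖u‖ := by
        rw [Finset.sum_mul]
        exact Finset.sum_congr rfl fun j _ => by ring

end Eigenbasis

section SpectralData

attribute [local instance] Matrix.normedAddCommGroup Matrix.normedSpace

/-- The action of matrices on column vectors, as a continuous linear map in both arguments. -/
def matCLM : Mat3 →L[ℂ] (Fin 3 → ℂ) →L[ℂ] (Fin 3 → ℂ) :=
  LinearMap.toContinuousLinearMap
    (LinearMap.toContinuousLinearMap.toLinearMap ∘ₗ Matrix.toLin'.toLinearMap)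

theorem matCLM_apply (A : Mat3) (u : Fin 3 → ℂ) : matCLM A u = A.mulVec u := rfl

/-- The eigenvectors of `matX q₀ v z` for `‖v‖ = q₀`. -/
def eigCol (q₀ : ℝ) (v : Vec2) (z : ℂ) : Fin 3 → Fin 3 → ℂ :=
  ![![1, v 0 / z, v 1 / z], ![0, perp v 0, perp v 1], ![(q₀ : ℂ) ^ 2 / z, v 0, v 1]]

/-- The basis dual to `eigCol`. -/
def eigRow (q₀ : ℝ) (v : Vec2) (z : ℂ) : Fin 3 → Fin 3 → ℂ :=
  ![![rhoHat q₀ z, -(rhoHat q₀ z * star (v 0) / z), -(rhoHat q₀ z * star (v 1) / z)],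
    ![0, star (perp v 0) / (q₀ : ℂ) ^ 2, star (perp v 1) / (q₀ : ℂ) ^ 2],
    ![-(rhoHat q₀ z / z), rhoHat q₀ z * star (v 0) / (q₀ : ℂ) ^ 2,
      rhoHat q₀ z * star (v 1) / (q₀ : ℂ) ^ 2]]

/-- The coordinate functionals of the basis `eigCol`. -/
def eigCoord (q₀ : ℝ) (v : Vec2) (z : ℂ) (j : Fin 3) : (Fin 3 → ℂ) →L[ℂ] ℂ :=
  ∑ l, eigRow q₀ v z j l • ContinuousLinearMap.proj l

/-- The frequencies: `matX q₀ v z` has the eigenvalues `i freq`. -/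
def freq (q₀ : ℝ) (z : ℂ) : Fin 3 → ℂ := ![lamOf q₀ z, -kOf q₀ z, -lamOf q₀ z]

/-- A bound for the semigroups generated by `matX q₀ v z - i freq j₀` when no frequency
grows faster than the `j₀`-th. -/
def eigBound (q₀ : ℝ) (v : Vec2) (z : ℂ) : ℝ := ∑ j, ‖eigCoord q₀ v z j‖ * ‖eigCol q₀ v z j‖

variable {q₀ : ℝ} {v : Vec2} {z : ℂ}

theorem matX_mulVec (φ : Fin 3 → ℂ) :
    (matX q₀ v z).mulVec φ = ![I * kOf q₀ z * φ 0 - I * (star (v 0) * φ 1 + star (v 1) * φ 2),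
      I * v 0 * φ 0 - I * kOf q₀ z * φ 1, I * v 1 * φ 0 - I * kOf q₀ z * φ 2] := by
  ext i
  fin_cases i <;>
    simp [matX, matJ, matQ, Matrix.mulVec, dotProduct, Fin.sum_univ_three, Matrix.diagonal] <;> ring

theorem vec2_norm_sq (v : Vec2) : v 0 * star (v 0) + v 1 * star (v 1) = (‖v‖ : ℂ) ^ 2 := by
  rw [← Complex.ofReal_pow, EuclideanSpace.norm_sq_eq]
  simp [Complex.mul_conj, Complex.normSq_eq_norm_sq]

theorem perp_zero (v : Vec2) : perp v 0 = star (v 1) := rfl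

theorem perp_one (v : Vec2) : perp v 1 = -star (v 0) := rfl

theorem norm_perp (v : Vec2) : ‖perp v‖ = ‖v‖ := by
  rw [EuclideanSpace.norm_eq, EuclideanSpace.norm_eq]
  simp only [Fin.sum_univ_two, perp_zero, perp_one, norm_neg, norm_star, add_comm]

theorem not_mem_exceptional_iff :
    z ∉ exceptional q₀ ↔ z ≠ 0 ∧ z ^ 2 - (q₀ : ℂ) ^ 2 ≠ 0 := by
  simp only [exceptional, Set.mem_insert_iff, Set.mem_singleton_iff, not_or,
    ← sq_eq_sq_iff_eq_or_eq_neg, sub_ne_zero, ne_eq]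

theorem finite_exceptional (q₀ : ℝ) : (exceptional q₀).Finite :=
  ((Set.finite_singleton _).insert _).insert _

theorem isOpen_compl_exceptional : IsOpen (exceptional q₀)ᶜ :=
  (finite_exceptional q₀).isClosed.isOpen_compl

theorem eventually_cofinite_not_mem_exceptional (q₀ : ℝ) : ∀ᶠ z in cofinite, z ∉ exceptional q₀ :=
  (finite_exceptional q₀).eventually_cofinite_notMem

theorem not_mem_exceptional_of_im_ne_zero (hz : z.im ≠ 0) : z ∉ exceptional q₀ := by
  rintro (rfl | rfl | rfl) <;> simp at hz

theorem matX_mulVec_eigCol (hz : z ≠ 0) (hv : ‖v‖ = q₀) (j : Fin 3) :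
    (matX q₀ v z).mulVec (eigCol q₀ v z j) = (I * freq q₀ z j) • eigCol q₀ v z j := by
  have hn := vec2_norm_sq v
  rw [hv] at hn
  simp only [← starRingEnd_apply] at hn
  rw [matX_mulVec]
  ext i
  fin_cases j <;> fin_cases i <;>
    simp [eigCol, freq, kOf, lamOf, perp_zero, perp_one] <;> field_simp <;>
    first | ring1 | linear_combination (-2 : ℂ) * hn | linear_combination (-2 * z ^ 2) * hn

theorem sum_eigCol_mul_eigRow (hq : q₀ ≠ 0) (hz : z ∉ exceptional q₀) (hv : ‖v‖ = q₀)
    (i l : Fin 3) : ∑ j, eigCol q₀ v z j i * eigRow q₀ v z j l = if i = l then 1 else 0 := by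
  obtain ⟨hz0, hz1⟩ := not_mem_exceptional_iff.1 hz
  have hn := vec2_norm_sq v
  rw [hv] at hn
  simp only [← starRingEnd_apply] at hn
  have hq' : (q₀ : ℂ) ≠ 0 := Complex.ofReal_ne_zero.2 hq
  rw [Fin.sum_univ_three]
  fin_cases i <;> fin_cases l <;>
    simp [eigCol, eigRow, rhoHat, perp_zero, perp_one] <;> field_simp <;>
    first
    | ring1
    | linear_combination hn
    | linear_combination -hn
    | linear_combination (z ^ 2 - q₀ ^ 2) * hn

theorem eigCoord_apply (j : Fin 3) (u : Fin 3 → ℂ) :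
    eigCoord q₀ v z j u = ∑ l, eigRow q₀ v z j l * u l := by
  simp only [eigCoord, sum_apply, smul_apply, ContinuousLinearMap.proj_apply, smul_eq_mul]

theorem eigCoord_eigCol (hq : q₀ ≠ 0) (hz : z ∉ exceptional q₀) (hv : ‖v‖ = q₀) (i j : Fin 3) :
    eigCoord q₀ v z i (eigCol q₀ v z j) = if i = j then 1 else 0 := by
  have hinv : Matrix.of (fun i j => eigCol q₀ v z j i) * Matrix.of (eigRow q₀ v z) = 1 := by
    ext i l
    rw [Matrix.mul_apply, Matrix.one_apply, ← sum_eigCol_mul_eigRow hq hz hv]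
    rfl
  rw [eigCoord_apply, ← Matrix.one_apply, ← mul_eq_one_comm.1 hinv, Matrix.mul_apply]
  rfl

theorem sum_eigCoord_smul_eigCol (hq : q₀ ≠ 0) (hz : z ∉ exceptional q₀) (hv : ‖v‖ = q₀)
    (u : Fin 3 → ℂ) : ∑ j, eigCoord q₀ v z j u • eigCol q₀ v z j = u := by
  ext i
  calc (∑ j, eigCoord q₀ v z j u • eigCol q₀ v z j) i
      = ∑ l, (∑ j, eigCol q₀ v z j i * eigRow q₀ v z j l) * u l := by
        simp only [Finset.sum_apply, Pi.smul_apply, smul_eq_mul, eigCoord_apply, Finset.sum_mul]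
        rw [Finset.sum_comm]
        exact Finset.sum_congr rfl fun l _ => Finset.sum_congr rfl fun j _ => by ring
    _ = u i := by
        simp only [sum_eigCol_mul_eigRow hq hz hv, ite_mul, one_mul, zero_mul, Finset.sum_ite_eq,
          Finset.mem_univ, if_true]

theorem differentiableAt_rhoHat (hz : z ∉ exceptional q₀) : DifferentiableAt ℂ (rhoHat q₀) z := by
  have := (not_mem_exceptional_iff.1 hz).2
  unfold rhoHat
  fun_prop (disch := assumption)

theorem differentiableAt_kOf (hz : z ≠ 0) : DifferentiableAt ℂ (kOf q₀) z := by
  unfold kOf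
  fun_prop (disch := assumption)

theorem differentiableAt_lamOf (hz : z ≠ 0) : DifferentiableAt ℂ (lamOf q₀) z := by
  unfold lamOf
  fun_prop (disch := assumption)

theorem differentiableAt_freq (hz : z ≠ 0) (j : Fin 3) :
    DifferentiableAt ℂ (fun z => freq q₀ z j) z := by
  fin_cases j
  exacts [differentiableAt_lamOf hz, (differentiableAt_kOf hz).fun_neg,
    (differentiableAt_lamOf hz).fun_neg]

theorem differentiableAt_eigCol (hz : z ≠ 0) (j : Fin 3) :
    DifferentiableAt ℂ (fun z => eigCol q₀ v z j) z := by
  refine differentiableAt_pi.2 fun i => ?_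
  fin_cases j <;> fin_cases i <;>
    simp only [eigCol, Fin.zero_eta, Fin.mk_one, Fin.reduceFinMk, Matrix.cons_val] <;>
    fun_prop (disch := assumption)

theorem continuousAt_eigCoord (hz : z ∉ exceptional q₀) (j : Fin 3) :
    ContinuousAt (fun z => eigCoord q₀ v z j) z := by
  have hr := (differentiableAt_rhoHat hz).continuousAt
  have hz0 := (not_mem_exceptional_iff.1 hz).1
  refine tendsto_finsetSum _ fun l _ => Tendsto.smul ?_ tendsto_const_nhds
  change ContinuousAt (fun z => eigRow q₀ v z j l) z
  fin_cases j <;> fin_cases l <;>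
    simp only [eigRow, Fin.zero_eta, Fin.mk_one, Fin.reduceFinMk, Matrix.cons_val] <;>
    fun_prop (disch := assumption)

theorem continuousAt_eigBound (hz : z ∉ exceptional q₀) : ContinuousAt (eigBound q₀ v) z :=
  tendsto_finsetSum _ fun j _ => (continuousAt_eigCoord hz j).norm.mul
    (differentiableAt_eigCol (not_mem_exceptional_iff.1 hz).1 j).continuousAt.norm

theorem tendsto_rhoHat_cobounded : Tendsto (rhoHat q₀) (Bornology.cobounded ℂ) (𝓝 1) := by
  have hinv : Tendsto (fun z : ℂ => (1 - (q₀ : ℂ) ^ 2 * z⁻¹ ^ 2)⁻¹) (Bornology.cobounded ℂ)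
      (𝓝 (1 - (q₀ : ℂ) ^ 2 * 0 ^ 2)⁻¹) :=
    (tendsto_const_nhds.sub ((tendsto_inv₀_cobounded.pow 2).const_mul _)).inv₀ (by norm_num)
  rw [zero_pow two_ne_zero, mul_zero, sub_zero, inv_one] at hinv
  refine hinv.congr' ?_
  filter_upwards [Filter.hasBasis_cobounded_norm.mem_of_mem (i := 1) trivial] with z hz
  have hz0 : z ≠ 0 := norm_pos_iff.1 (zero_lt_one.trans_le hz)
  rw [rhoHat, ← inv_div, sub_div, div_self (pow_ne_zero 2 hz0), div_eq_mul_inv _ (z ^ 2), inv_pow]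

theorem tendsto_eigCol_cobounded (j : Fin 3) :
    Tendsto (fun z => eigCol q₀ v z j) (Bornology.cobounded ℂ)
      (𝓝 (![![1, 0, 0], ![0, perp v 0, perp v 1], ![0, v 0, v 1]] j)) := by
  have hdiv : ∀ c : ℂ, Tendsto (fun z : ℂ => c / z) (Bornology.cobounded ℂ) (𝓝 0) := fun c => by
    simpa only [div_eq_mul_inv, mul_zero] using tendsto_inv₀_cobounded.const_mul c
  refine tendsto_pi_nhds.2 fun i => ?_
  fin_cases j <;> fin_cases i
  exacts [tendsto_const_nhds, hdiv _, hdiv _, tendsto_const_nhds, tendsto_const_nhds,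
    tendsto_const_nhds, hdiv _, tendsto_const_nhds, tendsto_const_nhds]

theorem exists_tendsto_eigRow_cobounded (j l : Fin 3) :
    ∃ c, Tendsto (fun z => eigRow q₀ v z j l) (Bornology.cobounded ℂ) (𝓝 c) := by
  have hr : ∀ c : ℂ, Tendsto (fun z => rhoHat q₀ z * c) (Bornology.cobounded ℂ) (𝓝 (1 * c)) :=
    fun c => tendsto_rhoHat_cobounded.mul_const c
  have hrz : ∀ c : ℂ, Tendsto (fun z => rhoHat q₀ z * c / z) (Bornology.cobounded ℂ)
      (𝓝 (1 * c * 0)) := fun c => by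
    simpa only [div_eq_mul_inv] using (hr c).mul tendsto_inv₀_cobounded
  have hrz1 := hrz 1
  simp only [mul_one] at hrz1
  fin_cases j <;> fin_cases l
  exacts [⟨_, tendsto_rhoHat_cobounded⟩, ⟨_, (hrz _).neg⟩, ⟨_, (hrz _).neg⟩,
    ⟨_, tendsto_const_nhds⟩, ⟨_, tendsto_const_nhds⟩, ⟨_, tendsto_const_nhds⟩,
    ⟨_, hrz1.neg⟩, ⟨_, (hr _).div_const _⟩, ⟨_, (hr _).div_const _⟩]

theorem exists_eventually_eigBound_le_cobounded :
    ∃ M, ∀ᶠ z in Bornology.cobounded ℂ, eigBound q₀ v z ≤ M := by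
  choose c hc using exists_tendsto_eigRow_cobounded (q₀ := q₀) (v := v)
  have hcoord : ∀ j, Tendsto (fun z => eigCoord q₀ v z j) (Bornology.cobounded ℂ)
      (𝓝 (∑ l, c j l • ContinuousLinearMap.proj l)) := fun j =>
    tendsto_finsetSum _ fun l _ => (hc j l).smul_const _
  exact ⟨_, (tendsto_finsetSum Finset.univ fun j _ => (hcoord j).norm.mul
    (tendsto_eigCol_cobounded j).norm).eventually_le_const (lt_add_one _)⟩

theorem im_sq_div_nonpos (hz : 0 ≤ z.im) : ((q₀ : ℂ) ^ 2 / z).im ≤ 0 := by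
  rw [div_eq_mul_inv, ← Complex.ofReal_pow, Complex.im_ofReal_mul, Complex.inv_im]
  exact mul_nonpos_of_nonneg_of_nonpos (sq_nonneg _)
    (div_nonpos_of_nonpos_of_nonneg (neg_nonpos.2 hz) (Complex.normSq_nonneg z))

theorem re_I_mul_freq_sub_nonpos (hz : 0 ≤ z.im) (j : Fin 3) :
    (I * (freq q₀ z j - freq q₀ z 2)).re ≤ 0 := by
  have him := im_sq_div_nonpos (q₀ := q₀) hz
  rw [Complex.I_mul_re, Complex.sub_im, neg_nonpos, sub_nonneg]
  fin_cases j <;> simp [freq, kOf, lamOf] <;> linarith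

theorem freq_ofReal_im (z : ℝ) (j : Fin 3) : (freq q₀ (z : ℂ) j).im = 0 := by
  have : ((q₀ : ℂ) ^ 2 / (z : ℂ)).im = 0 := by
    rw [← Complex.ofReal_pow, ← Complex.ofReal_div, Complex.ofReal_im]
  fin_cases j <;> simp [freq, kOf, lamOf, this]

end SpectralData

section LeftSolution

attribute [local instance] Matrix.normedAddCommGroup Matrix.normedSpace

/-- A potential with the regularity and decay needed for the Jost solutions normalized at `-∞`. -/
structure LeftPotential (q₀ : ℝ) (q : ℝ → Vec2) (v : Vec2) : Prop where
  pos : 0 < q₀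
  norm_eq : ‖v‖ = q₀
  tendsto : Tendsto q atBot (𝓝 v)
  integrableOn : IntegrableOn (fun x => (1 + |x|) • (q x - v)) (Set.Iic 0)
  diff : Differentiable ℝ q
  deriv_integrableOn : IntegrableOn (deriv q) (Set.Iic 0)

/-- The unperturbed generator `X - i freq j₀`, which annihilates the `j₀`-th eigenvector. -/
def shiftedX (q₀ : ℝ) (v : Vec2) (j₀ : Fin 3) (z : ℂ) : (Fin 3 → ℂ) →L[ℂ] (Fin 3 → ℂ) :=
  matCLM (matX q₀ v z) - (I * freq q₀ z j₀) • ContinuousLinearMap.id ℂ (Fin 3 → ℂ)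

/-- The perturbation `i (Q(q(x)) - Q(v))` as an operator. -/
def potPerturb (q : ℝ → Vec2) (v : Vec2) (x : ℝ) : (Fin 3 → ℂ) →L[ℂ] (Fin 3 → ℂ) :=
  matCLM (I • matQ (q x - v))

/-- The solution `w` of `w' = (X - i freq j₀) w` that tends to the `j₀`-th eigenvector
at `-∞`. -/
def leftSol (q₀ : ℝ) (q : ℝ → Vec2) (v : Vec2) (j₀ : Fin 3) (z : ℂ) (x : ℝ) : Fin 3 → ℂ :=
  volterraSol (shiftedX q₀ v j₀ z) (potPerturb q v) (eigCol q₀ v z j₀) x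

variable {q₀ : ℝ} {q : ℝ → Vec2} {v : Vec2} {z : ℂ} {j₀ : Fin 3} {M : ℝ}

theorem shiftedX_apply (u : Fin 3 → ℂ) :
    shiftedX q₀ v j₀ z u = (matX q₀ v z).mulVec u - (I * freq q₀ z j₀) • u := rfl

theorem shiftedX_eigCol (hz : z ≠ 0) (hv : ‖v‖ = q₀) (j : Fin 3) :
    shiftedX q₀ v j₀ z (eigCol q₀ v z j)
      = (I * (freq q₀ z j - freq q₀ z j₀)) • eigCol q₀ v z j := by
  rw [shiftedX_apply, matX_mulVec_eigCol hz hv, ← sub_smul, mul_sub]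

theorem shiftedX_eigCol_self (hz : z ≠ 0) (hv : ‖v‖ = q₀) :
    shiftedX q₀ v j₀ z (eigCol q₀ v z j₀) = 0 := by
  rw [shiftedX_eigCol hz hv, sub_self, mul_zero, zero_smul]

theorem differentiableAt_shiftedX (hz : z ≠ 0) :
    DifferentiableAt ℂ (shiftedX q₀ v j₀) z := by
  have hk := differentiableAt_kOf (q₀ := q₀) hz
  have hX : DifferentiableAt ℂ (matX q₀ v) z :=
    ((hk.const_mul I).smul_const matJ).add_const (I • matQ v)
  exact (matCLM.differentiableAt.comp z hX).sub
    (((differentiableAt_freq hz j₀).const_mul I).smul_const _)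

theorem matQ_sub (u w : Vec2) : matQ (u - w) = matQ u - matQ w := by
  ext i j
  fin_cases i <;> fin_cases j <;> simp [matQ, sub_eq_add_neg, add_comm]

theorem shiftedX_add_potPerturb_apply (x : ℝ) (u : Fin 3 → ℂ) :
    shiftedX q₀ v j₀ z u + potPerturb q v x u
      = (matX q₀ (q x) z).mulVec u - (I * freq q₀ z j₀) • u := by
  rw [shiftedX_apply, potPerturb, matCLM_apply, matQ_sub, matX, matX, smul_sub, Matrix.sub_mulVec,
    Matrix.add_mulVec, Matrix.add_mulVec]
  abel

theorem continuous_matQ : Continuous matQ := by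
  refine continuous_matrix fun i j => ?_
  fin_cases i <;> fin_cases j <;>
    simp only [matQ, Fin.zero_eta, Fin.mk_one, Fin.reduceFinMk, Matrix.of_apply,
      Matrix.cons_val] <;>
    fun_prop

theorem norm_matQ_le (u : Vec2) : ‖matQ u‖ ≤ ‖u‖ := by
  refine (Matrix.norm_le_iff (norm_nonneg u)).2 fun i j => ?_
  have h0 := PiLp.norm_apply_le u 0
  have h1 := PiLp.norm_apply_le u 1
  fin_cases i <;> fin_cases j <;> simp [matQ, h0, h1]

theorem norm_matCLM_le (A : Mat3) : ‖matCLM A‖ ≤ 3 * ‖A‖ := by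
  refine ContinuousLinearMap.opNorm_le_bound _ (by positivity) fun u => ?_
  refine (pi_norm_le_iff_of_nonneg (by positivity)).2 fun i => ?_
  calc ‖∑ j, A i j * u j‖ ≤ ∑ _j : Fin 3, ‖A‖ * ‖u‖ := norm_sum_le_of_le _ fun j _ => by
        rw [norm_mul]
        gcongr
        exacts [A.norm_entry_le_entrywise_sup_norm, norm_le_pi_norm u j]
    _ = 3 * ‖A‖ * ‖u‖ := by
        rw [Finset.sum_const, Finset.card_univ, Fintype.card_fin, nsmul_eq_mul, Nat.cast_ofNat,
          mul_assoc]

theorem norm_potPerturb_le (x : ℝ) : ‖potPerturb q v x‖ ≤ 3 * ‖q x - v‖ :=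
  (norm_matCLM_le _).trans <| by
    rw [norm_smul, norm_I, one_mul]
    gcongr
    exact norm_matQ_le _

theorem integrableOn_Iic_of_continuous {F : Type*} [NormedAddCommGroup F] {f : ℝ → F}
    (hf : Continuous f) {a : ℝ} (ha : IntegrableOn f (Set.Iic a)) (x : ℝ) :
    IntegrableOn f (Set.Iic x) :=
  (ha.union (hf.integrableOn_Icc (a := a) (b := x))).mono_set fun y hy =>
    (le_total y a).imp id fun h => ⟨h, hy⟩

namespace LeftPotential

theorem continuous (h : LeftPotential q₀ q v) : Continuous q := h.diff.continuous

theorem integrableOn_sub (h : LeftPotential q₀ q v) :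
    IntegrableOn (fun x => q x - v) (Set.Iic 0) := by
  refine Integrable.mono h.integrableOn
    (h.continuous.sub continuous_const).aestronglyMeasurable (Eventually.of_forall fun x => ?_)
  rw [norm_smul, Real.norm_of_nonneg (by positivity)]
  exact le_mul_of_one_le_left (norm_nonneg _) (le_add_of_nonneg_right (abs_nonneg x))

theorem continuous_potPerturb (h : LeftPotential q₀ q v) : Continuous (potPerturb q v) :=
  matCLM.continuous.comp
    ((continuous_matQ.comp (h.continuous.sub continuous_const)).const_smul I)

theorem isIntegrablePerturbation (h : LeftPotential q₀ q v) (hz : z ∉ exceptional q₀)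
    (hc : ∀ j, (I * (freq q₀ z j - freq q₀ z j₀)).re ≤ 0) (hM : eigBound q₀ v z ≤ M) :
    IsIntegrablePerturbation (shiftedX q₀ v j₀ z) (potPerturb q v) M where
  norm_exp_le _ hs := (norm_exp_smul_le_of_eigenbasis
    (shiftedX_eigCol (not_mem_exceptional_iff.1 hz).1 h.norm_eq)
    (sum_eigCoord_smul_eigCol h.pos.ne' hz h.norm_eq) hc hs).trans hM
  continuous := h.continuous_potPerturb
  integrableOn := integrableOn_Iic_of_continuous h.continuous_potPerturb
    ((h.integrableOn_sub.norm.const_mul 3).mono' h.continuous_potPerturb.aestronglyMeasurable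
      (Eventually.of_forall norm_potPerturb_le))

theorem tendsto_leftSol (h : LeftPotential q₀ q v) (hz : z ∉ exceptional q₀)
    (hc : ∀ j, (I * (freq q₀ z j - freq q₀ z j₀)).re ≤ 0) :
    Tendsto (leftSol q₀ q v j₀ z) atBot (𝓝 (eigCol q₀ v z j₀)) :=
  (h.isIntegrablePerturbation hz hc le_rfl).tendsto_volterraSol

theorem norm_leftSol_le (h : LeftPotential q₀ q v) (hz : z ∉ exceptional q₀)
    (hc : ∀ j, (I * (freq q₀ z j - freq q₀ z j₀)).re ≤ 0) (hM : eigBound q₀ v z ≤ M) (x : ℝ) :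
    ‖leftSol q₀ q v j₀ z x‖ ≤ ‖eigCol q₀ v z j₀‖ * 2 * volterraWeight (potPerturb q v) M x :=
  (h.isIntegrablePerturbation hz hc hM).norm_volterraSol_le x

theorem hasDerivAt_leftSol (h : LeftPotential q₀ q v) (hz : z ∉ exceptional q₀)
    (hc : ∀ j, (I * (freq q₀ z j - freq q₀ z j₀)).re ≤ 0) (x : ℝ) :
    HasDerivAt (leftSol q₀ q v j₀ z) ((matX q₀ (q x) z).mulVec (leftSol q₀ q v j₀ z x)
      - (I * freq q₀ z j₀) • leftSol q₀ q v j₀ z x) x :=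
  ((h.isIntegrablePerturbation hz hc le_rfl).hasDerivAt_volterraSol
    (shiftedX_eigCol_self (not_mem_exceptional_iff.1 hz).1 h.norm_eq) x).congr_deriv
    (shiftedX_add_potPerturb_apply x _)

end LeftPotential

theorem exists_isOpen_eigBound_le (hz : z ∉ exceptional q₀) (j₀ : Fin 3) :
    ∃ U : Set ℂ, IsOpen U ∧ z ∈ U ∧ U ⊆ (exceptional q₀)ᶜ ∧ ∃ M K,
      ∀ w ∈ U, eigBound q₀ v w ≤ M ∧ ‖eigCol q₀ v w j₀‖ ≤ K := by
  have hbound := (continuousAt_eigBound (v := v) hz).eventually_le_const (lt_add_one _)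
  have hcol := (differentiableAt_eigCol (q₀ := q₀) (v := v) (not_mem_exceptional_iff.1 hz).1
    j₀).continuousAt.norm.eventually_le_const (lt_add_one _)
  have hne : ∀ᶠ w in 𝓝 z, w ∈ (exceptional q₀)ᶜ := isOpen_compl_exceptional.mem_nhds hz
  obtain ⟨U, hU, hUo, hzU⟩ := mem_nhds_iff.1 (hne.and (hbound.and hcol))
  exact ⟨U, hUo, hzU, fun w hw => (hU hw).1, _, _, fun w hw => (hU hw).2⟩

theorem LeftPotential.continuousOn_leftSol (h : LeftPotential q₀ q v) (x : ℝ) :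
    ContinuousOn (fun z => leftSol q₀ q v 2 z x) ({z : ℂ | 0 ≤ z.im} \ exceptional q₀) := by
  rintro z ⟨hz, hze⟩
  obtain ⟨U, hUo, hzU, hUe, M, K, hU⟩ := exists_isOpen_eigBound_le (v := v) hze 2
  have hne : ∀ w ∈ U, w ≠ 0 := fun w hw => (not_mem_exceptional_iff.1 (hUe hw)).1
  have hcont := continuousOn_volterraSol (U := {z : ℂ | 0 ≤ z.im} ∩ U) (K := K)
    (fun w hw =>
      h.isIntegrablePerturbation (hUe hw.2) (re_I_mul_freq_sub_nonpos hw.1) (hU w hw.2).1)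
    (fun w hw => (hU w hw.2).2)
    (fun w hw => (differentiableAt_shiftedX (hne w hw.2)).continuousAt.continuousWithinAt)
    (fun w hw => (differentiableAt_eigCol (hne w hw.2) 2).continuousAt.continuousWithinAt) x
  refine (hcont z ⟨hz, hzU⟩).mono_of_mem_nhdsWithin ?_
  filter_upwards [self_mem_nhdsWithin, mem_nhdsWithin_of_mem_nhds (hUo.mem_nhds hzU)] with w h1 h2
  exact ⟨h1.1, h2⟩

theorem LeftPotential.differentiableOn_leftSol (h : LeftPotential q₀ q v) (x : ℝ) :
    DifferentiableOn ℂ (fun z => leftSol q₀ q v 2 z x) {z : ℂ | 0 < z.im} := by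
  intro z (hz : 0 < z.im)
  obtain ⟨U, hUo, hzU, hUe, M, K, hU⟩ :=
    exists_isOpen_eigBound_le (v := v) (not_mem_exceptional_of_im_ne_zero (q₀ := q₀) hz.ne') 2
  have hne : ∀ w ∈ U, w ≠ 0 := fun w hw => (not_mem_exceptional_iff.1 (hUe hw)).1
  have ho : IsOpen ({z : ℂ | 0 < z.im} ∩ U) :=
    (isOpen_lt continuous_const Complex.continuous_im).inter hUo
  have hdiff := differentiableOn_volterraSol ho (K := K)
    (fun w hw => h.isIntegrablePerturbation (hUe hw.2) (re_I_mul_freq_sub_nonpos hw.1.le)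
      (hU w hw.2).1)
    (fun w hw => (hU w hw.2).2)
    (fun w hw => (differentiableAt_shiftedX (hne w hw.2)).differentiableWithinAt)
    (fun w hw => (differentiableAt_eigCol (hne w hw.2) 2).differentiableWithinAt) x
  exact (hdiff.differentiableAt (ho.mem_nhds ⟨hz, hzU⟩)).differentiableWithinAt

end LeftSolution

section DampedEquation

theorem norm_exp_mul_sub_le_one {c : ℂ} (hc : c.re ≤ 0) {x y : ℝ} (h : y ≤ x) :
    ‖Complex.exp (c * (x - y))‖ ≤ 1 := by
  rw [Complex.norm_exp, Real.exp_le_one_iff, ← Complex.ofReal_sub, Complex.re_mul_ofReal]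
  exact mul_nonpos_of_nonpos_of_nonneg hc (sub_nonneg.2 h)

theorem norm_exp_sub_one_le_of_re_nonpos {w : ℂ} (hw : w.re ≤ 0) :
    ‖Complex.exp w - 1‖ ≤ ‖w‖ := by
  have hexp : ∀ u ∈ {u : ℂ | u.re ≤ 0}, ‖Complex.exp u‖ ≤ 1 := fun u hu => by
    rwa [Complex.norm_exp, Real.exp_le_one_iff]
  have h := (convex_halfSpace_re_le 0).norm_image_sub_le_of_norm_hasDerivWithin_le
    (fun u _ => (Complex.hasDerivAt_exp u).hasDerivWithinAt) hexp
    (show (0 : ℂ) ∈ {u : ℂ | u.re ≤ 0} from Complex.zero_re.le) hw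
  rwa [Complex.exp_zero, one_mul, sub_zero] at h

theorem norm_le_integral_of_damped {f h : ℝ → ℂ} {b : ℝ → ℝ} {c : ℂ} {a : ℝ} (hc : c.re ≤ 0)
    (hd : ∀ x, HasDerivAt f (c * f x + h x) x) (hf : Tendsto f atBot (𝓝 0))
    (hb : ∀ x ≤ a, ‖h x‖ ≤ b x) (hbi : IntegrableOn b (Set.Iic a)) :
    ‖f a‖ ≤ ∫ y in Set.Iic a, b y := by
  have hh : h = fun x => deriv f x - c * f x := funext fun x => by
    rw [(hd x).deriv, add_sub_cancel_left]
  have hmeas : Measurable h := by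
    have hcont : Continuous f := continuous_iff_continuousAt.2 fun x => (hd x).continuousAt
    exact hh ▸ (measurable_deriv f).sub (hcont.measurable.const_mul c)
  have hderiv : ∀ y ∈ Set.Iic a, HasDerivAt (fun y : ℝ => Complex.exp (c * (a - y)) * f y)
      (Complex.exp (c * (a - y)) * h y) y := fun y _ => by
    have hexp := (((hasDerivAt_id y).ofReal_comp.const_sub (a : ℂ)).const_mul c).cexp
    exact (hexp.mul (hd y)).congr_deriv (by simp only [id_eq, ofReal_one]; ring)
  have hle : ∀ᵐ y : ℝ ∂volume.restrict (Set.Iic a), ‖Complex.exp (c * (a - y)) * h y‖ ≤ b y := by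
    filter_upwards [ae_restrict_mem measurableSet_Iic] with y hy
    rw [norm_mul]
    exact (mul_le_of_le_one_left (norm_nonneg _) (norm_exp_mul_sub_le_one hc hy)).trans (hb y hy)
  have hlim : Tendsto (fun y : ℝ => Complex.exp (c * (a - y)) * f y) atBot (𝓝 0) := by
    refine squeeze_zero_norm' ?_ (tendsto_zero_iff_norm_tendsto_zero.1 hf)
    filter_upwards [eventually_le_atBot a] with y hy
    rw [norm_mul]
    exact mul_le_of_le_one_left (norm_nonneg _) (norm_exp_mul_sub_le_one hc hy)
  have hint := integral_Iic_of_hasDerivAt_of_tendsto' hderiv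
    (hbi.mono' (by fun_prop) hle) hlim
  rw [sub_self, mul_zero, Complex.exp_zero, one_mul, sub_zero] at hint
  exact hint ▸ norm_integral_le_of_norm_le hbi hle

theorem isBigO_of_damped {α : Type*} {l : Filter α} {f h : α → ℝ → ℂ} {c : α → ℂ} {s : α → ℝ}
    {b : ℝ → ℝ} (hc : ∀ᶠ z in l, (c z).re ≤ 0)
    (hd : ∀ᶠ z in l, ∀ x, HasDerivAt (f z) (c z * f z x + h z x) x)
    (hf : ∀ᶠ z in l, Tendsto (f z) atBot (𝓝 0)) (hb : IntegrableOn b (Set.Iic 0))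
    (hh : (fun p : α × ℝ => h p.1 p.2) =O[l ×ˢ 𝓟 (Set.Iic 0)] fun p => s p.1 * b p.2) :
    (fun p : α × ℝ => f p.1 p.2) =O[l ×ˢ 𝓟 (Set.Iic 0)] fun p => s p.1 := by
  obtain ⟨C, hC0, hC⟩ := hh.exists_pos
  have hbound : ∀ᶠ z in l, ∀ x ∈ Set.Iic (0 : ℝ), ‖h z x‖ ≤ C * ‖s z * b x‖ :=
    eventually_prod_principal_iff.1 hC.bound
  refine IsBigO.of_bound (C * ∫ y in Set.Iic 0, ‖b y‖) (eventually_prod_principal_iff.2 ?_)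
  filter_upwards [hc, hd, hf, hbound] with z hcz hdz hfz hhz x (hx : x ≤ 0)
  have hsub : Set.Iic x ⊆ Set.Iic 0 := Set.Iic_subset_Iic.2 hx
  have hint : IntegrableOn (fun y => C * ‖s z‖ * ‖b y‖) (Set.Iic 0) := hb.norm.const_mul _
  calc ‖f z x‖ ≤ ∫ y in Set.Iic x, C * ‖s z‖ * ‖b y‖ :=
        norm_le_integral_of_damped hcz hdz hfz
          (fun y hy => (hhz y (hsub hy)).trans_eq (by rw [norm_mul, mul_assoc]))
          (hint.mono_set hsub)
    _ ≤ ∫ y in Set.Iic 0, C * ‖s z‖ * ‖b y‖ :=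
        setIntegral_mono_set hint (Eventually.of_forall fun y => by positivity)
          hsub.eventuallyLE
    _ = (C * ∫ y in Set.Iic 0, ‖b y‖) * ‖s z‖ := by
        rw [integral_const_mul, mul_right_comm]

end DampedEquation

section LargeSpectralParameter

theorem isBigO_inner {α F : Type*} [NormedAddCommGroup F] [InnerProductSpace ℂ F] {l : Filter α}
    {f g : α → F} {a b : α → ℝ} (hf : f =O[l] a) (hg : g =O[l] b) :
    (fun x => inner ℂ (f x) (g x)) =O[l] fun x => a x * b x :=
  (IsBigO.of_norm_le fun x => norm_inner_le_norm (f x) (g x)).trans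
    (hf.norm_left.mul hg.norm_left)

theorem tendsto_prodMk_prod_principal {α β : Type*} (l : Filter α) {s : Set β} {b : β}
    (hb : b ∈ s) :
    Tendsto (fun a => (a, b)) l (l ×ˢ 𝓟 s) :=
  tendsto_id.prodMk (tendsto_principal.2 (Eventually.of_forall fun _ => hb))

theorem isBigO_one_principal_Iic {F : Type*} [NormedAddCommGroup F] {f : ℝ → F} {y : F}
    (hf : Continuous f) (hy : Tendsto f atBot (𝓝 y)) (a : ℝ) :
    f =O[𝓟 (Set.Iic a)] fun _ => (1 : ℝ) := by
  obtain ⟨C, hC⟩ := (hy.isBigO_one ℝ).bound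
  obtain ⟨b, hb⟩ := eventually_atBot.1 hC
  have hcover : 𝓟 (Set.Iic a) ≤ 𝓟 (Set.Iic b) ⊔ 𝓟 (Set.Icc b a) := by
    rw [sup_principal]
    exact principal_mono.2 fun x hx => (le_total x b).imp id fun h => ⟨h, hx⟩
  refine (isBigO_sup.2 ⟨?_, ?_⟩).mono hcover
  · exact IsBigO.of_bound C (eventually_principal.2 fun x hx => hb x hx)
  · exact hf.continuousOn.isBigO_principal isCompact_Icc (by norm_num)

/-- The last two components of a column. -/
def lowerPart : (Fin 3 → ℂ) →L[ℂ] Vec2 :=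
  (EuclideanSpace.equiv (Fin 2) ℂ).symm.toContinuousLinearMap.comp
    (ContinuousLinearMap.pi ![ContinuousLinearMap.proj 1, ContinuousLinearMap.proj 2])

theorem lowerPart_zero (w : Fin 3 → ℂ) : lowerPart w 0 = w 1 := rfl

theorem lowerPart_one (w : Fin 3 → ℂ) : lowerPart w 1 = w 2 := rfl

theorem inner_vec2 (a b : Vec2) : inner ℂ a b = star (a 0) * b 0 + star (a 1) * b 1 := by
  simp only [PiLp.inner_apply, Fin.sum_univ_two, RCLike.inner_apply, starRingEnd_apply, mul_comm]

theorem inner_perp_self (v : Vec2) : inner ℂ v (perp v) = 0 := by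
  rw [inner_vec2, perp_zero, perp_one]
  ring

theorem lowerPart_eigCol_one (q₀ : ℝ) (v : Vec2) (z : ℂ) :
    lowerPart (eigCol q₀ v z 1) = perp v := by
  ext i
  fin_cases i <;> rfl

theorem lowerPart_eigCol_two (q₀ : ℝ) (v : Vec2) (z : ℂ) : lowerPart (eigCol q₀ v z 2) = v := by
  ext i
  fin_cases i <;> rfl

/-- The filter `l` tends to infinity within the spectral parameters for which no frequency grows
faster than the `j₀`-th. -/
structure IsAdmissibleAtInfinity (q₀ : ℝ) (j₀ : Fin 3) (l : Filter ℂ) : Prop where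
  le_cobounded : l ≤ Bornology.cobounded ℂ
  eventually_re_nonpos : ∀ᶠ z in l, ∀ j, (I * (freq q₀ z j - freq q₀ z j₀)).re ≤ 0

/-- The combination `z w₀ - q† w_⊥` of the components of `leftSol`, which isolates the frequency
`λ` up to integrable terms. -/
def fastPart (q₀ : ℝ) (q : ℝ → Vec2) (v : Vec2) (j₀ : Fin 3) (z : ℂ) (x : ℝ) : ℂ :=
  z * leftSol q₀ q v j₀ z x 0 - inner ℂ (q x) (lowerPart (leftSol q₀ q v j₀ z x))

/-- The forcing term in the equation of `fastPart`. -/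
def fastForcing (q₀ : ℝ) (q : ℝ → Vec2) (v : Vec2) (j₀ : Fin 3) (z : ℂ) (x : ℝ) : ℂ :=
  I * (inner ℂ v v - inner ℂ (q x) (q x)) * leftSol q₀ q v j₀ z x 0
    - inner ℂ (deriv q x) (lowerPart (leftSol q₀ q v j₀ z x))

/-- The integrable weight that controls the forcing terms at large `z`. -/
def decayWeight (q : ℝ → Vec2) (v : Vec2) (x : ℝ) : ℝ :=
  (1 + |x|) * ‖q x - v‖ + ‖deriv q x‖

variable {q₀ : ℝ} {q : ℝ → Vec2} {v : Vec2} {z : ℂ} {j₀ : Fin 3} {l : Filter ℂ}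

theorem IsAdmissibleAtInfinity.eventually (h : IsAdmissibleAtInfinity q₀ j₀ l) :
    ∀ᶠ z in l, z ∉ exceptional q₀ ∧ ∀ j, (I * (freq q₀ z j - freq q₀ z j₀)).re ≤ 0 :=
  ((eventually_cofinite_not_mem_exceptional q₀).filter_mono
    (h.le_cobounded.trans (Bornology.le_cofinite ℂ))).and h.eventually_re_nonpos

theorem lowerPart_matX_mulVec (u : Vec2) (w : Fin 3 → ℂ) :
    lowerPart ((matX q₀ u z).mulVec w) = (I * w 0) • u - (I * kOf q₀ z) • lowerPart w := by
  rw [matX_mulVec]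
  ext i
  fin_cases i <;>
    simp only [Fin.zero_eta, Fin.mk_one, lowerPart_zero, lowerPart_one, PiLp.sub_apply,
      PiLp.smul_apply, smul_eq_mul, Matrix.cons_val] <;>
    ring

theorem matX_mulVec_zero (u : Vec2) (w : Fin 3 → ℂ) :
    (matX q₀ u z).mulVec w 0 = I * kOf q₀ z * w 0 - I * inner ℂ u (lowerPart w) := by
  rw [matX_mulVec, inner_vec2, lowerPart_zero, lowerPart_one, Matrix.cons_val_zero]

theorem mul_kOf_sub_lamOf (hz : z ≠ 0) : z * (kOf q₀ z - lamOf q₀ z) = (q₀ : ℂ) ^ 2 := by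
  rw [kOf, lamOf]
  field_simp
  ring

theorem kOf_add_lamOf : kOf q₀ z + lamOf q₀ z = z := by
  rw [kOf, lamOf]
  ring

namespace LeftPotential

theorem inner_self_eq (h : LeftPotential q₀ q v) : inner ℂ v v = (q₀ : ℂ) ^ 2 := by
  rw [inner_self_eq_norm_sq_to_K, h.norm_eq]
  rfl

theorem hasDerivAt_leftSol_zero (h : LeftPotential q₀ q v) (hz : z ∉ exceptional q₀)
    (hc : ∀ j, (I * (freq q₀ z j - freq q₀ z j₀)).re ≤ 0) (x : ℝ) :
    HasDerivAt (fun y => leftSol q₀ q v j₀ z y 0)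
      (I * (kOf q₀ z - freq q₀ z j₀) * leftSol q₀ q v j₀ z x 0
        - I * inner ℂ (q x) (lowerPart (leftSol q₀ q v j₀ z x))) x := by
  refine (hasDerivAt_pi.1 (h.hasDerivAt_leftSol hz hc x) 0).congr_deriv ?_
  rw [Pi.sub_apply, Pi.smul_apply, matX_mulVec_zero, smul_eq_mul]
  ring

theorem hasDerivAt_lowerPart_leftSol (h : LeftPotential q₀ q v) (hz : z ∉ exceptional q₀)
    (hc : ∀ j, (I * (freq q₀ z j - freq q₀ z j₀)).re ≤ 0) (x : ℝ) :
    HasDerivAt (fun y => lowerPart (leftSol q₀ q v j₀ z y))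
      ((I * leftSol q₀ q v j₀ z x 0) • q x
        - (I * (kOf q₀ z + freq q₀ z j₀)) • lowerPart (leftSol q₀ q v j₀ z x)) x := by
  refine ((lowerPart.restrictScalars ℝ).hasFDerivAt.comp_hasDerivAt x
    (h.hasDerivAt_leftSol hz hc x)).congr_deriv ?_
  rw [ContinuousLinearMap.coe_restrictScalars', map_sub, map_smul, lowerPart_matX_mulVec]
  module

theorem hasDerivAt_fastPart (h : LeftPotential q₀ q v) (hz : z ∉ exceptional q₀)
    (hc : ∀ j, (I * (freq q₀ z j - freq q₀ z j₀)).re ≤ 0) (x : ℝ) :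
    HasDerivAt (fastPart q₀ q v j₀ z)
      (I * (freq q₀ z 0 - freq q₀ z j₀) * fastPart q₀ q v j₀ z x
        + fastForcing q₀ q v j₀ z x) x := by
  have hhead := (h.hasDerivAt_leftSol_zero hz hc x).const_mul z
  have hinner := (h.diff x).hasDerivAt.inner ℂ (h.hasDerivAt_lowerPart_leftSol hz hc x)
  refine (hhead.sub hinner).congr_deriv ?_
  have hprod : z * (kOf q₀ z - lamOf q₀ z) = inner ℂ v v := by
    rw [mul_kOf_sub_lamOf (not_mem_exceptional_iff.1 hz).1, h.inner_self_eq]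
  have hfreq : freq q₀ z 0 = lamOf q₀ z := rfl
  rw [inner_sub_right, inner_smul_right, inner_smul_right, fastPart, fastForcing, hfreq]
  linear_combination (I * leftSol q₀ q v j₀ z x 0) * hprod
    + (I * inner ℂ (q x) (lowerPart (leftSol q₀ q v j₀ z x))) * kOf_add_lamOf (q₀ := q₀) (z := z)

theorem tendsto_fastPart (h : LeftPotential q₀ q v) (hj : j₀ ≠ 0) (hz : z ∉ exceptional q₀)
    (hc : ∀ j, (I * (freq q₀ z j - freq q₀ z j₀)).re ≤ 0) :
    Tendsto (fastPart q₀ q v j₀ z) atBot (𝓝 0) := by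
  have hlim : z * eigCol q₀ v z j₀ 0 - inner ℂ v (lowerPart (eigCol q₀ v z j₀)) = 0 := by
    match j₀, hj with
    | 1, _ =>
      rw [lowerPart_eigCol_one, inner_perp_self, sub_zero]
      exact mul_zero z
    | 2, _ =>
      rw [lowerPart_eigCol_two, h.inner_self_eq, sub_eq_zero]
      exact mul_div_cancel₀ _ (not_mem_exceptional_iff.1 hz).1
  have hw := h.tendsto_leftSol hz hc
  rw [← hlim]
  exact ((tendsto_pi_nhds.1 hw 0).const_mul z).sub
    (h.tendsto.inner ((lowerPart.continuous.tendsto _).comp hw))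

theorem integrableOn_decayWeight (h : LeftPotential q₀ q v) :
    IntegrableOn (decayWeight q v) (Set.Iic 0) := by
  have hnorm : ∀ x, ‖(1 + |x|) • (q x - v)‖ = (1 + |x|) * ‖q x - v‖ := fun x => by
    rw [norm_smul, Real.norm_of_nonneg (by positivity)]
  exact (h.integrableOn.norm.congr (Eventually.of_forall hnorm)).add h.deriv_integrableOn.norm

theorem isBigO_one (h : LeftPotential q₀ q v) (l : Filter ℂ) :
    (fun p : ℂ × ℝ => q p.2) =O[l ×ˢ 𝓟 (Set.Iic 0)] fun _ => (1 : ℝ) :=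
  (isBigO_one_principal_Iic h.continuous h.tendsto 0).comp_tendsto tendsto_snd

end LeftPotential

theorem isBigO_sub_decayWeight (q : ℝ → Vec2) (v : Vec2) (L : Filter (ℂ × ℝ)) :
    (fun p => q p.2 - v) =O[L] fun p => decayWeight q v p.2 := by
  refine IsBigO.of_bound' (Eventually.of_forall fun p => ?_)
  rw [Real.norm_of_nonneg (by unfold decayWeight; positivity)]
  calc ‖q p.2 - v‖ ≤ (1 + |p.2|) * ‖q p.2 - v‖ :=
        le_mul_of_one_le_left (norm_nonneg _) (le_add_of_nonneg_right (abs_nonneg _))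
    _ ≤ decayWeight q v p.2 := le_add_of_nonneg_right (norm_nonneg _)

theorem isBigO_deriv_decayWeight (q : ℝ → Vec2) (v : Vec2) (L : Filter (ℂ × ℝ)) :
    (fun p => deriv q p.2) =O[L] fun p => decayWeight q v p.2 := by
  refine IsBigO.of_bound' (Eventually.of_forall fun p => ?_)
  rw [Real.norm_of_nonneg (by unfold decayWeight; positivity)]
  exact le_add_of_nonneg_left (by positivity)

theorem LeftPotential.isBigO_leftSol (h : LeftPotential q₀ q v)
    (hl : IsAdmissibleAtInfinity q₀ j₀ l) :
    (fun p : ℂ × ℝ => leftSol q₀ q v j₀ p.1 p.2) =O[l ×ˢ 𝓟 (Set.Iic 0)] fun _ => (1 : ℝ) := by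
  obtain ⟨M, hM⟩ := exists_eventually_eigBound_le_cobounded (q₀ := q₀) (v := v)
  obtain ⟨K, hK⟩ : ∃ K, ∀ᶠ z in Bornology.cobounded ℂ, ‖eigCol q₀ v z j₀‖ ≤ K :=
    ⟨_, (tendsto_eigCol_cobounded j₀).norm.eventually_le_const (lt_add_one _)⟩
  refine IsBigO.of_bound (K * 2 * volterraWeight (potPerturb q v) M 0)
    (eventually_prod_principal_iff.2 ?_)
  filter_upwards [hl.le_cobounded hM, hl.le_cobounded hK, hl.eventually]
    with z hMz hKz ⟨hz, hc⟩ x (hx : x ≤ 0)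
  rw [norm_one, mul_one]
  calc ‖leftSol q₀ q v j₀ z x‖
      ≤ ‖eigCol q₀ v z j₀‖ * 2 * volterraWeight (potPerturb q v) M x :=
        h.norm_leftSol_le hz hc hMz x
    _ ≤ K * 2 * volterraWeight (potPerturb q v) M 0 := by
        have := (h.isIntegrablePerturbation hz hc hMz).monotone_volterraWeight hx
        have := volterraWeight_nonneg (B := potPerturb q v) (M := M) x
        have : 0 ≤ K := (norm_nonneg _).trans hKz
        gcongr

theorem LeftPotential.isBigO_lowerPart_leftSol (h : LeftPotential q₀ q v)
    (hl : IsAdmissibleAtInfinity q₀ j₀ l) :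
    (fun p : ℂ × ℝ => lowerPart (leftSol q₀ q v j₀ p.1 p.2))
      =O[l ×ˢ 𝓟 (Set.Iic 0)] fun _ => (1 : ℝ) :=
  (lowerPart.isBigO_comp _ _).trans (h.isBigO_leftSol hl)

theorem LeftPotential.isBigO_fastForcing (h : LeftPotential q₀ q v)
    (hl : IsAdmissibleAtInfinity q₀ j₀ l) :
    (fun p : ℂ × ℝ => fastForcing q₀ q v j₀ p.1 p.2)
      =O[l ×ˢ 𝓟 (Set.Iic 0)] fun p => decayWeight q v p.2 := by
  have hsub := isBigO_sub_decayWeight q v (l ×ˢ 𝓟 (Set.Iic 0))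
  have hself : (fun p : ℂ × ℝ => inner ℂ v v - inner ℂ (q p.2) (q p.2))
      =O[l ×ˢ 𝓟 (Set.Iic 0)] fun p => decayWeight q v p.2 := by
    have hleft := (isBigO_inner hsub (h.isBigO_one l)).congr_right fun _ => mul_one _
    have hright := (isBigO_inner (isBigO_const_const v (one_ne_zero' ℝ) _) hsub).congr_right
      fun _ => one_mul _
    refine (hleft.neg_left.sub hright).congr_left fun p => ?_
    rw [inner_sub_left, inner_sub_right]
    ring
  have hhead := (isBigO_pi.1 (h.isBigO_leftSol hl)) 0
  have htail := isBigO_inner (isBigO_deriv_decayWeight q v (l ×ˢ 𝓟 (Set.Iic 0)))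
    (h.isBigO_lowerPart_leftSol hl)
  refine (((hself.const_mul_left I).mul hhead).sub htail).congr_right fun p => mul_one _

theorem LeftPotential.isBigO_fastPart (h : LeftPotential q₀ q v) (hj : j₀ ≠ 0)
    (hl : IsAdmissibleAtInfinity q₀ j₀ l) :
    (fun p : ℂ × ℝ => fastPart q₀ q v j₀ p.1 p.2)
      =O[l ×ˢ 𝓟 (Set.Iic 0)] fun _ => (1 : ℝ) :=
  isBigO_of_damped (s := fun _ => 1) (hl.eventually.mono fun _ hz => hz.2 0)
    (hl.eventually.mono fun _ hz => h.hasDerivAt_fastPart hz.1 hz.2)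
    (hl.eventually.mono fun _ hz => h.tendsto_fastPart hj hz.1 hz.2)
    h.integrableOn_decayWeight
    ((h.isBigO_fastForcing hl).congr_right fun _ => (one_mul _).symm)

theorem LeftPotential.isBigO_leftSol_zero (h : LeftPotential q₀ q v) (hj : j₀ ≠ 0)
    (hl : IsAdmissibleAtInfinity q₀ j₀ l) :
    (fun p : ℂ × ℝ => leftSol q₀ q v j₀ p.1 p.2 0)
      =O[l ×ˢ 𝓟 (Set.Iic 0)] fun p => ‖p.1‖⁻¹ := by
  have hinner := isBigO_inner (h.isBigO_one l) (h.isBigO_lowerPart_leftSol hl)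
  have hsum := (isBigO_refl (fun p : ℂ × ℝ => p.1⁻¹) (l ×ˢ 𝓟 (Set.Iic 0))).norm_right.mul
    ((h.isBigO_fastPart hj hl).add (hinner.congr_right fun _ => one_mul _))
  refine hsum.congr' ?_ (Eventually.of_forall fun p => (mul_one _).trans (norm_inv _))
  filter_upwards [tendsto_fst.eventually hl.eventually] with p hp
  rw [fastPart, sub_add_cancel, inv_mul_cancel_left₀ (not_mem_exceptional_iff.1 hp.1).1]

end LargeSpectralParameter

section SlowestSolution

variable {q₀ : ℝ} {q : ℝ → Vec2} {v : Vec2} {z : ℂ} {j j₀ : Fin 3} {l : Filter ℂ}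

theorem lowerPart_eigCol_zero (q₀ : ℝ) (v : Vec2) (z : ℂ) :
    lowerPart (eigCol q₀ v z 0) = z⁻¹ • v := by
  ext i
  fin_cases i <;> exact div_eq_inv_mul _ _

theorem potPerturb_apply_zero (x : ℝ) (w : Fin 3 → ℂ) :
    potPerturb q v x w 0 = -(I * inner ℂ (q x - v) (lowerPart w)) := by
  simp [potPerturb, matCLM_apply, matQ, Matrix.mulVec, dotProduct, Fin.sum_univ_three, inner_vec2,
    lowerPart_zero, lowerPart_one]
  ring

theorem lowerPart_potPerturb_apply (x : ℝ) (w : Fin 3 → ℂ) :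
    lowerPart (potPerturb q v x w) = (I * w 0) • (q x - v) := by
  ext i
  fin_cases i <;>
    simp [potPerturb, matCLM_apply, matQ, dotProduct, Fin.sum_univ_three, lowerPart_zero,
      lowerPart_one] <;>
    ring

theorem isBigO_eigRow_one (hl : l ≤ Bornology.cobounded ℂ) (j i : Fin 3) :
    (fun p : ℂ × ℝ => eigRow q₀ v p.1 j i) =O[l ×ˢ 𝓟 (Set.Iic 0)] fun _ => (1 : ℝ) := by
  obtain ⟨c, hc⟩ := exists_tendsto_eigRow_cobounded (q₀ := q₀) (v := v) j i
  exact ((hc.mono_left hl).isBigO_one ℝ).comp_tendsto tendsto_fst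

theorem isBigO_eigRow_zero (hl : l ≤ Bornology.cobounded ℂ) (hj : j ≠ 0) :
    (fun p : ℂ × ℝ => eigRow q₀ v p.1 j 0) =O[l ×ˢ 𝓟 (Set.Iic 0)] fun p => ‖p.1‖⁻¹ := by
  match j, hj with
  | 1, _ => exact isBigO_zero _ _
  | 2, _ =>
    have hrho : rhoHat q₀ =O[l] fun _ => (1 : ℝ) :=
      (tendsto_rhoHat_cobounded.mono_left hl).isBigO_one ℝ
    have hmul := (hrho.neg_left.mul (isBigO_refl (fun z : ℂ => z⁻¹) l).norm_right).congr
      (fun z => show _ = eigRow q₀ v z 2 0 from neg_mul _ _) fun z => one_mul _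
    exact (hmul.congr_right fun z => norm_inv z).comp_tendsto tendsto_fst

namespace LeftPotential

theorem eigCoord_shiftedX (h : LeftPotential q₀ q v) (hz : z ∉ exceptional q₀) (j : Fin 3)
    (u : Fin 3 → ℂ) : eigCoord q₀ v z j (shiftedX q₀ v j₀ z u)
      = I * (freq q₀ z j - freq q₀ z j₀) * eigCoord q₀ v z j u := by
  conv_lhs => rw [← sum_eigCoord_smul_eigCol h.pos.ne' hz h.norm_eq u]
  simp only [map_sum, map_smul, shiftedX_eigCol (not_mem_exceptional_iff.1 hz).1 h.norm_eq,
    eigCoord_eigCol h.pos.ne' hz h.norm_eq, smul_eq_mul, mul_ite, mul_one, mul_zero,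
    Finset.sum_ite_eq, Finset.mem_univ, if_true]
  exact mul_comm _ _

theorem hasDerivAt_eigCoord_leftSol_sub (h : LeftPotential q₀ q v) (hz : z ∉ exceptional q₀)
    (hc : ∀ j, (I * (freq q₀ z j - freq q₀ z j₀)).re ≤ 0) (j : Fin 3) (x : ℝ) :
    HasDerivAt (fun y => eigCoord q₀ v z j (leftSol q₀ q v j₀ z y - eigCol q₀ v z j₀))
      (I * (freq q₀ z j - freq q₀ z j₀)
          * eigCoord q₀ v z j (leftSol q₀ q v j₀ z x - eigCol q₀ v z j₀)
        + eigCoord q₀ v z j (potPerturb q v x (leftSol q₀ q v j₀ z x))) x := by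
  have hderiv := (h.isIntegrablePerturbation hz hc le_rfl).hasDerivAt_volterraSol
    (shiftedX_eigCol_self (not_mem_exceptional_iff.1 hz).1 h.norm_eq) x
  refine (((eigCoord q₀ v z j).restrictScalars ℝ).hasFDerivAt.comp_hasDerivAt x
    (hderiv.sub_const _)).congr_deriv ?_
  rw [ContinuousLinearMap.coe_restrictScalars', map_add, ← h.eigCoord_shiftedX hz, map_sub,
    shiftedX_eigCol_self (not_mem_exceptional_iff.1 hz).1 h.norm_eq, sub_zero]
  rfl

theorem tendsto_eigCoord_leftSol_sub (h : LeftPotential q₀ q v) (hz : z ∉ exceptional q₀)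
    (hc : ∀ j, (I * (freq q₀ z j - freq q₀ z j₀)).re ≤ 0) (j : Fin 3) :
    Tendsto (fun y => eigCoord q₀ v z j (leftSol q₀ q v j₀ z y - eigCol q₀ v z j₀)) atBot
      (𝓝 0) := by
  have hsub := (h.tendsto_leftSol hz hc).sub_const (eigCol q₀ v z j₀)
  rw [sub_self] at hsub
  have hlim := ((eigCoord q₀ v z j).continuous.tendsto 0).comp hsub
  rwa [map_zero] at hlim

theorem isBigO_eigCoord_potPerturb (h : LeftPotential q₀ q v) (hj : j ≠ 0) (hj₀ : j₀ ≠ 0)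
    (hl : IsAdmissibleAtInfinity q₀ j₀ l) :
    (fun p : ℂ × ℝ => eigCoord q₀ v p.1 j (potPerturb q v p.2 (leftSol q₀ q v j₀ p.1 p.2)))
      =O[l ×ˢ 𝓟 (Set.Iic 0)] fun p => ‖p.1‖⁻¹ * decayWeight q v p.2 := by
  have hsub := isBigO_sub_decayWeight q v (l ×ˢ 𝓟 (Set.Iic 0))
  have hhead : (fun p : ℂ × ℝ => potPerturb q v p.2 (leftSol q₀ q v j₀ p.1 p.2) 0)
      =O[l ×ˢ 𝓟 (Set.Iic 0)] fun p => decayWeight q v p.2 := by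
    simp only [potPerturb_apply_zero]
    exact ((isBigO_inner hsub
      (h.isBigO_lowerPart_leftSol hl)).const_mul_left I).neg_left.congr_right fun p => mul_one _
  have htail : (fun p : ℂ × ℝ => lowerPart (potPerturb q v p.2 (leftSol q₀ q v j₀ p.1 p.2)))
      =O[l ×ˢ 𝓟 (Set.Iic 0)] fun p => ‖p.1‖⁻¹ * decayWeight q v p.2 := by
    simp only [lowerPart_potPerturb_apply]
    exact ((h.isBigO_leftSol_zero hj₀ hl).const_mul_left I).smul hsub
  have htail' := isBigO_pi.1 ((EuclideanSpace.equiv (Fin 2) ℂ).isBigO_comp _ _ |>.trans htail)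
  simp only [eigCoord_apply, Fin.sum_univ_three]
  refine (((isBigO_eigRow_zero hl.le_cobounded hj).mul hhead).add ?_).add ?_
  · exact ((isBigO_eigRow_one hl.le_cobounded j 1).mul (htail' 0)).congr_right fun p => one_mul _
  · exact ((isBigO_eigRow_one hl.le_cobounded j 2).mul (htail' 1)).congr_right fun p => one_mul _

theorem isBigO_eigCoord_leftSol_sub (h : LeftPotential q₀ q v) (hj : j ≠ 0) (hj₀ : j₀ ≠ 0)
    (hl : IsAdmissibleAtInfinity q₀ j₀ l) :
    (fun p : ℂ × ℝ => eigCoord q₀ v p.1 j (leftSol q₀ q v j₀ p.1 p.2 - eigCol q₀ v p.1 j₀))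
      =O[l ×ˢ 𝓟 (Set.Iic 0)] fun p => ‖p.1‖⁻¹ :=
  isBigO_of_damped (s := fun z => ‖z‖⁻¹)
    (f := fun z x => eigCoord q₀ v z j (leftSol q₀ q v j₀ z x - eigCol q₀ v z j₀))
    (hl.eventually.mono fun _ hz => hz.2 j)
    (hl.eventually.mono fun _ hz => h.hasDerivAt_eigCoord_leftSol_sub hz.1 hz.2 j)
    (hl.eventually.mono fun _ hz => h.tendsto_eigCoord_leftSol_sub hz.1 hz.2 j)
    h.integrableOn_decayWeight (h.isBigO_eigCoord_potPerturb hj hj₀ hl)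

theorem isBigO_eigCoord_zero_leftSol_sub (h : LeftPotential q₀ q v)
    (hl : IsAdmissibleAtInfinity q₀ j₀ l) :
    (fun p : ℂ × ℝ => eigCoord q₀ v p.1 0 (leftSol q₀ q v j₀ p.1 p.2 - eigCol q₀ v p.1 j₀))
      =O[l ×ˢ 𝓟 (Set.Iic 0)] fun _ => (1 : ℝ) := by
  have hcol : (fun p : ℂ × ℝ => eigCol q₀ v p.1 j₀) =O[l ×ˢ 𝓟 (Set.Iic 0)] fun _ => (1 : ℝ) :=
    (((tendsto_eigCol_cobounded j₀).mono_left hl.le_cobounded).isBigO_one ℝ).comp_tendsto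
      tendsto_fst
  have hsub := isBigO_pi.1 ((h.isBigO_leftSol hl).sub hcol)
  simp only [eigCoord_apply]
  exact IsBigO.fun_sum fun i _ =>
    ((isBigO_eigRow_one hl.le_cobounded 0 i).mul (hsub i)).congr_right fun _ => one_mul _

theorem isBigO_lowerPart_leftSol_sub (h : LeftPotential q₀ q v) (hj₀ : j₀ ≠ 0)
    (hl : IsAdmissibleAtInfinity q₀ j₀ l) :
    (fun p : ℂ × ℝ => lowerPart (leftSol q₀ q v j₀ p.1 p.2) - lowerPart (eigCol q₀ v p.1 j₀))
      =O[l ×ˢ 𝓟 (Set.Iic 0)] fun p => ‖p.1‖⁻¹ := by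
  have hconst : ∀ w : Vec2, (fun _ : ℂ × ℝ => w) =O[l ×ˢ 𝓟 (Set.Iic 0)] fun _ => (1 : ℝ) :=
    fun w => isBigO_const_const w one_ne_zero _
  have hinv : (fun p : ℂ × ℝ => p.1⁻¹) =O[l ×ˢ 𝓟 (Set.Iic 0)] fun p => ‖p.1‖⁻¹ :=
    (isBigO_refl _ _).norm_right.congr_right fun p => norm_inv _
  have h0 := (h.isBigO_eigCoord_zero_leftSol_sub hl).smul (hinv.smul (hconst v))
  have h1 := (h.isBigO_eigCoord_leftSol_sub one_ne_zero hj₀ hl).smul (hconst (perp v))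
  have h2 := (h.isBigO_eigCoord_leftSol_sub (by decide : (2 : Fin 3) ≠ 0) hj₀ hl).smul (hconst v)
  simp only [smul_eq_mul, mul_one, one_mul] at h0 h1 h2
  refine ((h0.add h1).add h2).congr' ?_ EventuallyEq.rfl
  filter_upwards [tendsto_fst.eventually hl.eventually] with p hp
  rw [← map_sub]
  conv_rhs => rw [← sum_eigCoord_smul_eigCol h.pos.ne' hp.1 h.norm_eq
    (leftSol q₀ q v j₀ p.1 p.2 - eigCol q₀ v p.1 j₀)]
  rw [Fin.sum_univ_three, map_add, map_add, map_smul, map_smul, map_smul, lowerPart_eigCol_zero,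
    lowerPart_eigCol_one, lowerPart_eigCol_two]

end LeftPotential

end SlowestSolution

section TransverseComponent

/-- The component of the slowest solution along `p`, corrected so that the fast oscillation of
`fastPart` is integrated by parts. -/
def transversePart (q₀ : ℝ) (q : ℝ → Vec2) (v p : Vec2) (z : ℂ) (x : ℝ) : ℂ :=
  inner ℂ p (lowerPart (leftSol q₀ q v 2 z x)) - inner ℂ p (q x) * fastPart q₀ q v 2 z x / z ^ 2

/-- The part of the forcing term of `transversePart` that is of second order in `1 / z`. -/
def transverseRemainder (q₀ : ℝ) (q : ℝ → Vec2) (v p : Vec2) (z : ℂ) (x : ℝ) : ℂ :=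
  I / z * (inner ℂ p (q x) * inner ℂ (q x) (lowerPart (leftSol q₀ q v 2 z x) - v))
    - (inner ℂ p (deriv q x) * fastPart q₀ q v 2 z x
      + inner ℂ p (q x) * fastForcing q₀ q v 2 z x) / z ^ 2

/-- The left half of the integral whose value over the line is `ϑ₁`. -/
def transverseIntegral (q : ℝ → Vec2) (v p : Vec2) (x : ℝ) : ℂ :=
  ∫ y in Set.Iic x, inner ℂ p (q y) * inner ℂ (q y) v

/-- `transversePart` without the slow oscillation `exp (-i q₀² x / z)` and without its
leading term. -/
def transverseDefect (q₀ : ℝ) (q : ℝ → Vec2) (v p : Vec2) (z : ℂ) (x : ℝ) : ℂ :=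
  exp (I * ((q₀ : ℂ) ^ 2 / z) * x) * transversePart q₀ q v p z x
    - I / z * transverseIntegral q v p x

variable {q₀ : ℝ} {q : ℝ → Vec2} {v p : Vec2} {z : ℂ} {l : Filter ℂ}

theorem isBigO_inner_norm_sub (hp : inner ℂ p v = 0) (L : Filter (ℂ × ℝ)) :
    (fun a => inner ℂ p (q a.2)) =O[L] fun a => ‖q a.2 - v‖ := by
  refine IsBigO.of_bound ‖p‖ (Eventually.of_forall fun a => ?_)
  rw [norm_norm, ← sub_zero (inner ℂ p (q a.2)), ← hp, ← inner_sub_right]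
  exact norm_inner_le_norm _ _

theorem re_slow_nonpos (hc : ∀ j, (I * (freq q₀ z j - freq q₀ z 2)).re ≤ 0)
    (hz : z ∉ exceptional q₀) {x : ℝ} (hx : x ≤ 0) : (I * ((q₀ : ℂ) ^ 2 / z) * x).re ≤ 0 := by
  have hslow : I * (freq q₀ z 1 - freq q₀ z 2) = -(I * ((q₀ : ℂ) ^ 2 / z)) := by
    rw [← mul_kOf_sub_lamOf (not_mem_exceptional_iff.1 hz).1,
      mul_div_cancel_left₀ _ (not_mem_exceptional_iff.1 hz).1]
    simp only [freq, Matrix.cons_val]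
    ring
  have hre := hc 1
  rw [hslow, neg_re] at hre
  rw [re_mul_ofReal]
  exact mul_nonpos_of_nonneg_of_nonpos (neg_nonpos.1 hre) hx

namespace LeftPotential

theorem continuous_inner_mul_inner (h : LeftPotential q₀ q v) (p : Vec2) :
    Continuous fun x => (inner ℂ p (q x) * inner ℂ (q x) v : ℂ) :=
  (continuous_const.inner h.continuous).mul (h.continuous.inner continuous_const)

theorem integrableOn_inner_mul_inner (h : LeftPotential q₀ q v) (hp : inner ℂ p v = 0) :
    IntegrableOn (fun x => inner ℂ p (q x) * inner ℂ (q x) v) (Set.Iic 0) := by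
  have hcont : Continuous fun x => (inner ℂ (q x) v : ℂ) := h.continuous.inner continuous_const
  obtain ⟨C, hC⟩ := (isBigO_one_principal_Iic hcont
    (h.tendsto.inner tendsto_const_nhds) 0).bound
  have hsub : ∀ x, inner ℂ p (q x - v) = inner ℂ p (q x) := fun x => by
    rw [inner_sub_right, hp, sub_zero]
  have hint := (h.integrableOn_sub.const_inner p).mul_bdd hcont.aestronglyMeasurable
    (ae_restrict_of_forall_mem measurableSet_Iic (eventually_principal.1 hC))
  simp only [hsub] at hint
  exact hint

theorem hasDerivAt_transversePart (h : LeftPotential q₀ q v) (hz : z ∉ exceptional q₀)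
    (hc : ∀ j, (I * (freq q₀ z j - freq q₀ z 2)).re ≤ 0) (x : ℝ) :
    HasDerivAt (transversePart q₀ q v p z)
      (-(I * ((q₀ : ℂ) ^ 2 / z)) * transversePart q₀ q v p z x
        + (I / z * (inner ℂ p (q x) * inner ℂ (q x) v) + transverseRemainder q₀ q v p z x)) x := by
  have hz0 := (not_mem_exceptional_iff.1 hz).1
  have htail := (hasDerivAt_const x p).inner ℂ (h.hasDerivAt_lowerPart_leftSol hz hc x)
  have hq := (hasDerivAt_const x p).inner ℂ (h.diff x).hasDerivAt
  refine (htail.sub ((hq.mul (h.hasDerivAt_fastPart hz hc x)).div_const (z ^ 2))).congr_deriv ?_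
  have hhead : leftSol q₀ q v 2 z x 0
      = (fastPart q₀ q v 2 z x + inner ℂ (q x) (lowerPart (leftSol q₀ q v 2 z x))) / z := by
    rw [fastPart, sub_add_cancel, mul_div_cancel_left₀ _ hz0]
  have hslow : kOf q₀ z + freq q₀ z 2 = (q₀ : ℂ) ^ 2 / z := by
    rw [eq_div_iff hz0, mul_comm, ← mul_kOf_sub_lamOf hz0]
    rfl
  have hfast : freq q₀ z 0 - freq q₀ z 2 = z - (q₀ : ℂ) ^ 2 / z := by
    rw [← hslow]
    simp only [freq, Matrix.cons_val]
    linear_combination kOf_add_lamOf (q₀ := q₀) (z := z)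
  rw [transversePart, transverseRemainder, hfast, hslow]
  simp only [inner_sub_right, inner_smul_right, inner_zero_left, add_zero]
  rw [hhead]
  field_simp
  ring

theorem isBigO_transverseRemainder (h : LeftPotential q₀ q v) (hp : inner ℂ p v = 0)
    (hl : IsAdmissibleAtInfinity q₀ 2 l) :
    (fun a : ℂ × ℝ => transverseRemainder q₀ q v p a.1 a.2)
      =O[l ×ˢ 𝓟 (Set.Iic 0)] fun a => ‖a.1‖⁻¹ ^ 2 * decayWeight q v a.2 := by
  have hinv : (fun a : ℂ × ℝ => a.1⁻¹) =O[l ×ˢ 𝓟 (Set.Iic 0)] fun a => ‖a.1‖⁻¹ :=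
    IsBigO.of_norm_le fun a => (norm_inv a.1).le
  have hpq := (isBigO_inner_norm_sub (q := q) hp (l ×ˢ 𝓟 (Set.Iic 0))).trans
    (isBigO_sub_decayWeight q v _).norm_left
  have htail : (fun a : ℂ × ℝ => lowerPart (leftSol q₀ q v 2 a.1 a.2) - v)
      =O[l ×ˢ 𝓟 (Set.Iic 0)] fun a => ‖a.1‖⁻¹ := by
    simpa only [lowerPart_eigCol_two] using h.isBigO_lowerPart_leftSol_sub (by decide) hl
  have hmain := (hinv.const_mul_left I).mul (hpq.mul (isBigO_inner (h.isBigO_one l) htail))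
  have hderiv := (isBigO_inner (isBigO_const_const p one_ne_zero _)
    (isBigO_deriv_decayWeight q v _)).mul (h.isBigO_fastPart (by decide) hl)
  have hpq_one : (fun a : ℂ × ℝ => inner ℂ p (q a.2)) =O[l ×ˢ 𝓟 (Set.Iic 0)] fun _ => (1 : ℝ) :=
    (isBigO_inner (isBigO_const_const p one_ne_zero _) (h.isBigO_one l)).congr_right
      fun _ => one_mul 1
  have hforcing := hpq_one.mul (h.isBigO_fastForcing hl)
  have hcorr := (hinv.pow 2).mul ((hderiv.congr_right fun a => by ring).add
    (hforcing.congr_right fun a => one_mul (decayWeight q v a.2)))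
  refine ((hmain.congr_right fun a => ?_).sub hcorr).congr_left fun a => ?_
  · ring
  · rw [transverseRemainder, div_eq_mul_inv, div_eq_mul_inv, inv_pow]
    ring

theorem tendsto_transversePart (h : LeftPotential q₀ q v) (hp : inner ℂ p v = 0)
    (hz : z ∉ exceptional q₀) (hc : ∀ j, (I * (freq q₀ z j - freq q₀ z 2)).re ≤ 0) :
    Tendsto (transversePart q₀ q v p z) atBot (𝓝 0) := by
  have htail := (lowerPart.continuous.tendsto _).comp (h.tendsto_leftSol hz hc)
  rw [lowerPart_eigCol_two] at htail
  have hlim := (tendsto_const_nhds (x := p).inner htail (𝕜 := ℂ)).sub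
    (((tendsto_const_nhds (x := p).inner h.tendsto (𝕜 := ℂ)).mul
      (h.tendsto_fastPart (by decide) hz hc)).div_const (z ^ 2))
  rwa [hp, zero_mul, zero_div, sub_zero] at hlim

theorem hasDerivAt_transverseDefect (h : LeftPotential q₀ q v) (hp : inner ℂ p v = 0)
    (hz : z ∉ exceptional q₀) (hc : ∀ j, (I * (freq q₀ z j - freq q₀ z 2)).re ≤ 0) (x : ℝ) :
    HasDerivAt (transverseDefect q₀ q v p z)
      (exp (I * ((q₀ : ℂ) ^ 2 / z) * x) * transverseRemainder q₀ q v p z x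
        + (exp (I * ((q₀ : ℂ) ^ 2 / z) * x) - 1)
          * (I / z * (inner ℂ p (q x) * inner ℂ (q x) v))) x := by
  have hcont := h.continuous_inner_mul_inner p
  have hint := hasDerivAt_integral_Iic hcont
    (fun y => integrableOn_Iic_of_continuous hcont (h.integrableOn_inner_mul_inner hp) y) x
  have hexp := ((ofRealCLM.hasDerivAt (x := x)).const_mul (I * ((q₀ : ℂ) ^ 2 / z))).cexp
  refine ((hexp.mul (h.hasDerivAt_transversePart hz hc x)).sub
    (hint.const_mul (I / z))).congr_deriv ?_
  simp only [ofRealCLM_apply, ofReal_one]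
  ring

theorem tendsto_transverseDefect (h : LeftPotential q₀ q v) (hp : inner ℂ p v = 0)
    (hz : z ∉ exceptional q₀) (hc : ∀ j, (I * (freq q₀ z j - freq q₀ z 2)).re ≤ 0) :
    Tendsto (transverseDefect q₀ q v p z) atBot (𝓝 0) := by
  have hphase : IsBoundedUnder (· ≤ ·) atBot
      fun x : ℝ => ‖exp (I * ((q₀ : ℂ) ^ 2 / z) * x)‖ :=
    isBoundedUnder_of_eventually_le (a := 1) <| (eventually_le_atBot 0).mono fun x hx => by
      rw [norm_exp, Real.exp_le_one_iff]
      exact re_slow_nonpos hc hz hx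
  have hint : Tendsto (transverseIntegral q v p) atBot (𝓝 0) :=
    tendsto_integral_Iic_zero tendsto_id
  have hlim := (isBoundedUnder_le_mul_tendsto_zero hphase
    (h.tendsto_transversePart hp hz hc)).sub (hint.const_mul (I / z))
  rwa [mul_zero, sub_zero] at hlim

/-- The slow oscillation moves by `O(|x| / z)`, which is where the weight `1 + |x|` is spent. -/
theorem isBigO_deriv_transverseDefect (h : LeftPotential q₀ q v) (hp : inner ℂ p v = 0)
    (hl : IsAdmissibleAtInfinity q₀ 2 l) :
    (fun a : ℂ × ℝ => exp (I * ((q₀ : ℂ) ^ 2 / a.1) * a.2) * transverseRemainder q₀ q v p a.1 a.2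
        + (exp (I * ((q₀ : ℂ) ^ 2 / a.1) * a.2) - 1)
          * (I / a.1 * (inner ℂ p (q a.2) * inner ℂ (q a.2) v)))
      =O[l ×ˢ 𝓟 (Set.Iic 0)] fun a => ‖a.1‖⁻¹ ^ 2 * decayWeight q v a.2 := by
  have hslow : ∀ᶠ a in l ×ˢ 𝓟 (Set.Iic (0 : ℝ)), (I * ((q₀ : ℂ) ^ 2 / a.1) * a.2).re ≤ 0 :=
    eventually_prod_principal_iff.2
      (hl.eventually.mono fun _ hz _ hx => re_slow_nonpos hz.2 hz.1 hx)
  have hphase : (fun a : ℂ × ℝ => exp (I * ((q₀ : ℂ) ^ 2 / a.1) * a.2))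
      =O[l ×ˢ 𝓟 (Set.Iic 0)] fun _ => (1 : ℝ) :=
    IsBigO.of_bound' (hslow.mono fun a ha => by
      rwa [norm_exp, norm_one, Real.exp_le_one_iff])
  have hphase_sub : (fun a : ℂ × ℝ => exp (I * ((q₀ : ℂ) ^ 2 / a.1) * a.2) - 1)
      =O[l ×ˢ 𝓟 (Set.Iic 0)] fun a => ‖a.1‖⁻¹ * a.2 :=
    IsBigO.of_bound (q₀ ^ 2) (hslow.mono fun a ha => by
      refine (norm_exp_sub_one_le_of_re_nonpos ha).trans_eq ?_
      simp only [norm_mul, norm_I, norm_pow, norm_real, norm_inv, one_mul,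
        div_eq_mul_inv, Real.norm_eq_abs, sq_abs]
      rw [abs_norm, mul_assoc])
  have hinv : (fun a : ℂ × ℝ => I / a.1) =O[l ×ˢ 𝓟 (Set.Iic 0)] fun a => ‖a.1‖⁻¹ :=
    IsBigO.of_norm_le fun a => by rw [norm_div, norm_I, one_div]
  have hqv := isBigO_inner (h.isBigO_one l) (isBigO_const_const v one_ne_zero _)
  have hweight : (fun a : ℂ × ℝ => a.2 * ‖q a.2 - v‖)
      =O[l ×ˢ 𝓟 (Set.Iic 0)] fun a => decayWeight q v a.2 :=
    IsBigO.of_norm_le fun a => by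
      rw [norm_mul, norm_norm, Real.norm_eq_abs, decayWeight]
      nlinarith [norm_nonneg (q a.2 - v), norm_nonneg (deriv q a.2)]
  have hosc := hphase_sub.mul (hinv.mul ((isBigO_inner_norm_sub (q := q) hp _).mul hqv))
  refine ((hphase.mul (h.isBigO_transverseRemainder hp hl)).congr_right
    fun _ => one_mul _).add ((hosc.congr_right fun a => ?_).trans
      ((isBigO_refl (fun a : ℂ × ℝ => ‖a.1‖⁻¹ ^ 2) _).mul hweight))
  ring

theorem isBigO_transverseDefect (h : LeftPotential q₀ q v) (hp : inner ℂ p v = 0)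
    (hl : IsAdmissibleAtInfinity q₀ 2 l) :
    (fun a : ℂ × ℝ => transverseDefect q₀ q v p a.1 a.2)
      =O[l ×ˢ 𝓟 (Set.Iic 0)] fun a => ‖a.1‖⁻¹ ^ 2 :=
  isBigO_of_damped (c := 0) (s := fun z => ‖z‖⁻¹ ^ 2) (Eventually.of_forall fun _ => le_rfl)
    (hl.eventually.mono fun z hz x => by
      simpa only [Pi.zero_apply, zero_mul, zero_add]
        using h.hasDerivAt_transverseDefect hp hz.1 hz.2 x)
    (hl.eventually.mono fun _ hz => h.tendsto_transverseDefect hp hz.1 hz.2)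
    h.integrableOn_decayWeight (h.isBigO_deriv_transverseDefect hp hl)

theorem isBigO_inner_lowerPart_leftSol_sub (h : LeftPotential q₀ q v) (hp : inner ℂ p v = 0)
    (hl : IsAdmissibleAtInfinity q₀ 2 l) :
    (fun z => inner ℂ p (lowerPart (leftSol q₀ q v 2 z 0)) - I / z * transverseIntegral q v p 0)
      =O[l] fun z => ‖z‖⁻¹ ^ 2 := by
  have hat0 := tendsto_prodMk_prod_principal l (Set.mem_Iic.2 (le_refl (0 : ℝ)))
  have hfast := (((h.isBigO_fastPart (by decide) hl).comp_tendsto hat0).const_mul_left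
    (inner ℂ p (q 0))).mul ((IsBigO.of_norm_le fun z => (norm_inv z).le).pow 2)
  refine (((h.isBigO_transverseDefect hp hl).comp_tendsto hat0).add
    (hfast.congr_right fun z => one_mul _)).congr_left fun z => ?_
  simp only [Function.comp_apply, transverseDefect, transversePart, ofReal_zero, mul_zero, exp_zero]
  ring

end LeftPotential

end TransverseComponent

section BoundaryUniqueness

theorem mapsTo_I_pow_mul {s : Set ℝ} (hs : ∀ x ∈ s, -x ∈ s) (k : ℕ) :
    Set.MapsTo (I ^ k * ·) (s ×ℂ s) (s ×ℂ s) := by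
  induction k with
  | zero => exact fun w hw => by simpa only [pow_zero, one_mul] using hw
  | succ k ih =>
    intro w hw
    beta_reduce
    rw [pow_succ', mul_assoc, mem_reProdIm, I_mul_re, I_mul_im]
    exact ⟨hs _ (ih hw).2, (ih hw).1⟩

theorem exists_I_pow_mul_im_eq_neg {r : ℝ} (hr : 0 < r) {w : ℂ}
    (hw : w ∈ frontier (Set.Ioo (-r) r ×ℂ Set.Ioo (-r) r)) :
    ∃ k < 4, (I ^ k * w).im = -r := by
  rw [frontier_reProdIm, frontier_Ioo (neg_lt_self hr)] at hw
  rcases hw with ⟨-, him | him⟩ | ⟨hre | hre, -⟩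
  · exact ⟨0, by norm_num, by rwa [pow_zero, one_mul]⟩
  · exact ⟨2, by norm_num, by rw [I_sq, neg_one_mul, neg_im, him]⟩
  · exact ⟨1, by norm_num, by rwa [pow_one, I_mul_im]⟩
  · exact ⟨3, by norm_num, by rw [I_pow_three, neg_mul, neg_im, I_mul_im, hre]⟩

/-- The product of the four rotates of `F` vanishes on the whole boundary of the square, hence at
its centre. -/
theorem eq_zero_of_eq_zero_on_side {F : ℂ → ℂ} {r : ℝ} (hr : 0 < r)
    (hF : DiffContOnCl ℂ F (Set.Ioo (-r) r ×ℂ Set.Ioo (-r) r))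
    (h0 : ∀ w ∈ closure (Set.Ioo (-r) r ×ℂ Set.Ioo (-r) r), w.im = -r → F w = 0) : F 0 = 0 := by
  have hsymm : ∀ x ∈ Set.Ioo (-r) r, -x ∈ Set.Ioo (-r) r := fun x hx =>
    ⟨neg_lt_neg hx.2, neg_lt.1 hx.1⟩
  have hrot (k : ℕ) := mapsTo_I_pow_mul hsymm k
  have hcont (k : ℕ) : Continuous (I ^ k * ·) := continuous_const_mul _
  have hprod : DiffContOnCl ℂ (fun w => ∏ k ∈ Finset.range 4, F (I ^ k * w))
      (Set.Ioo (-r) r ×ℂ Set.Ioo (-r) r) :=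
    ⟨DifferentiableOn.fun_finsetProd fun k _ => hF.1.comp (by fun_prop) (hrot k),
      continuousOn_finsetProd _ fun k _ =>
        hF.2.comp (hcont k).continuousOn ((hrot k).closure (hcont k))⟩
  have hfrontier : ∀ w ∈ frontier (Set.Ioo (-r) r ×ℂ Set.Ioo (-r) r),
      ‖∏ k ∈ Finset.range 4, F (I ^ k * w)‖ ≤ 0 := fun w hw => by
    obtain ⟨k, hk, him⟩ := exists_I_pow_mul_im_eq_neg hr hw
    rw [norm_le_zero_iff]
    exact Finset.prod_eq_zero (Finset.mem_range.2 hk)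
      (h0 _ ((hrot k).closure (hcont k) hw.1) him)
  have hcentre : (0 : ℂ) ∈ Set.Ioo (-r) r ×ℂ Set.Ioo (-r) r :=
    ⟨⟨neg_lt_zero.2 hr, hr⟩, ⟨neg_lt_zero.2 hr, hr⟩⟩
  have hzero := norm_le_of_forall_mem_frontier_norm_le
    ((Metric.isBounded_Ioo _ _).reProdIm (Metric.isBounded_Ioo _ _)) hprod hfrontier
    (subset_closure hcentre)
  simpa only [mul_zero, Finset.prod_const, norm_le_zero_iff, pow_eq_zero_iff, Finset.card_range,
    ne_eq, OfNat.ofNat_ne_zero, not_false_eq_true] using hzero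

theorem eqOn_zero_of_eq_zero_on_ray {F : ℂ → ℂ} {a : ℝ}
    (hd : DifferentiableOn ℂ F {z | 0 < z.im})
    (hc : ContinuousOn F {z | a < z.re ∧ 0 ≤ z.im}) (h0 : ∀ x : ℝ, a < x → F x = 0) :
    Set.EqOn F 0 {z | 0 < z.im} := by
  have hcorner : ∀ c : ℂ, 0 < c.im → a < c.re - c.im → F c = 0 := fun c him hre => by
    have hcl : ∀ w ∈ closure (Set.Ioo (-c.im) c.im ×ℂ Set.Ioo (-c.im) c.im),
        a < (c + w).re ∧ 0 ≤ (c + w).im := fun w hw => by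
      rw [closure_reProdIm, closure_Ioo (neg_lt_self him).ne] at hw
      rw [add_re, add_im]
      exact ⟨by linarith [hw.1.1], by linarith [hw.2.1]⟩
    rw [← add_zero c]
    refine eq_zero_of_eq_zero_on_side (F := fun w => F (c + w)) him
      ⟨hd.comp (by fun_prop) fun w hw => ?_, hc.comp (by fun_prop) hcl⟩ fun w hw hwim => ?_
    · rw [Set.mem_ofPred_eq, add_im]
      linarith [hw.2.1]
    · have hreal : c + w = ((c + w).re : ℂ) :=
        Complex.ext rfl (by rw [add_im, hwim, add_neg_cancel, ofReal_im])
      rw [hreal]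
      exact h0 _ (hcl w hw).1
  have hopen : IsOpen {c : ℂ | 0 < c.im ∧ a < c.re - c.im} :=
    (isOpen_lt continuous_const continuous_im).inter
      (isOpen_lt continuous_const (continuous_re.sub continuous_im))
  have hbase : (⟨a + 2, 1⟩ : ℂ) ∈ {c : ℂ | 0 < c.im ∧ a < c.re - c.im} :=
    ⟨one_pos, show a < a + 2 - 1 by linarith⟩
  have hnear : F =ᶠ[𝓝 ⟨a + 2, 1⟩] 0 :=
    eventually_of_mem (hopen.mem_nhds hbase) fun c hc => hcorner c hc.1 hc.2
  exact (hd.analyticOnNhd (isOpen_lt continuous_const continuous_im))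
    |>.eqOn_zero_of_preconnected_of_eventuallyEq_zero (convex_halfSpace_im_gt 0).isPreconnected
      hbase.1 hnear

variable {q₀ : ℝ} {f : ℝ → ℂ} {F G : ℂ → ℂ}

theorem not_mem_exceptional_of_abs_lt_re {z : ℂ} (hz : |q₀| < z.re) : z ∉ exceptional q₀ := by
  rintro (rfl | rfl | rfl)
  · exact (abs_nonneg q₀).not_gt hz
  · exact (le_abs_self q₀).not_gt hz
  · exact (neg_le_abs q₀).not_gt hz

theorem ExtendsToUpper.unique (hF : ExtendsToUpper q₀ f F) (hG : ExtendsToUpper q₀ f G) {z : ℂ}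
    (hz : 0 ≤ z.im) (hze : z ∉ exceptional q₀) : F z = G z := by
  rcases hz.eq_or_lt with him | him
  · have hreal : (z.re : ℂ) = z := Complex.ext rfl him
    rw [← hreal] at hze ⊢
    exact (hF.boundary _ hze).trans (hG.boundary _ hze).symm
  · refine sub_eq_zero.1 (eqOn_zero_of_eq_zero_on_ray (F := fun z => F z - G z) (a := |q₀|)
      (hF.holo.sub hG.holo) ((hF.cont.sub hG.cont).mono fun w hw =>
        ⟨hw.2, not_mem_exceptional_of_abs_lt_re hw.1⟩) (fun x hx => ?_) him)
    have hxe : x ∈ realSpectrum q₀ := not_mem_exceptional_of_abs_lt_re hx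
    rw [hF.boundary x hxe, hG.boundary x hxe, sub_self]

theorem neg_mem_exceptional_iff {z : ℂ} : -z ∈ exceptional q₀ ↔ z ∈ exceptional q₀ := by
  rw [← not_iff_not, not_mem_exceptional_iff, not_mem_exceptional_iff, neg_sq, neg_ne_zero]

theorem ExtendsToLower.comp_neg (hF : ExtendsToLower q₀ f F) :
    ExtendsToUpper q₀ (fun x => f (-x)) (fun z => F (-z)) where
  holo := hF.holo.comp (differentiableOn_neg _) fun z hz => by
    rw [Set.mem_ofPred_eq, neg_im]
    exact neg_neg_of_pos hz
  cont := hF.cont.comp continuousOn_neg fun z hz =>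
    ⟨by rw [Set.mem_ofPred_eq, neg_im]; exact neg_nonpos.2 hz.1,
      fun h => hz.2 (neg_mem_exceptional_iff.1 h)⟩
  boundary z hz := by
    rw [← ofReal_neg]
    exact hF.boundary (-z) fun h => hz (neg_mem_exceptional_iff.1 (by rwa [ofReal_neg] at h))

theorem ExtendsToLower.unique (hF : ExtendsToLower q₀ f F) (hG : ExtendsToLower q₀ f G) {z : ℂ}
    (hz : z.im ≤ 0) (hze : z ∉ exceptional q₀) : F z = G z := by
  have hneg := hF.comp_neg.unique hG.comp_neg (z := -z) (by rw [neg_im]; exact neg_nonneg.2 hz)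
    fun h => hze (neg_mem_exceptional_iff.1 h)
  rwa [neg_neg] at hneg

end BoundaryUniqueness

section IndefiniteForm

/-- The sesquilinear form `φ† J χ`, which is conserved by the scattering problem at real `z`. -/
def jform (φ χ : Fin 3 → ℂ) : ℂ := star (φ 0) * χ 0 - star (φ 1) * χ 1 - star (φ 2) * χ 2

theorem jform_smul_smul (a b : ℂ) (φ χ : Fin 3 → ℂ) :
    jform (a • φ) (b • χ) = star a * b * jform φ χ := by
  simp only [jform, Pi.smul_apply, smul_eq_mul, star_mul']
  ring

theorem star_jform (φ χ : Fin 3 → ℂ) : star (jform φ χ) = jform χ φ := by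
  simp only [jform, star_sub, star_mul', star_star]
  ring

theorem conjTranspose_mul_matJ_mul_apply (A B : Mat3) (i j : Fin 3) :
    (A.conjTranspose * matJ * B) i j = jform (A.col i) (B.col j) := by
  rw [Matrix.mul_apply, Fin.sum_univ_three]
  simp only [matJ, Matrix.mul_diagonal, jform, Matrix.conjTranspose_apply, Matrix.col_apply,
    Matrix.cons_val]
  ring

theorem norm_jform_le (φ χ : Fin 3 → ℂ) : ‖jform φ χ‖ ≤ 3 * (‖φ‖ * ‖χ‖) := by
  have h : ∀ i, ‖star (φ i) * χ i‖ ≤ ‖φ‖ * ‖χ‖ := fun i => by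
    rw [norm_mul, norm_star]
    exact mul_le_mul (norm_le_pi_norm φ i) (norm_le_pi_norm χ i) (norm_nonneg _) (norm_nonneg _)
  have h₁ := norm_sub_le (star (φ 0) * χ 0 - star (φ 1) * χ 1) (star (φ 2) * χ 2)
  have h₂ := norm_sub_le (star (φ 0) * χ 0) (star (φ 1) * χ 1)
  rw [jform]
  linarith [h 0, h 1, h 2]

theorem isBigO_jform {α : Type*} (l : Filter α) (f g : α → Fin 3 → ℂ) :
    (fun x => jform (f x) (g x)) =O[l] fun x => ‖f x‖ * ‖g x‖ :=
  IsBigO.of_bound 3 <| Eventually.of_forall fun x => by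
    rw [norm_mul, norm_norm, norm_norm]
    exact norm_jform_le _ _

theorem tendsto_jform_sub_jform {α : Type*} {l : Filter α} {f g b c : α → Fin 3 → ℂ}
    (hb : b =O[l] fun _ => (1 : ℝ)) (hc : c =O[l] fun _ => (1 : ℝ))
    (hf : Tendsto (fun x => f x - b x) l (𝓝 0)) (hg : Tendsto (fun x => g x - c x) l (𝓝 0)) :
    Tendsto (fun x => jform (f x) (g x) - jform (b x) (c x)) l (𝓝 0) := by
  have hf₀ : (fun x => f x - b x) =o[l] fun _ => (1 : ℝ) := (isLittleO_one_iff ℝ).2 hf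
  have hg₀ : (fun x => g x - c x) =o[l] fun _ => (1 : ℝ) := (isLittleO_one_iff ℝ).2 hg
  have hg₁ : g =O[l] fun _ => (1 : ℝ) :=
    (hg₀.isBigO.add hc).congr_left fun x => sub_add_cancel (g x) (c x)
  have h₁ := (isBigO_jform l (fun x => f x - b x) g).trans_isLittleO
    (hf₀.norm_left.mul_isBigO hg₁.norm_left)
  have h₂ := (isBigO_jform l b fun x => g x - c x).trans_isLittleO
    (hb.norm_left.mul_isLittleO hg₀.norm_left)
  refine (isLittleO_one_iff ℝ).1 (((h₁.congr_right fun _ => one_mul _).add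
    (h₂.congr_right fun _ => one_mul _)).congr_left fun x => ?_)
  simp only [jform, Pi.sub_apply, star_sub]
  ring

/-- `φ` solves the scattering problem `φ' = X φ`. -/
def IsSol (q₀ : ℝ) (q : ℝ → Vec2) (z : ℂ) (φ : ℝ → Fin 3 → ℂ) : Prop :=
  ∀ x, HasDerivAt φ ((matX q₀ (q x) z).mulVec (φ x)) x

variable {q₀ : ℝ} {q : ℝ → Vec2} {z : ℝ} {φ χ : ℝ → Fin 3 → ℂ}

theorem star_kOf_ofReal : star (kOf q₀ z) = kOf q₀ z := by
  simp only [kOf, star_div₀, star_add, star_pow, star_ofNat, RCLike.star_def, conj_ofReal]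

theorem star_rhoHat_ofReal : star (rhoHat q₀ z) = rhoHat q₀ z := by
  simp only [rhoHat, star_div₀, star_sub, star_pow, RCLike.star_def, conj_ofReal]

theorem IsSol.smul {w : ℂ} (hφ : IsSol q₀ q w φ) (a : ℂ) : IsSol q₀ q w fun x => a • φ x :=
  fun x => ((hφ x).const_smul a).congr_deriv (by rw [Matrix.mulVec_smul])

theorem IsSol.sub {w : ℂ} (hφ : IsSol q₀ q w φ) (hχ : IsSol q₀ q w χ) :
    IsSol q₀ q w fun x => φ x - χ x :=
  fun x => ((hφ x).sub (hχ x)).congr_deriv (by rw [Matrix.mulVec_sub])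

theorem jform_eq_of_isSol (hφ : IsSol q₀ q z φ) (hχ : IsSol q₀ q z χ) (x y : ℝ) :
    jform (φ x) (χ x) = jform (φ y) (χ y) := by
  have hd : ∀ x, HasDerivAt (fun x => jform (φ x) (χ x)) 0 x := fun x => by
    have h := fun i => (hasDerivAt_pi.1 (hφ x) i).star.mul (hasDerivAt_pi.1 (hχ x) i)
    refine (((h 0).sub (h 1)).sub (h 2)).congr_deriv ?_
    rw [matX_mulVec, matX_mulVec]
    simp only [Matrix.cons_val, star_sub, star_mul', star_add, star_star, star_kOf_ofReal,
      show star I = -I from conj_I]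
    ring
  exact is_const_of_deriv_eq_zero (fun x => (hd x).differentiableAt) (fun x => (hd x).deriv) x y

theorem jform_eq_of_tendsto {l : Filter ℝ} [l.NeBot] {b b' : ℝ → Fin 3 → ℂ} {c : ℂ}
    (hφ : IsSol q₀ q z φ) (hχ : IsSol q₀ q z χ)
    (hb : b =O[l] fun _ => (1 : ℝ)) (hb' : b' =O[l] fun _ => (1 : ℝ))
    (hφb : Tendsto (fun x => φ x - b x) l (𝓝 0)) (hχb : Tendsto (fun x => χ x - b' x) l (𝓝 0))
    (hc : ∀ x, jform (b x) (b' x) = c) (x : ℝ) : jform (φ x) (χ x) = c := by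
  have h := tendsto_jform_sub_jform hb hb' hφb hχb
  simp only [hc, jform_eq_of_isSol hφ hχ _ x] at h
  exact sub_eq_zero.1 (tendsto_nhds_unique tendsto_const_nhds h)

end IndefiniteForm

section OrthogonalSystems

/-- Three solutions of the scattering problem that are orthogonal for `jform`, with Gram matrix
`diag d`. -/
structure IsOrthogonalSystem (q₀ : ℝ) (q : ℝ → Vec2) (z : ℝ) (d : Fin 3 → ℂ)
    (φ : Fin 3 → ℝ → Fin 3 → ℂ) : Prop where
  sol : ∀ j, IsSol q₀ q z (φ j)
  ne_zero : ∀ j, d j ≠ 0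
  gram : ∀ i j x, jform (φ i x) (φ j x) = if i = j then d i else 0

/-- The matrix whose columns are the values at `x` of the functions `φ j`. -/
def colMatrix (φ : Fin 3 → ℝ → Fin 3 → ℂ) (x : ℝ) : Mat3 := Matrix.of fun i j => φ j x i

namespace IsOrthogonalSystem

variable {q₀ : ℝ} {q : ℝ → Vec2} {z : ℝ} {d : Fin 3 → ℂ} {φ χ : Fin 3 → ℝ → Fin 3 → ℂ}
  {H : Mat3}

theorem smul (hφ : IsOrthogonalSystem q₀ q z d φ) {a : Fin 3 → ℂ} (ha : ∀ j, a j ≠ 0) :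
    IsOrthogonalSystem q₀ q z (fun j => star (a j) * a j * d j) fun j x => a j • φ j x where
  sol j := (hφ.sol j).smul (a j)
  ne_zero j := mul_ne_zero (mul_ne_zero (star_ne_zero.2 (ha j)) (ha j)) (hφ.ne_zero j)
  gram i j x := by
    rw [jform_smul_smul, hφ.gram]
    split_ifs with h
    · rw [h]
    · rw [mul_zero]

theorem conjTranspose_mul_colMatrix (hφ : IsOrthogonalSystem q₀ q z d φ) (x : ℝ) :
    (colMatrix φ x).conjTranspose * matJ * colMatrix φ x = Matrix.diagonal d := by
  ext i j
  rw [conjTranspose_mul_matJ_mul_apply, Matrix.diagonal_apply]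
  exact hφ.gram i j x

theorem isUnit_det_colMatrix (hφ : IsOrthogonalSystem q₀ q z d φ) (x : ℝ) :
    IsUnit (colMatrix φ x).det := by
  have h := congrArg Matrix.det (hφ.conjTranspose_mul_colMatrix x)
  rw [Matrix.det_mul, Matrix.det_diagonal] at h
  exact isUnit_of_mul_isUnit_right
    (h ▸ (Finset.prod_ne_zero_iff.2 fun j _ => hφ.ne_zero j).isUnit)

theorem mul_apply_of_colMatrix_eq (hφ : IsOrthogonalSystem q₀ q z d φ) {x : ℝ}
    (h : colMatrix χ x = colMatrix φ x * H) (i j : Fin 3) :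
    d i * H i j = jform (φ i x) (χ j x) := by
  have h' := conjTranspose_mul_matJ_mul_apply (colMatrix φ x) (colMatrix χ x) i j
  rw [h, ← Matrix.mul_assoc, hφ.conjTranspose_mul_colMatrix, Matrix.diagonal_mul, ← h] at h'
  exact h'

/-- The coordinates of a solution in an orthogonal system are constant because `jform` is
conserved. -/
theorem exists_colMatrix_eq_mul (hφ : IsOrthogonalSystem q₀ q z d φ)
    (hχ : ∀ j, IsSol q₀ q z (χ j)) : ∃ H, ∀ x, colMatrix χ x = colMatrix φ x * H := by
  refine ⟨Matrix.of fun i j => (d i)⁻¹ * jform (φ i 0) (χ j 0), fun x => ?_⟩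
  have hu := hφ.isUnit_det_colMatrix x
  suffices h : Matrix.of (fun i j => (d i)⁻¹ * jform (φ i 0) (χ j 0))
      = (colMatrix φ x)⁻¹ * colMatrix χ x by
    rw [h, Matrix.mul_nonsing_inv_cancel_left _ _ hu]
  ext i j
  have h := hφ.mul_apply_of_colMatrix_eq
    (Matrix.mul_nonsing_inv_cancel_left _ (colMatrix χ x) hu).symm i j
  rw [Matrix.of_apply, jform_eq_of_isSol (hφ.sol i) (hχ j) 0 x, ← h,
    inv_mul_cancel_left₀ (hφ.ne_zero i)]

theorem eq_zero_of_jform_eq_zero (hφ : IsOrthogonalSystem q₀ q z d φ) {x : ℝ} {u : Fin 3 → ℂ}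
    (hu : ∀ i, jform (φ i x) u = 0) : u = 0 := by
  have hdet := hφ.isUnit_det_colMatrix x
  have hinv : (colMatrix φ x)⁻¹ * colMatrix (fun _ _ => u) x = 0 := by
    ext i j
    have h := hφ.mul_apply_of_colMatrix_eq (χ := fun _ _ => u)
      (Matrix.mul_nonsing_inv_cancel_left _ _ hdet).symm i j
    rw [hu] at h
    exact (mul_eq_zero.1 h).resolve_left (hφ.ne_zero i)
  have h₀ : colMatrix (fun _ _ => u) x = 0 := by
    rw [← Matrix.mul_nonsing_inv_cancel_left _ (colMatrix (fun _ _ => u) x) hdet, hinv,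
      Matrix.mul_zero]
  ext i
  exact congrFun₂ h₀ i 0

end IsOrthogonalSystem

end OrthogonalSystems

section Waves

/-- The plane-wave solutions for the constant potential `v`. -/
def eigWave (q₀ : ℝ) (v : Vec2) (z : ℂ) (j : Fin 3) (x : ℝ) : Fin 3 → ℂ :=
  Complex.exp (I * freq q₀ z j * x) • eigCol q₀ v z j

/-- `φ` solves the scattering problem and is asymptotic along `l` to the `j`-th plane wave. -/
structure IsWave (q₀ : ℝ) (q : ℝ → Vec2) (l : Filter ℝ) (v : Vec2) (z : ℝ) (j : Fin 3)
    (φ : ℝ → Fin 3 → ℂ) : Prop where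
  sol : IsSol q₀ q z φ
  tendsto : Tendsto (fun x => φ x - eigWave q₀ v z j x) l (𝓝 0)

/-- The diagonal of the Gram matrix of `eigCol` for `jform`. -/
def eigForm (q₀ : ℝ) (z : ℂ) : Fin 3 → ℂ :=
  ![(rhoHat q₀ z)⁻¹, -(q₀ : ℂ) ^ 2, -((q₀ : ℂ) ^ 2 * (rhoHat q₀ z)⁻¹)]

variable {q₀ : ℝ} {q : ℝ → Vec2} {v : Vec2} {z : ℝ} {l : Filter ℝ} {j : Fin 3}
  {φ χ : ℝ → Fin 3 → ℂ}

theorem rhoHat_ne_zero {w : ℂ} (hw : w ∉ exceptional q₀) : rhoHat q₀ w ≠ 0 := by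
  obtain ⟨h₀, h₁⟩ := not_mem_exceptional_iff.1 hw
  exact div_ne_zero (pow_ne_zero 2 h₀) h₁

theorem eigForm_ne_zero (hq : q₀ ≠ 0) {w : ℂ} (hw : w ∉ exceptional q₀) (j : Fin 3) :
    eigForm q₀ w j ≠ 0 := by
  have hq' : (q₀ : ℂ) ^ 2 ≠ 0 := pow_ne_zero 2 (ofReal_ne_zero.2 hq)
  have hρ := inv_ne_zero (rhoHat_ne_zero hw)
  fin_cases j
  exacts [hρ, neg_ne_zero.2 hq', neg_ne_zero.2 (mul_ne_zero hq' hρ)]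

theorem star_eigForm_ofReal (j : Fin 3) : star (eigForm q₀ z j) = eigForm q₀ z j := by
  fin_cases j <;>
    simp only [eigForm, Fin.zero_eta, Fin.mk_one, Fin.reduceFinMk, Matrix.cons_val, star_neg,
      star_mul', star_inv₀, star_pow, star_rhoHat_ofReal, RCLike.star_def, conj_ofReal]

theorem inv_rhoHat {w : ℂ} (hw : w ≠ 0) : (rhoHat q₀ w)⁻¹ = 1 - (q₀ : ℂ) ^ 2 / w ^ 2 := by
  rw [rhoHat, inv_div, sub_div, div_self (pow_ne_zero 2 hw)]

theorem jform_eigCol (hz : z ≠ 0) (hv : ‖v‖ = q₀) (i j : Fin 3) :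
    jform (eigCol q₀ v z i) (eigCol q₀ v z j) = if i = j then eigForm q₀ z i else 0 := by
  have hz' : (z : ℂ) ≠ 0 := ofReal_ne_zero.2 hz
  have hn := vec2_norm_sq v
  rw [hv] at hn
  have hzz : star (z : ℂ) = z := conj_ofReal z
  have hqq : star (q₀ : ℂ) = q₀ := conj_ofReal q₀
  fin_cases i <;> fin_cases j <;>
    simp only [jform, eigCol, eigForm, inv_rhoHat hz', perp_zero, perp_one, Fin.zero_eta,
      Fin.mk_one, Fin.reduceFinMk, Fin.reduceEq, Matrix.cons_val, if_true, if_false, star_one,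
      star_zero, star_neg, star_div₀, star_star, star_pow, hzz, hqq] <;>
    field_simp <;>
    first
    | ring1
    | linear_combination -hn
    | linear_combination -(z : ℂ) ^ 2 * hn

theorem norm_exp_freq_ofReal (j : Fin 3) (x : ℝ) :
    ‖Complex.exp (I * freq q₀ z j * x)‖ = 1 := by
  rw [Complex.norm_exp, mul_assoc, Complex.I_mul_re, Complex.im_mul_ofReal, freq_ofReal_im,
    zero_mul, neg_zero, Real.exp_zero]

theorem isBigO_eigWave_one (j : Fin 3) : eigWave q₀ v z j =O[l] fun _ => (1 : ℝ) :=
  IsBigO.of_bound ‖eigCol q₀ v z j‖ <| Eventually.of_forall fun x => by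
    rw [eigWave, norm_smul, norm_exp_freq_ofReal, one_mul, norm_one, mul_one]

theorem jform_eigWave (hz : z ≠ 0) (hv : ‖v‖ = q₀) (i j : Fin 3) (x : ℝ) :
    jform (eigWave q₀ v z i x) (eigWave q₀ v z j x) = if i = j then eigForm q₀ z i else 0 := by
  rw [eigWave, eigWave, jform_smul_smul, jform_eigCol hz hv]
  split_ifs with h
  · rw [h, RCLike.star_def, conj_mul', norm_exp_freq_ofReal, ofReal_one, one_pow, one_mul]
  · rw [mul_zero]

namespace IsWave

theorem isOrthogonalSystem [l.NeBot] (hq : q₀ ≠ 0) (hz : z ∈ realSpectrum q₀) (hv : ‖v‖ = q₀)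
    {φ : Fin 3 → ℝ → Fin 3 → ℂ} (h : ∀ j, IsWave q₀ q l v z j (φ j)) :
    IsOrthogonalSystem q₀ q z (eigForm q₀ z) φ where
  sol j := (h j).sol
  ne_zero := eigForm_ne_zero hq hz
  gram i j := jform_eq_of_tendsto (h i).sol (h j).sol (isBigO_eigWave_one i) (isBigO_eigWave_one j)
    (h i).tendsto (h j).tendsto
    (jform_eigWave (ofReal_ne_zero.1 (not_mem_exceptional_iff.1 hz).1) hv i j)

theorem eq [l.NeBot] (hq : q₀ ≠ 0) (hz : z ∈ realSpectrum q₀) (hv : ‖v‖ = q₀)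
    {φ : Fin 3 → ℝ → Fin 3 → ℂ} (h : ∀ j, IsWave q₀ q l v z j (φ j))
    (hχ : IsWave q₀ q l v z j χ) (x : ℝ) : χ x = φ j x := by
  have hlim : Tendsto (fun y => χ y - φ j y) l (𝓝 0) := by
    simpa only [sub_sub_sub_cancel_right, sub_zero] using hχ.tendsto.sub (h j).tendsto
  refine sub_eq_zero.1
    ((isOrthogonalSystem hq hz hv h).eq_zero_of_jform_eq_zero (x := x) fun i => ?_)
  exact jform_eq_of_tendsto (h i).sol (hχ.sol.sub (h j).sol) (isBigO_eigWave_one i)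
    (isBigO_zero _ _) (h i).tendsto (by simpa only [sub_zero] using hlim)
    (fun y => by simp only [jform, Pi.zero_apply, mul_zero, sub_zero]) x

theorem of_exp_smul {w : ℝ → Fin 3 → ℂ}
    (hd : ∀ x, HasDerivAt w ((matX q₀ (q x) z).mulVec (w x) - (I * freq q₀ z j) • w x) x)
    (hw : Tendsto w l (𝓝 (eigCol q₀ v z j))) :
    IsWave q₀ q l v z j fun x => Complex.exp (I * freq q₀ z j * x) • w x where
  sol x := by
    have hexp : HasDerivAt (fun x : ℝ => Complex.exp (I * freq q₀ z j * x))
        (Complex.exp (I * freq q₀ z j * x) * (I * freq q₀ z j)) x := by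
      simpa only [id, ofReal_one, mul_one] using
        ((hasDerivAt_id x).ofReal_comp.const_mul (I * freq q₀ z j)).cexp
    refine (hexp.smul (hd x)).congr_deriv ?_
    rw [Matrix.mulVec_smul]
    module
  tendsto := by
    refine squeeze_zero_norm (fun x => le_of_eq ?_)
      (tendsto_zero_iff_norm_tendsto_zero.1 (tendsto_sub_nhds_zero_iff.2 hw))
    rw [eigWave, ← smul_sub, norm_smul, norm_exp_freq_ofReal, one_mul]

end IsWave

theorem re_I_mul_freq_sub_ofReal (z : ℝ) (i j : Fin 3) :
    (I * (freq q₀ z i - freq q₀ z j)).re = 0 := by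
  rw [I_mul_re, sub_im, freq_ofReal_im, freq_ofReal_im, sub_zero, neg_zero]

/-- The left Jost column: the bounded solution `leftSol` with its phase restored. -/
def leftWave (q₀ : ℝ) (q : ℝ → Vec2) (v : Vec2) (j : Fin 3) (z x : ℝ) : Fin 3 → ℂ :=
  Complex.exp (I * freq q₀ z j * x) • leftSol q₀ q v j z x

theorem LeftPotential.isWave_leftWave (h : LeftPotential q₀ q v) (hz : z ∈ realSpectrum q₀)
    (j : Fin 3) : IsWave q₀ q atBot v z j (leftWave q₀ q v j z) :=
  .of_exp_smul (h.hasDerivAt_leftSol hz fun i => (re_I_mul_freq_sub_ofReal z i j).le)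
    (h.tendsto_leftSol hz fun i => (re_I_mul_freq_sub_ofReal z i j).le)

end Waves

section Reflection

variable {q₀ : ℝ} {q : ℝ → Vec2} {v : Vec2} {z : ℝ}

theorem kOf_neg (w : ℂ) : kOf q₀ (-w) = -kOf q₀ w := by
  rw [kOf, kOf, div_neg]
  ring

theorem lamOf_neg (w : ℂ) : lamOf q₀ (-w) = -lamOf q₀ w := by
  rw [lamOf, lamOf, div_neg]
  ring

theorem freq_neg (w : ℂ) (j : Fin 3) : freq q₀ (-w) j = -freq q₀ w j := by
  fin_cases j <;>
    simp only [freq, kOf_neg, lamOf_neg, Fin.zero_eta, Fin.mk_one, Fin.reduceFinMk, Matrix.cons_val]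

theorem matX_neg_neg (v : Vec2) (w : ℂ) : matX q₀ (-v) (-w) = -matX q₀ v w := by
  have hQ : matQ (-v) = -matQ v := by
    ext i j
    fin_cases i <;> fin_cases j <;>
      simp only [matQ, PiLp.neg_apply, star_neg, neg_neg, neg_zero, Matrix.neg_apply,
        Fin.zero_eta, Fin.mk_one, Fin.reduceFinMk, Matrix.of_apply, Matrix.cons_val]
  rw [matX, matX, kOf_neg, hQ]
  module

/-- The signs of the eigenvectors under `(v, z) ↦ (-v, -z)`. -/
def reflectSign : Fin 3 → ℂ := ![1, -1, -1]

theorem eigCol_neg_neg (v : Vec2) (w : ℂ) (j : Fin 3) :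
    eigCol q₀ (-v) (-w) j = reflectSign j • eigCol q₀ v w j := by
  ext i
  fin_cases j <;> fin_cases i <;>
    simp only [eigCol, reflectSign, perp_zero, perp_one, PiLp.neg_apply, star_neg, neg_neg,
      neg_div, div_neg, Fin.zero_eta, Fin.mk_one, Fin.reduceFinMk, Matrix.cons_val,
      Pi.smul_apply, smul_eq_mul, neg_one_mul, one_mul, neg_zero]

theorem reflectSign_mul_self (j : Fin 3) : reflectSign j * reflectSign j = 1 := by
  fin_cases j <;> simp [reflectSign]

/-- The potential of the problem reflected at `x = 0`, which exchanges the two Jost problems. -/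
def reflectPot (q : ℝ → Vec2) (x : ℝ) : Vec2 := -q (-x)

/-- The right Jost column: the left solution of the reflected problem, with its phase restored. -/
def rightWave (q₀ : ℝ) (q : ℝ → Vec2) (v : Vec2) (j : Fin 3) (z x : ℝ) : Fin 3 → ℂ :=
  Complex.exp (I * freq q₀ z j * x) •
    reflectSign j • leftSol q₀ (reflectPot q) (-v) j (-(z : ℂ)) (-x)

theorem LeftPotential.isWave_rightWave (h : LeftPotential q₀ (reflectPot q) (-v))
    (hz : z ∈ realSpectrum q₀) (j : Fin 3) :
    IsWave q₀ q atTop v z j (rightWave q₀ q v j z) := by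
  have hz' : -(z : ℂ) ∉ exceptional q₀ := mt neg_mem_exceptional_iff.1 hz
  have hc (i : Fin 3) : (I * (freq q₀ (-(z : ℂ)) i - freq q₀ (-(z : ℂ)) j)).re ≤ 0 := by
    rw [← ofReal_neg]
    exact (re_I_mul_freq_sub_ofReal (-z) i j).le
  refine .of_exp_smul (fun x => ?_) ?_
  · have hd := (h.hasDerivAt_leftSol hz' hc (-x)).scomp x (hasDerivAt_neg x)
    refine (hd.const_smul (reflectSign j)).congr_deriv ?_
    rw [reflectPot, neg_neg, matX_neg_neg, freq_neg, Matrix.mulVec_smul, Matrix.neg_mulVec]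
    module
  · have ht := ((h.tendsto_leftSol hz' hc).comp tendsto_neg_atTop_atBot).const_smul (reflectSign j)
    rwa [eigCol_neg_neg, smul_smul, reflectSign_mul_self, one_smul] at ht

end Reflection

section Inversion

variable {q₀ : ℝ} {q : ℝ → Vec2} {v : Vec2} {z : ℝ} {w : ℂ} {l : Filter ℝ}
  {φ : ℝ → Fin 3 → ℂ}

theorem sq_div_not_mem_exceptional (hq : q₀ ≠ 0) (hw : w ∉ exceptional q₀) :
    (q₀ : ℂ) ^ 2 / w ∉ exceptional q₀ := by
  obtain ⟨h₀, h₁⟩ := not_mem_exceptional_iff.1 hw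
  have hq' : (q₀ : ℂ) ≠ 0 := ofReal_ne_zero.2 hq
  refine not_mem_exceptional_iff.2 ⟨div_ne_zero (pow_ne_zero 2 hq') h₀, ?_⟩
  have h : ((q₀ : ℂ) ^ 2 / w) ^ 2 - (q₀ : ℂ) ^ 2
      = -((q₀ : ℂ) ^ 2 * (w ^ 2 - (q₀ : ℂ) ^ 2) / w ^ 2) := by
    field_simp
    ring
  rw [h]
  exact neg_ne_zero.2 (div_ne_zero (mul_ne_zero (pow_ne_zero 2 hq') h₁) (pow_ne_zero 2 h₀))

theorem sq_div_mem_realSpectrum (hq : q₀ ≠ 0) (hz : z ∈ realSpectrum q₀) :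
    q₀ ^ 2 / z ∈ realSpectrum q₀ := by
  simpa only [realSpectrum, Set.mem_ofPred_eq, ofReal_div, ofReal_pow] using
    sq_div_not_mem_exceptional hq hz

theorem kOf_sq_div (hq : q₀ ≠ 0) (hw : w ≠ 0) : kOf q₀ ((q₀ : ℂ) ^ 2 / w) = kOf q₀ w := by
  have hq' : (q₀ : ℂ) ≠ 0 := ofReal_ne_zero.2 hq
  rw [kOf, kOf]
  field_simp
  ring

theorem lamOf_sq_div (hq : q₀ ≠ 0) (hw : w ≠ 0) : lamOf q₀ ((q₀ : ℂ) ^ 2 / w) = -lamOf q₀ w := by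
  have hq' : (q₀ : ℂ) ≠ 0 := ofReal_ne_zero.2 hq
  rw [lamOf, lamOf]
  field_simp
  ring

theorem IsSol.of_sq_div (hq : q₀ ≠ 0) (hw : w ≠ 0)
    (h : IsSol q₀ q ((q₀ : ℂ) ^ 2 / w) φ) : IsSol q₀ q w φ := by
  intro x
  have hx := h x
  rwa [matX, kOf_sq_div hq hw] at hx

theorem eigWave_two_sq_div (hq : q₀ ≠ 0) (hw : w ≠ 0) (x : ℝ) :
    eigWave q₀ v ((q₀ : ℂ) ^ 2 / w) 2 x = w • eigWave q₀ v w 0 x := by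
  have hq' : (q₀ : ℂ) ≠ 0 := ofReal_ne_zero.2 hq
  have hf : freq q₀ ((q₀ : ℂ) ^ 2 / w) 2 = freq q₀ w 0 := by
    simp only [freq, Matrix.cons_val, lamOf_sq_div hq hw, neg_neg]
  rw [eigWave, eigWave, hf, smul_comm]
  congr 1
  ext i
  fin_cases i <;>
    simp only [eigCol, Fin.zero_eta, Fin.mk_one, Fin.reduceFinMk, Matrix.cons_val, Pi.smul_apply,
      smul_eq_mul] <;>
    field_simp

theorem eigWave_one_sq_div (hq : q₀ ≠ 0) (hw : w ≠ 0) (x : ℝ) :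
    eigWave q₀ v ((q₀ : ℂ) ^ 2 / w) 1 x = eigWave q₀ v w 1 x := by
  have hf : freq q₀ ((q₀ : ℂ) ^ 2 / w) 1 = freq q₀ w 1 := by
    simp only [freq, Matrix.cons_val, kOf_sq_div hq hw]
  rw [eigWave, eigWave, hf]
  rfl

theorem IsWave.zero_of_sq_div (hq : q₀ ≠ 0) (hz : z ≠ 0)
    (h : IsWave q₀ q l v (q₀ ^ 2 / z) 2 φ) :
    IsWave q₀ q l v z 0 fun x => (z : ℂ)⁻¹ • φ x := by
  have hz' : (z : ℂ) ≠ 0 := ofReal_ne_zero.2 hz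
  obtain ⟨hsol, hlim⟩ := h
  rw [ofReal_div, ofReal_pow] at hsol hlim
  refine ⟨(hsol.of_sq_div hq hz').smul _, ?_⟩
  have hlim' := hlim.const_smul (z : ℂ)⁻¹
  rw [smul_zero] at hlim'
  refine hlim'.congr fun x => ?_
  rw [eigWave_two_sq_div hq hz', smul_sub, smul_smul, inv_mul_cancel₀ hz', one_smul]

theorem IsWave.one_of_sq_div (hq : q₀ ≠ 0) (hz : z ≠ 0)
    (h : IsWave q₀ q l v (q₀ ^ 2 / z) 1 φ) : IsWave q₀ q l v z 1 φ := by
  have hz' : (z : ℂ) ≠ 0 := ofReal_ne_zero.2 hz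
  obtain ⟨hsol, hlim⟩ := h
  rw [ofReal_div, ofReal_pow] at hsol hlim
  refine ⟨hsol.of_sq_div hq hz', hlim.congr fun x => ?_⟩
  rw [eigWave_one_sq_div hq hz']

end Inversion

section JostMatrices

/-- The scalars relating the columns of `matY` to `eigCol`. -/
def colScale (q₀ : ℝ) (z : ℂ) : Fin 3 → ℂ := ![I * rhoHat q₀ z, 1 / q₀, rhoHat q₀ z / q₀]

/-- The time-dependent part of the phases. -/
def timePhase (q₀ σ t : ℝ) (z : ℂ) : Fin 3 → ℂ :=
  ![2 * lamOf q₀ z * (kOf q₀ z + σ * (3 * kOf q₀ z ^ 2 - lamOf q₀ z ^ 2)) * t,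
    -((lamOf q₀ z ^ 2 + kOf q₀ z ^ 2 + 4 * σ * kOf q₀ z ^ 3) * t),
    -(2 * lamOf q₀ z * (kOf q₀ z + σ * (3 * kOf q₀ z ^ 2 - lamOf q₀ z ^ 2)) * t)]

/-- The normalization of the Jost columns relative to `eigWave`. -/
def jostScale (q₀ σ t : ℝ) (z : ℂ) (j : Fin 3) : ℂ :=
  colScale q₀ z j * Complex.exp (I * timePhase q₀ σ t z j)

variable {q₀ σ t : ℝ} {v v' : Vec2} {z : ℝ} {w : ℂ} {l l' : Filter ℝ} {j : Fin 3}

theorem jostScale_ne_zero (hq : q₀ ≠ 0) (hw : w ∉ exceptional q₀) (j : Fin 3) :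
    jostScale q₀ σ t w j ≠ 0 := by
  have hq' : (q₀ : ℂ) ≠ 0 := ofReal_ne_zero.2 hq
  have hρ := rhoHat_ne_zero hw
  refine mul_ne_zero ?_ (Complex.exp_ne_zero _)
  fin_cases j
  exacts [mul_ne_zero I_ne_zero hρ, one_div_ne_zero hq', div_ne_zero hρ hq']

theorem matY_apply (hq : q₀ ≠ 0) (w : ℂ) (i j : Fin 3) :
    matY q₀ v w i j = colScale q₀ w j * eigCol q₀ v w j i := by
  have hq' : (q₀ : ℂ) ≠ 0 := ofReal_ne_zero.2 hq
  fin_cases i <;> fin_cases j <;> simp [matY, colScale, eigCol] <;> field_simp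

theorem expDelta_apply (w : ℂ) (x : ℝ) (j : Fin 3) :
    expDelta q₀ σ w x t j j
      = Complex.exp (I * timePhase q₀ σ t w j) * Complex.exp (I * freq q₀ w j * x) := by
  rw [expDelta, Matrix.diagonal_apply_eq, ← Complex.exp_add]
  fin_cases j <;> simp [timePhase, freq, delta₁, delta₂] <;> ring_nf

theorem matY_mul_expDelta (hq : q₀ ≠ 0) (w : ℂ) (x : ℝ) :
    matY q₀ v w * expDelta q₀ σ w x t
      = colMatrix (fun j x => jostScale q₀ σ t w j • eigWave q₀ v w j x) x := by
  ext i j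
  have h := expDelta_apply (q₀ := q₀) (σ := σ) (t := t) w x j
  rw [expDelta, Matrix.diagonal_apply_eq] at h
  rw [expDelta, Matrix.mul_diagonal, h, matY_apply hq]
  simp only [colMatrix, Matrix.of_apply, jostScale, eigWave, Pi.smul_apply, smul_eq_mul]
  ring

theorem isJost_iff {q : ℝ → ℝ → Vec2} {ψ : ℝ → ℝ → Mat3} (hq : q₀ ≠ 0) :
    IsJost q₀ σ q t l v ψ ↔ ∀ z ∈ realSpectrum q₀, ∃ φ : Fin 3 → ℝ → Fin 3 → ℂ,
      (∀ j, IsWave q₀ (q · t) l v z j (φ j)) ∧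
        ψ z = colMatrix fun j x => jostScale q₀ σ t z j • φ j x := by
  constructor
  · intro h z hz
    have hs := jostScale_ne_zero (σ := σ) (t := t) hq hz
    refine ⟨fun j x => (jostScale q₀ σ t z j)⁻¹ • (ψ z x).col j, fun j => ⟨IsSol.smul
      (fun x => hasDerivAt_pi.2 fun i => h.ode z hz x i j) _, ?_⟩, ?_⟩
    · refine tendsto_pi_nhds.2 fun i => ?_
      have hb := (tendsto_pi_nhds.1 (tendsto_pi_nhds.1 (h.boundary z hz) i) j).const_mul
        (jostScale q₀ σ t z j)⁻¹
      simp only [matY_mul_expDelta hq, colMatrix, Matrix.sub_apply, Matrix.of_apply, Pi.smul_apply,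
        smul_eq_mul, mul_sub, inv_mul_cancel_left₀ (hs j), Matrix.zero_apply, mul_zero] at hb
      exact hb
    · ext x i j
      exact (mul_inv_cancel_left₀ (hs j) _).symm
  · intro h
    refine ⟨fun z hz x i j => ?_, fun z hz => tendsto_pi_nhds.2 fun i => tendsto_pi_nhds.2
      fun j => ?_⟩ <;> obtain ⟨φ, hφ, hψ⟩ := h z hz
    · rw [hψ]
      exact hasDerivAt_pi.1 ((hφ j).sol.smul (jostScale q₀ σ t z j) x) i
    · have hb := (tendsto_pi_nhds.1 (hφ j).tendsto i).const_mul (jostScale q₀ σ t z j)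
      rw [Pi.zero_apply, mul_zero] at hb
      simp only [hψ, matY_mul_expDelta hq]
      exact hb.congr fun x => mul_sub _ _ _

theorem IsJost.eigForm_mul_apply [l.NeBot] [l'.NeBot] {q : ℝ → ℝ → Vec2} {ψ ψ' : ℝ → ℝ → Mat3}
    {M : Mat3} {φ φ' : ℝ → Fin 3 → ℂ} (hq : q₀ ≠ 0) (hv : ‖v‖ = q₀) (hv' : ‖v'‖ = q₀)
    (hz : z ∈ realSpectrum q₀) (hψ : IsJost q₀ σ q t l v ψ) (hψ' : IsJost q₀ σ q t l' v' ψ')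
    {x : ℝ} (h : ψ' z x = ψ z x * M) (hφ : IsWave q₀ (q · t) l v z j φ)
    (hφ' : IsWave q₀ (q · t) l' v' z j φ') :
    eigForm q₀ z j * M j j = jform (φ x) (φ' x) := by
  obtain ⟨χ, hχ, hψχ⟩ := (isJost_iff hq).1 hψ z hz
  obtain ⟨χ', hχ', hψχ'⟩ := (isJost_iff hq).1 hψ' z hz
  have hs := jostScale_ne_zero (σ := σ) (t := t) hq hz
  rw [hψχ, hψχ'] at h
  have hM := ((IsWave.isOrthogonalSystem hq hz hv hχ).smul hs).mul_apply_of_colMatrix_eq h j j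
  rw [jform_smul_smul, mul_assoc] at hM
  rw [IsWave.eq hq hz hv hχ hφ, IsWave.eq hq hz hv' hχ' hφ']
  exact mul_left_cancel₀ (mul_ne_zero (star_ne_zero.2 (hs j)) (hs j)) hM

theorem exists_colMatrix_eq_mul_and_inverse {q : ℝ → Vec2} {d e : Fin 3 → ℂ}
    {φ χ : Fin 3 → ℝ → Fin 3 → ℂ} (hφ : IsOrthogonalSystem q₀ q z d φ)
    (hχ : IsOrthogonalSystem q₀ q z e χ) :
    ∃ H S : Mat3, (∀ x, colMatrix χ x = colMatrix φ x * H) ∧ H * S = 1 ∧ S * H = 1 := by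
  obtain ⟨H, hH⟩ := hφ.exists_colMatrix_eq_mul hχ.sol
  have hu : IsUnit H.det := by
    have h := hχ.isUnit_det_colMatrix 0
    rw [hH, Matrix.det_mul] at h
    exact isUnit_of_mul_isUnit_right h
  exact ⟨H, H⁻¹, hH, Matrix.mul_nonsing_inv _ hu, Matrix.nonsing_inv_mul _ hu⟩

end JostMatrices

section ScatteringCoefficients

/-- The form of the left and the reflected right solution at `x = 0`, from which the diagonal
entries of the inverse scattering matrix are read off. Conjugating `z` in the first argument makes
it holomorphic in `z`. -/
def scatForm (q₀ : ℝ) (q : ℝ → Vec2) (qm qp : Vec2) (j : Fin 3) (z : ℂ) : ℂ :=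
  jform (leftSol q₀ (reflectPot q) (-qp) j (-star z) 0) (leftSol q₀ q qm j z 0)

/-- The coefficient `s₃₃` in the closed upper half-plane; `s₁₁` is its value at `q₀² / z`. -/
def scatCoeff (q₀ : ℝ) (q : ℝ → Vec2) (qm qp : Vec2) (z : ℂ) : ℂ :=
  rhoHat q₀ z / (q₀ : ℂ) ^ 2 * scatForm q₀ q qm qp 2 z

/-- Jost solutions with their scattering matrix and its inverse, that is, scattering data without
the continuations. -/
structure IsScattering (q₀ σ : ℝ) (q : ℝ → ℝ → Vec2) (t : ℝ) (qm qp : Vec2)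
    (ψm ψp : ℝ → ℝ → Mat3) (H S : ℝ → Mat3) : Prop where
  jost_minus : IsJost q₀ σ q t atBot qm ψm
  jost_plus : IsJost q₀ σ q t atTop qp ψp
  scattering : ∀ z ∈ realSpectrum q₀, ∀ x : ℝ, ψp z x = ψm z x * H z
  inverse : ∀ z ∈ realSpectrum q₀, H z * S z = 1 ∧ S z * H z = 1

theorem ScatteringData.isScattering {q₀ σ t : ℝ} {q : ℝ → ℝ → Vec2} {qm qp : Vec2}
    (D : ScatteringData q₀ σ q t qm qp) : IsScattering q₀ σ q t qm qp D.ψm D.ψp D.H D.S :=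
  ⟨D.jost_minus, D.jost_plus, D.scattering, D.inverse⟩

theorem jform_rightWave_leftWave_zero (q₀ : ℝ) (q : ℝ → Vec2) (qm qp : Vec2) (j : Fin 3) (z : ℝ) :
    jform (rightWave q₀ q qp j z 0) (leftWave q₀ q qm j z 0)
      = reflectSign j * scatForm q₀ q qm qp j z := by
  have hstar : star (reflectSign j) = reflectSign j := by
    fin_cases j <;>
      simp only [reflectSign, Fin.zero_eta, Fin.mk_one, Fin.reduceFinMk, Matrix.cons_val,
        star_neg, star_one]
  rw [rightWave, leftWave, ofReal_zero, mul_zero, Complex.exp_zero, one_smul, neg_zero, scatForm,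
    ← one_smul ℂ (leftSol q₀ q qm j z 0), jform_smul_smul, hstar, mul_one, one_smul,
    show star (z : ℂ) = z from conj_ofReal z]

theorem rhoHat_sq_div {q₀ : ℝ} {w : ℂ} (hq : q₀ ≠ 0) (hw : w ∉ exceptional q₀) :
    rhoHat q₀ ((q₀ : ℂ) ^ 2 / w) = -((q₀ : ℂ) ^ 2 / w ^ 2 * rhoHat q₀ w) := by
  have hq' : (q₀ : ℂ) ≠ 0 := ofReal_ne_zero.2 hq
  obtain ⟨h₀, h₁⟩ := not_mem_exceptional_iff.1 hw
  have h₂ := (not_mem_exceptional_iff.1 (sq_div_not_mem_exceptional hq hw)).2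
  rw [rhoHat, rhoHat, div_eq_iff h₂]
  field_simp
  ring

namespace IsScattering

variable {q₀ σ t : ℝ} {q : ℝ → ℝ → Vec2} {qm qp : Vec2} {z : ℝ} {ψm ψp : ℝ → ℝ → Mat3}
  {H S : ℝ → Mat3} (D : IsScattering q₀ σ q t qm qp ψm ψp H S)

include D

theorem eigForm_mul_S (hq : q₀ ≠ 0) (hqm : ‖qm‖ = q₀) (hqp : ‖qp‖ = q₀)
    (hz : z ∈ realSpectrum q₀) {j : Fin 3} {φ χ : ℝ → Fin 3 → ℂ}
    (hφ : IsWave q₀ (q · t) atBot qm z j φ) (hχ : IsWave q₀ (q · t) atTop qp z j χ) :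
    eigForm q₀ z j * S z j j = jform (χ 0) (φ 0) :=
  D.jost_plus.eigForm_mul_apply hq hqp hqm hz D.jost_minus
    (by rw [D.scattering z hz, Matrix.mul_assoc, (D.inverse z hz).1, Matrix.mul_one]) hχ hφ

theorem H_apply_self (hq : q₀ ≠ 0) (hqm : ‖qm‖ = q₀) (hqp : ‖qp‖ = q₀) (hz : z ∈ realSpectrum q₀)
    (j : Fin 3) : H z j j = star (S z j j) := by
  obtain ⟨φ, hφ, -⟩ := (isJost_iff hq).1 D.jost_minus z hz
  obtain ⟨χ, hχ, -⟩ := (isJost_iff hq).1 D.jost_plus z hz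
  have hH := D.jost_minus.eigForm_mul_apply hq hqm hqp hz D.jost_plus (D.scattering z hz 0)
    (hφ j) (hχ j)
  refine mul_left_cancel₀ (eigForm_ne_zero hq hz j) (hH.trans ?_)
  rw [← star_jform, ← D.eigForm_mul_S hq hqm hqp hz (hφ j) (hχ j), star_mul', star_eigForm_ofReal]

variable (hm : LeftPotential q₀ (q · t) qm) (hp : LeftPotential q₀ (reflectPot (q · t)) (-qp))

include hm hp

theorem S_two_two (hz : z ∈ realSpectrum q₀) : S z 2 2 = scatCoeff q₀ (q · t) qm qp z := by
  have h := D.eigForm_mul_S hm.pos.ne' hm.norm_eq ((norm_neg qp).symm.trans hp.norm_eq) hz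
    (hm.isWave_leftWave hz 2) (hp.isWave_rightWave hz 2)
  have hq : (q₀ : ℂ) ≠ 0 := ofReal_ne_zero.2 hm.pos.ne'
  have hρ := rhoHat_ne_zero hz
  rw [jform_rightWave_leftWave_zero] at h
  simp only [eigForm, reflectSign, Matrix.cons_val, neg_mul, one_mul, neg_inj] at h
  rw [scatCoeff, ← h]
  field_simp

theorem S_zero_zero (hz : z ∈ realSpectrum q₀) :
    S z 0 0 = scatCoeff q₀ (q · t) qm qp ((q₀ : ℂ) ^ 2 / z) := by
  have hz₀ : (z : ℂ) ≠ 0 := (not_mem_exceptional_iff.1 hz).1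
  have hzi := sq_div_mem_realSpectrum hm.pos.ne' hz
  have h := D.eigForm_mul_S hm.pos.ne' hm.norm_eq ((norm_neg qp).symm.trans hp.norm_eq) hz
    ((hm.isWave_leftWave hzi 2).zero_of_sq_div hm.pos.ne' (ofReal_ne_zero.1 hz₀))
    ((hp.isWave_rightWave hzi 2).zero_of_sq_div hm.pos.ne' (ofReal_ne_zero.1 hz₀))
  have hq : (q₀ : ℂ) ≠ 0 := ofReal_ne_zero.2 hm.pos.ne'
  have hρ := rhoHat_ne_zero hz
  rw [jform_smul_smul, jform_rightWave_leftWave_zero, star_inv₀,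
    show star (z : ℂ) = z from conj_ofReal z, ofReal_div, ofReal_pow] at h
  simp only [eigForm, reflectSign, Matrix.cons_val] at h
  rw [inv_mul_eq_iff_eq_mul₀ hρ] at h
  rw [h, scatCoeff, rhoHat_sq_div hm.pos.ne' hz]
  field_simp

theorem S_one_one (hz : z ∈ realSpectrum q₀) :
    S z 1 1 = scatForm q₀ (q · t) qm qp 1 z / (q₀ : ℂ) ^ 2 := by
  have h := D.eigForm_mul_S hm.pos.ne' hm.norm_eq ((norm_neg qp).symm.trans hp.norm_eq) hz
    (hm.isWave_leftWave hz 1) (hp.isWave_rightWave hz 1)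
  rw [jform_rightWave_leftWave_zero] at h
  simp only [eigForm, reflectSign, Matrix.cons_val, neg_mul, one_mul, neg_inj] at h
  rw [← h, mul_div_cancel_left₀ _ (pow_ne_zero 2 (ofReal_ne_zero.2 hm.pos.ne'))]

theorem S_one_one_sq_div (hz : z ∈ realSpectrum q₀) : S (q₀ ^ 2 / z) 1 1 = S z 1 1 := by
  have hz₀ : z ≠ 0 := ofReal_ne_zero.1 (not_mem_exceptional_iff.1 hz).1
  have hzi := sq_div_mem_realSpectrum hm.pos.ne' hz
  have hqp := (norm_neg qp).symm.trans hp.norm_eq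
  have hl := hm.isWave_leftWave hzi 1
  have hr := hp.isWave_rightWave hzi 1
  have h := D.eigForm_mul_S hm.pos.ne' hm.norm_eq hqp hzi hl hr
  have h' := D.eigForm_mul_S hm.pos.ne' hm.norm_eq hqp hz (hl.one_of_sq_div hm.pos.ne' hz₀)
    (hr.one_of_sq_div hm.pos.ne' hz₀)
  exact mul_left_cancel₀ (eigForm_ne_zero hm.pos.ne' hz 1) (h.trans h'.symm)

end IsScattering

end ScatteringCoefficients

section Extensions

variable {q₀ : ℝ} {f g : ℝ → ℂ} {F : ℂ → ℂ}

theorem star_mem_exceptional_iff {z : ℂ} : star z ∈ exceptional q₀ ↔ z ∈ exceptional q₀ := by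
  have h : star z ^ 2 - (q₀ : ℂ) ^ 2 = star (z ^ 2 - (q₀ : ℂ) ^ 2) := by
    simp only [star_sub, star_pow, RCLike.star_def, conj_ofReal]
  rw [← not_iff_not, not_mem_exceptional_iff, not_mem_exceptional_iff, h, star_ne_zero,
    star_ne_zero]

theorem differentiableOn_star_comp_star {s : Set ℂ} (hs : IsOpen s) (hF : DifferentiableOn ℂ F s) :
    DifferentiableOn ℂ (fun z => star (F (star z))) (star ⁻¹' s) := fun z hz => by
  have h := (hF.differentiableAt (hs.mem_nhds hz)).star_star
  rw [star_star] at h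
  exact h.differentiableWithinAt

theorem im_sq_div_pos (hq : q₀ ≠ 0) {z : ℂ} (hz : z.im < 0) : 0 < ((q₀ : ℂ) ^ 2 / z).im := by
  have hz₀ : z ≠ 0 := fun h => hz.ne (h ▸ zero_im)
  rw [div_eq_mul_inv, ← ofReal_pow, im_ofReal_mul, inv_im]
  exact mul_pos (sq_pos_of_ne_zero hq) (div_pos (neg_pos.2 hz) (normSq_pos.2 hz₀))

namespace ExtendsToUpper

theorem comp_sq_div (hq : q₀ ≠ 0) (hF : ExtendsToUpper q₀ f F) :
    ExtendsToLower q₀ (fun x => f (q₀ ^ 2 / x)) (fun z => F ((q₀ : ℂ) ^ 2 / z)) where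
  holo := hF.holo.comp
    ((differentiableOn_const _).fun_div differentiableOn_id
      fun z hz h => (show z.im < 0 from hz).ne (h ▸ zero_im))
    fun z hz => im_sq_div_pos hq hz
  cont := by
    refine hF.cont.comp (continuousOn_const.div continuousOn_id fun z hz =>
      (not_mem_exceptional_iff.1 hz.2).1) fun z hz =>
      ⟨?_, sq_div_not_mem_exceptional hq hz.2⟩
    rcases (show z.im ≤ 0 from hz.1).eq_or_lt with h | h
    · have him := im_sq_div_nonpos (q₀ := q₀) (z := -z) (by rw [neg_im, h, neg_zero])
      rwa [div_neg, neg_im, neg_nonpos] at him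
    · exact (im_sq_div_pos hq h).le
  boundary z hz := by
    rw [← hF.boundary _ (sq_div_mem_realSpectrum hq hz), ofReal_div, ofReal_pow]

theorem congr (hF : ExtendsToUpper q₀ f F) (h : ∀ z ∈ realSpectrum q₀, f z = g z) :
    ExtendsToUpper q₀ g F :=
  ⟨hF.holo, hF.cont, fun z hz => (hF.boundary z hz).trans (h z hz)⟩

theorem conj (hF : ExtendsToUpper q₀ f F) :
    ExtendsToLower q₀ (fun x => star (f x)) (fun z => star (F (star z))) where
  holo := (differentiableOn_star_comp_star (isOpen_lt continuous_const continuous_im) hF.holo).mono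
    fun z hz => show 0 < (star z).im from neg_pos.2 hz
  cont := continuous_star.comp_continuousOn (hF.cont.comp continuous_star.continuousOn fun z hz =>
    ⟨show 0 ≤ (star z).im from neg_nonneg.2 hz.1, mt star_mem_exceptional_iff.1 hz.2⟩)
  boundary z hz := by rw [← hF.boundary z hz, show star (z : ℂ) = z from conj_ofReal z]

end ExtendsToUpper

namespace ExtendsToLower

theorem congr (hF : ExtendsToLower q₀ f F) (h : ∀ z ∈ realSpectrum q₀, f z = g z) :
    ExtendsToLower q₀ g F :=
  ⟨hF.holo, hF.cont, fun z hz => (hF.boundary z hz).trans (h z hz)⟩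

theorem conj (hF : ExtendsToLower q₀ f F) :
    ExtendsToUpper q₀ (fun x => star (f x)) (fun z => star (F (star z))) where
  holo := (differentiableOn_star_comp_star (isOpen_lt continuous_im continuous_const) hF.holo).mono
    fun z hz => show (star z).im < 0 from neg_neg_of_pos hz
  cont := continuous_star.comp_continuousOn (hF.cont.comp continuous_star.continuousOn fun z hz =>
    ⟨show (star z).im ≤ 0 from neg_nonpos.2 hz.1, mt star_mem_exceptional_iff.1 hz.2⟩)
  boundary z hz := by rw [← hF.boundary z hz, show star (z : ℂ) = z from conj_ofReal z]

end ExtendsToLower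

theorem extendsToUpper_scatCoeff {q : ℝ → Vec2} {qm qp : Vec2} (hm : LeftPotential q₀ q qm)
    (hp : LeftPotential q₀ (reflectPot q) (-qp)) :
    ExtendsToUpper q₀ (fun z => scatCoeff q₀ q qm qp z) (scatCoeff q₀ q qm qp) where
  holo := by
    have hleft := differentiableOn_pi.1 (hm.differentiableOn_leftSol 0)
    have hright (i : Fin 3) := (differentiableOn_star_comp_star
      (isOpen_lt continuous_im continuous_const)
      ((differentiableOn_pi.1 (hp.differentiableOn_leftSol 0) i).comp (differentiableOn_neg _)
        fun z (hz : z.im < 0) => neg_pos.2 hz)).mono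
      (fun z (hz : 0 < z.im) => neg_neg_of_pos hz)
    have hprod (i : Fin 3) := (hright i).mul (hleft i)
    have hrho : DifferentiableOn ℂ (rhoHat q₀) {z | 0 < z.im} := fun z hz =>
      (differentiableAt_rhoHat (not_mem_exceptional_of_im_ne_zero
        (show 0 < z.im from hz).ne')).differentiableWithinAt
    exact (hrho.div_const _).mul (((hprod 0).sub (hprod 1)).sub (hprod 2))
  cont := by
    have hleft := continuousOn_pi.1 (hm.continuousOn_leftSol 0)
    have hright (i : Fin 3) := continuous_star.comp_continuousOn
      ((continuousOn_pi.1 (hp.continuousOn_leftSol 0) i).comp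
        (s := {z : ℂ | 0 ≤ z.im} \ exceptional q₀) continuous_star.neg.continuousOn fun z hz =>
        ⟨show 0 ≤ (-star z).im by rw [neg_im, RCLike.star_def, conj_im, neg_neg]; exact hz.1,
          fun h => hz.2 (star_mem_exceptional_iff.1 (neg_mem_exceptional_iff.1 h))⟩)
    have hprod (i : Fin 3) := (hright i).mul (hleft i)
    have hrho : ContinuousOn (rhoHat q₀) ({z : ℂ | 0 ≤ z.im} \ exceptional q₀) := fun z hz =>
      (differentiableAt_rhoHat hz.2).continuousAt.continuousWithinAt
    exact (hrho.div_const _).mul (((hprod 0).sub (hprod 1)).sub (hprod 2))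
  boundary _ _ := rfl

end Extensions

section Existence

variable {q₀ σ t : ℝ} {q : ℝ → ℝ → Vec2} {qm qp : Vec2}

theorem IsScattering.extends {ψm ψp : ℝ → ℝ → Mat3} {H S : ℝ → Mat3}
    (D : IsScattering q₀ σ q t qm qp ψm ψp H S) (hm : LeftPotential q₀ (q · t) qm)
    (hp : LeftPotential q₀ (reflectPot (q · t)) (-qp)) :
    ExtendsToLower q₀ (fun z => S z 0 0)
      (fun z => scatCoeff q₀ (q · t) qm qp ((q₀ : ℂ) ^ 2 / z)) ∧
    ExtendsToUpper q₀ (fun z => S z 2 2) (scatCoeff q₀ (q · t) qm qp) ∧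
    ExtendsToUpper q₀ (fun z => H z 0 0)
      (fun z => star (scatCoeff q₀ (q · t) qm qp ((q₀ : ℂ) ^ 2 / star z))) ∧
    ExtendsToLower q₀ (fun z => H z 2 2) (fun z => star (scatCoeff q₀ (q · t) qm qp (star z))) := by
  have hH {z : ℝ} (hz : z ∈ realSpectrum q₀) (j : Fin 3) : star (S z j j) = H z j j :=
    (D.H_apply_self hm.pos.ne' hm.norm_eq ((norm_neg qp).symm.trans hp.norm_eq) hz j).symm
  have hs₃₃ : ExtendsToUpper q₀ (fun z => S z 2 2) (scatCoeff q₀ (q · t) qm qp) :=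
    (extendsToUpper_scatCoeff hm hp).congr fun z hz => (D.S_two_two hm hp hz).symm
  have hs₁₁ := ((extendsToUpper_scatCoeff hm hp).comp_sq_div hm.pos.ne').congr
    (g := fun z => S z 0 0) fun z hz => by
      rw [D.S_zero_zero hm hp hz, ofReal_div, ofReal_pow]
  exact ⟨hs₁₁, hs₃₃, hs₁₁.conj.congr fun z hz => hH hz 0, hs₃₃.conj.congr fun z hz => hH hz 2⟩

theorem exists_isScattering (hm : LeftPotential q₀ (q · t) qm)
    (hp : LeftPotential q₀ (reflectPot (q · t)) (-qp)) :
    ∃ ψm ψp H S, IsScattering q₀ σ q t qm qp ψm ψp H S := by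
  have hq := hm.pos.ne'
  have hqp := (norm_neg qp).symm.trans hp.norm_eq
  let ψm (z : ℝ) := colMatrix fun j x => jostScale q₀ σ t z j • leftWave q₀ (q · t) qm j z x
  let ψp (z : ℝ) := colMatrix fun j x => jostScale q₀ σ t z j • rightWave q₀ (q · t) qp j z x
  have hHS : ∀ z : realSpectrum q₀, ∃ H S : Mat3,
      (∀ x, ψp z x = ψm z x * H) ∧ H * S = 1 ∧ S * H = 1 := fun z => by
    have hs := jostScale_ne_zero (σ := σ) (t := t) hq z.2
    exact exists_colMatrix_eq_mul_and_inverse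
      ((IsWave.isOrthogonalSystem hq z.2 hm.norm_eq (hm.isWave_leftWave z.2)).smul hs)
      ((IsWave.isOrthogonalSystem hq z.2 hqp (hp.isWave_rightWave z.2)).smul hs)
  choose! H S hHS using fun z hz => hHS ⟨z, hz⟩
  exact ⟨ψm, ψp, H, S, (isJost_iff hq).2 fun z hz => ⟨_, hm.isWave_leftWave hz, rfl⟩,
    (isJost_iff hq).2 fun z hz => ⟨_, hp.isWave_rightWave hz, rfl⟩,
    fun z hz => (hHS z hz).1, fun z hz => (hHS z hz).2⟩

theorem nonempty_scatteringData (hm : LeftPotential q₀ (q · t) qm)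
    (hp : LeftPotential q₀ (reflectPot (q · t)) (-qp)) :
    Nonempty (ScatteringData q₀ σ q t qm qp) := by
  obtain ⟨ψm, ψp, H, S, D⟩ := exists_isScattering (σ := σ) hm hp
  obtain ⟨hs₁₁, hs₃₃, hh₁₁, hh₃₃⟩ := D.extends hm hp
  exact ⟨⟨ψm, ψp, H, S, _, _, _, _, D.jost_minus, D.jost_plus, D.scattering, D.inverse, hs₁₁, hs₃₃,
    hh₁₁, hh₃₃⟩⟩

end Existence

section ScatteringReflection

variable {q₀ : ℝ} {q : ℝ → Vec2} {qm qp : Vec2}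

theorem integrableOn_Iic_comp_neg_iff {F : Type*} [NormedAddCommGroup F] {f : ℝ → F} :
    IntegrableOn (fun x => f (-x)) (Set.Iic 0) ↔ IntegrableOn f (Set.Ici 0) := by
  have h := (Measure.measurePreserving_neg (volume : Measure ℝ)).integrableOn_comp_preimage
    (Homeomorph.neg ℝ).measurableEmbedding (f := f) (s := Set.Ici 0)
  rwa [Set.neg_preimage, Set.neg_Ici, neg_zero] at h

theorem leftPotential_reflectPot (hq : 0 < q₀) (hqp : ‖qp‖ = q₀) (hlim : Tendsto q atTop (𝓝 qp))
    (hint : IntegrableOn (fun x => (1 + |x|) • (q x - qp)) (Set.Ici 0))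
    (hdiff : Differentiable ℝ q) (hderiv : IntegrableOn (deriv q) (Set.Ici 0)) :
    LeftPotential q₀ (reflectPot q) (-qp) where
  pos := hq
  norm_eq := (norm_neg qp).trans hqp
  tendsto := (hlim.comp tendsto_neg_atBot_atTop).neg
  integrableOn := by
    refine (integrableOn_Iic_comp_neg_iff.2 hint).neg.congr (Eventually.of_forall fun x => ?_)
    simp only [Pi.neg_apply, reflectPot, abs_neg, ← smul_neg, neg_sub, sub_neg_eq_add]
    rw [neg_add_eq_sub]
  diff := (hdiff.comp differentiable_neg).neg
  deriv_integrableOn := by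
    have hd : deriv (reflectPot q) = fun x => deriv q (-x) := funext fun x => by
      rw [show reflectPot q = fun x => -q (-x) from rfl, deriv.fun_neg, deriv_comp_neg, neg_neg]
    rw [hd, integrableOn_Iic_comp_neg_iff]
    exact hderiv

theorem inner_reflectPot_mul_inner (x : ℝ) :
    (inner ℂ qm (reflectPot q x) * inner ℂ (reflectPot q x) (-qp) : ℂ)
      = -star (inner ℂ qp (q (-x)) * inner ℂ (q (-x)) qm) := by
  rw [← starRingEnd_apply, map_mul, inner_conj_symm, inner_conj_symm, reflectPot, inner_neg_right,
    inner_neg_neg, mul_comm, mul_neg]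

theorem integrable_inner_mul_inner (hm : LeftPotential q₀ q qm)
    (hp : LeftPotential q₀ (reflectPot q) (-qp)) (horth : inner ℂ qp qm = 0) :
    Integrable fun x => (inner ℂ qp (q x) * inner ℂ (q x) qm : ℂ) := by
  have horth' : inner ℂ qm (-qp) = 0 := by
    rw [inner_neg_right, inner_eq_zero_symm.1 horth, neg_zero]
  have hr := hp.integrableOn_inner_mul_inner horth'
  simp only [inner_reflectPot_mul_inner] at hr
  have hstar := (Complex.conjCLE.toContinuousLinearMap.integrable_comp hr).neg
  have hright : IntegrableOn (fun x => (inner ℂ qp (q x) * inner ℂ (q x) qm : ℂ)) (Set.Ici 0) :=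
    integrableOn_Iic_comp_neg_iff.1 (hstar.congr (Eventually.of_forall fun x => by simp))
  rw [← integrableOn_univ, ← Set.Iic_union_Ici (a := (0 : ℝ))]
  exact (hm.integrableOn_inner_mul_inner horth).union hright

theorem integral_inner_mul_inner
    (h : Integrable fun x => (inner ℂ qp (q x) * inner ℂ (q x) qm : ℂ)) :
    ∫ x, (inner ℂ qp (q x) * inner ℂ (q x) qm : ℂ)
      = transverseIntegral q qm qp 0 - star (transverseIntegral (reflectPot q) (-qp) qm 0) := by
  have hreflect : star (transverseIntegral (reflectPot q) (-qp) qm 0)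
      = -∫ x in Set.Ioi 0, (inner ℂ qp (q x) * inner ℂ (q x) qm : ℂ) := by
    simp only [transverseIntegral, inner_reflectPot_mul_inner]
    rw [integral_neg, star_neg, ← starRingEnd_apply, ← integral_conj]
    simp only [starRingEnd_apply, star_star]
    rw [integral_comp_neg_Iic 0 fun x => (inner ℂ qp (q x) * inner ℂ (q x) qm : ℂ), neg_zero]
  rw [hreflect, sub_neg_eq_add, transverseIntegral]
  exact (intervalIntegral.integral_Iic_add_Ioi h.integrableOn h.integrableOn).symm

end ScatteringReflection

section Orthogonality

theorem norm_sq_mul_inner_eq_add_perp (v x y : Vec2) : (‖v‖ : ℂ) ^ 2 * inner ℂ x y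
    = inner ℂ x v * inner ℂ v y + inner ℂ x (perp v) * inner ℂ (perp v) y := by
  rw [← vec2_norm_sq]
  simp only [inner_vec2, perp_zero, perp_one, star_neg, star_star]
  ring

theorem eq_smul_perp_of_inner_eq_zero {v w : Vec2} (hv : v ≠ 0) (h : inner ℂ v w = 0) :
    w = (inner ℂ (perp v) w / (‖v‖ : ℂ) ^ 2) • perp v := by
  have hv' : (‖v‖ : ℂ) ^ 2 ≠ 0 := pow_ne_zero 2 (ofReal_ne_zero.2 (norm_ne_zero_iff.2 hv))
  refine ext_inner_left ℂ fun x => mul_left_cancel₀ hv' ?_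
  rw [norm_sq_mul_inner_eq_add_perp, h, mul_zero, zero_add, inner_smul_right, ← mul_assoc,
    mul_div_cancel₀ _ hv', mul_comm]

theorem exists_eq_exp_smul_perp {v w : Vec2} (hv : v ≠ 0) (hw : ‖w‖ = ‖v‖) (h : inner ℂ w v = 0) :
    ∃ ϑ : ℝ, w = Complex.exp (-(I * ϑ)) • perp v := by
  have hsmul := eq_smul_perp_of_inner_eq_zero hv (inner_eq_zero_symm.1 h)
  have hnorm : ‖(inner ℂ (perp v) w / (‖v‖ : ℂ) ^ 2 : ℂ)‖ = 1 := by
    refine mul_right_cancel₀ (norm_ne_zero_iff.2 hv) ?_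
    rw [one_mul, ← norm_perp v, ← norm_smul, norm_perp, ← hsmul, hw]
  obtain ⟨θ, hθ⟩ := Complex.norm_eq_one_iff _ |>.1 hnorm
  refine ⟨-θ, ?_⟩
  rwa [ofReal_neg, mul_neg, neg_neg, mul_comm, hθ]

theorem integral_inner_mul_inner_eq_perp {v w : Vec2} (q : ℝ → Vec2) (hv : v ≠ 0)
    (h : inner ℂ w v = 0) :
    ∫ x, (inner ℂ w (q x) * inner ℂ (q x) v : ℂ)
      = inner ℂ w (perp v) / (‖v‖ : ℂ) ^ 2 * ∫ x, inner ℂ (perp v) (q x) * inner ℂ (q x) v := by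
  have hv' : (‖v‖ : ℂ) ^ 2 ≠ 0 := pow_ne_zero 2 (ofReal_ne_zero.2 (norm_ne_zero_iff.2 hv))
  have hinner (x : ℝ) : inner ℂ w (q x)
      = inner ℂ w (perp v) / (‖v‖ : ℂ) ^ 2 * inner ℂ (perp v) (q x) := by
    rw [div_mul_eq_mul_div, eq_div_iff hv', mul_comm, norm_sq_mul_inner_eq_add_perp, h, zero_mul,
      zero_add]
  simp only [hinner, mul_assoc, integral_const_mul]

end Orthogonality

section ScatteringAsymptotics

variable {q₀ : ℝ}

theorem jform_eq_inner (φ χ : Fin 3 → ℂ) :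
    jform φ χ = star (φ 0) * χ 0 - inner ℂ (lowerPart φ) (lowerPart χ) := by
  rw [jform, inner_vec2, lowerPart_zero, lowerPart_one, lowerPart_zero, lowerPart_one, sub_sub]

theorem inner_perp_perp (v w : Vec2) : inner ℂ (perp v) (perp w) = inner ℂ w v := by
  simp only [inner_vec2, perp_zero, perp_one, star_star, star_neg]
  ring

section

variable {α : Type*} {l : Filter α} {φ χ : α → Fin 3 → ℂ} {v w : Vec2} {r : α → ℝ}

theorem isBigO_jform_add (hvw : inner ℂ w v = 0) (hφ : (fun x => φ x 0) =O[l] r)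
    (hχ : (fun x => χ x 0) =O[l] r) (hφ' : (fun x => lowerPart (φ x) - w) =O[l] r)
    (hχ' : (fun x => lowerPart (χ x) - v) =O[l] r) :
    (fun x => jform (φ x) (χ x) + (inner ℂ w (lowerPart (χ x)) + inner ℂ (lowerPart (φ x)) v))
      =O[l] fun x => r x ^ 2 := by
  have hstar := IsBigO.of_norm_left (hφ.norm_left.congr_left fun x => (norm_star _).symm)
  refine ((hstar.mul hχ).sub (isBigO_inner hφ' hχ')).congr (fun x => ?_) fun x => (sq (r x)).symm
  rw [jform_eq_inner, inner_sub_left, inner_sub_right, inner_sub_right, hvw]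
  ring

theorem isBigO_jform_of_inner_eq_zero (hr : r =O[l] fun _ => (1 : ℝ)) (hvw : inner ℂ w v = 0)
    (hφ : (fun x => φ x 0) =O[l] r) (hχ : (fun x => χ x 0) =O[l] r)
    (hφ' : (fun x => lowerPart (φ x) - w) =O[l] r) (hχ' : (fun x => lowerPart (χ x) - v) =O[l] r) :
    (fun x => jform (φ x) (χ x)) =O[l] r := by
  have hsq : (fun x => r x ^ 2) =O[l] r :=
    ((isBigO_refl r l).mul hr).congr (fun x => (sq (r x)).symm) fun x => mul_one _
  have hleft := isBigO_inner (isBigO_const_const w one_ne_zero l) hχ'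
  have hright := isBigO_inner hφ' (isBigO_const_const v one_ne_zero l)
  simp only [one_mul, mul_one] at hleft hright
  refine (((isBigO_jform_add hvw hφ hχ hφ' hχ').trans hsq).sub (hleft.add hright)).congr_left
    fun x => ?_
  rw [inner_sub_left, inner_sub_right, hvw]
  ring

end

section

variable {z : ℂ} {j₀ : Fin 3} {l : Filter ℂ} {q : ℝ → Vec2} {v qm qp : Vec2}

theorem freq_neg_star (z : ℂ) (j : Fin 3) : freq q₀ (-star z) j = -star (freq q₀ z j) := by
  rw [freq_neg]
  fin_cases j <;>
    simp only [freq, kOf, lamOf, Fin.zero_eta, Fin.mk_one, Fin.reduceFinMk, Matrix.cons_val,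
      star_neg, star_div₀, star_add, star_sub, star_pow, RCLike.star_def, conj_ofReal, map_ofNat]

theorem tendsto_star_cobounded :
    Tendsto (star : ℂ → ℂ) (Bornology.cobounded ℂ) (Bornology.cobounded ℂ) := by
  rw [← tendsto_norm_atTop_iff_cobounded]
  simpa only [norm_star] using tendsto_norm_cobounded_atTop (E := ℂ)

theorem IsAdmissibleAtInfinity.map_neg_star (h : IsAdmissibleAtInfinity q₀ j₀ l) :
    IsAdmissibleAtInfinity q₀ j₀ (l.map fun z => -star z) where
  le_cobounded := (tendsto_neg_cobounded.comp tendsto_star_cobounded).mono_left h.le_cobounded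
  eventually_re_nonpos := eventually_map.2 (h.eventually_re_nonpos.mono fun z hz j => by
    have hj := hz j
    rw [I_mul_re] at hj ⊢
    rwa [freq_neg_star, freq_neg_star, neg_sub_neg, ← star_sub, RCLike.star_def, conj_im, ← neg_im,
      neg_sub])

theorem isAdmissibleAtInfinity_upper :
    IsAdmissibleAtInfinity q₀ 2 (Bornology.cobounded ℂ ⊓ 𝓟 {z : ℂ | 0 ≤ z.im}) where
  le_cobounded := inf_le_left
  eventually_re_nonpos := eventually_inf_principal.2
    (Eventually.of_forall fun _ hz => re_I_mul_freq_sub_nonpos hz)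

theorem isAdmissibleAtInfinity_real (j₀ : Fin 3) :
    IsAdmissibleAtInfinity q₀ j₀ ((Bornology.cobounded ℝ).map ((↑) : ℝ → ℂ)) where
  le_cobounded := by
    rw [← Tendsto, ← tendsto_norm_atTop_iff_cobounded]
    simpa only [norm_real] using tendsto_norm_cobounded_atTop (E := ℝ)
  eventually_re_nonpos := eventually_map.2
    (Eventually.of_forall fun z j => (re_I_mul_freq_sub_ofReal z j j₀).le)

namespace LeftPotential

theorem isBigO_leftSol_apply_zero (h : LeftPotential q₀ q v) (hj₀ : j₀ ≠ 0)
    (hl : IsAdmissibleAtInfinity q₀ j₀ l) :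
    (fun z => leftSol q₀ q v j₀ z 0 0) =O[l] fun z => ‖z‖⁻¹ := by
  have hcomp := (h.isBigO_leftSol_zero hj₀ hl).comp_tendsto
    (tendsto_prodMk_prod_principal l (Set.mem_Iic.2 (le_refl (0 : ℝ))))
  exact hcomp

theorem isBigO_lowerPart_leftSol_at_zero_sub (h : LeftPotential q₀ q v) (hj₀ : j₀ ≠ 0)
    (hl : IsAdmissibleAtInfinity q₀ j₀ l) :
    (fun z => lowerPart (leftSol q₀ q v j₀ z 0) - lowerPart (eigCol q₀ v z j₀))
      =O[l] fun z => ‖z‖⁻¹ := by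
  have hcomp := (h.isBigO_lowerPart_leftSol_sub hj₀ hl).comp_tendsto
    (tendsto_prodMk_prod_principal l (Set.mem_Iic.2 (le_refl (0 : ℝ))))
  exact hcomp

end LeftPotential

theorem isBigO_comp_neg_star {F : Type*} [NormedAddCommGroup F] {f : ℂ → F} (g : ℝ → ℝ)
    (h : f =O[l.map fun z => -star z] fun z => g ‖z‖) :
    (fun z => f (-star z)) =O[l] fun z => g ‖z‖ :=
  (isBigO_map.1 h).congr_right fun z => by
    rw [Function.comp_apply, norm_neg, norm_star]

variable (hm : LeftPotential q₀ q qm) (hp : LeftPotential q₀ (reflectPot q) (-qp))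
  (horth : inner ℂ qp qm = 0)

include hm hp horth

theorem isBigO_scatForm_one (hl : IsAdmissibleAtInfinity q₀ 1 l) :
    scatForm q₀ q qm qp 1 =O[l] fun z => ‖z‖⁻¹ := by
  have horth' : inner ℂ (perp (-qp)) (perp qm) = 0 := by
    rw [inner_perp_perp, inner_neg_right, inner_eq_zero_symm.1 horth, neg_zero]
  have hbdd : (fun z : ℂ => ‖z‖⁻¹) =O[l] fun _ => (1 : ℝ) :=
    ((tendsto_inv₀_cobounded.mono_left hl.le_cobounded).isBigO_one ℝ).norm_left.congr_left norm_inv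
  have hφ := isBigO_comp_neg_star (·⁻¹)
    (hp.isBigO_lowerPart_leftSol_at_zero_sub one_ne_zero hl.map_neg_star)
  have hχ := hm.isBigO_lowerPart_leftSol_at_zero_sub one_ne_zero hl
  simp only [lowerPart_eigCol_one] at hφ hχ
  exact isBigO_jform_of_inner_eq_zero hbdd horth' (isBigO_comp_neg_star (·⁻¹)
    (hp.isBigO_leftSol_apply_zero one_ne_zero hl.map_neg_star))
    (hm.isBigO_leftSol_apply_zero one_ne_zero hl) hφ hχ

theorem isBigO_scatForm_two_sub (hl : IsAdmissibleAtInfinity q₀ 2 l) :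
    (fun z => scatForm q₀ q qm qp 2 z - I / z * ∫ x, inner ℂ qp (q x) * inner ℂ (q x) qm)
      =O[l] fun z => ‖z‖⁻¹ ^ 2 := by
  have htwo : (2 : Fin 3) ≠ 0 := by decide
  have horth' : inner ℂ qm (-qp) = 0 := by
    rw [inner_neg_right, inner_eq_zero_symm.1 horth, neg_zero]
  have hφ := isBigO_comp_neg_star (·⁻¹)
    (hp.isBigO_lowerPart_leftSol_at_zero_sub htwo hl.map_neg_star)
  have hχ := hm.isBigO_lowerPart_leftSol_at_zero_sub htwo hl
  simp only [lowerPart_eigCol_two] at hφ hχ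
  have hform := isBigO_jform_add (inner_eq_zero_symm.1 horth') (isBigO_comp_neg_star (·⁻¹)
    (hp.isBigO_leftSol_apply_zero htwo hl.map_neg_star))
    (hm.isBigO_leftSol_apply_zero htwo hl) hφ hχ
  have hleft := hm.isBigO_inner_lowerPart_leftSol_sub horth hl
  have hright := isBigO_comp_neg_star (·⁻¹ ^ 2)
    (hp.isBigO_inner_lowerPart_leftSol_sub horth' hl.map_neg_star)
  refine ((hform.add hleft).sub (IsBigO.of_norm_left (hright.norm_left.congr_left fun z =>
    (norm_star _).symm))).congr_left fun z => ?_
  rw [integral_inner_mul_inner (integrable_inner_mul_inner hm hp horth), scatForm, inner_neg_left]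
  simp only [← starRingEnd_apply, map_sub, map_mul, map_div₀, map_neg, conj_I, conj_conj,
    inner_conj_symm]
  ring

theorem isBigO_scatCoeff_sub (hl : IsAdmissibleAtInfinity q₀ 2 l) :
    (fun z => scatCoeff q₀ q qm qp z
        - I * (∫ x, inner ℂ qp (q x) * inner ℂ (q x) qm) / ((q₀ : ℂ) ^ 2 * z))
      =O[l] fun z => 1 / z ^ 2 := by
  have hq : (q₀ : ℂ) ≠ 0 := ofReal_ne_zero.2 hm.pos.ne'
  set θ := ∫ x, inner ℂ qp (q x) * inner ℂ (q x) qm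
  have hrho : rhoHat q₀ =O[l] fun _ => (1 : ℝ) :=
    (tendsto_rhoHat_cobounded.mono_left hl.le_cobounded).isBigO_one ℝ
  have hinv : (fun z : ℂ => z⁻¹) =O[l] fun _ => (1 : ℝ) :=
    (tendsto_inv₀_cobounded.mono_left hl.le_cobounded).isBigO_one ℝ
  have hform : (fun z => scatForm q₀ q qm qp 2 z - I / z * θ) =O[l] fun z => 1 / z ^ 2 :=
    IsBigO.of_norm_right ((isBigO_scatForm_two_sub hm hp horth hl).congr_right fun z => by
      rw [norm_div, norm_one, norm_pow, one_div, inv_pow])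
  have hsub : (fun z => rhoHat q₀ z * (q₀ ^ 2 / z ^ 2 * (I / z * θ))) =O[l] fun z => 1 / z ^ 2 :=
    ((((hrho.mul hinv).congr_right fun _ => one_mul 1).smul
      (isBigO_refl (fun z : ℂ => 1 / z ^ 2) l)).const_mul_left
      (q₀ ^ 2 * I * θ)).congr (fun z => by rw [smul_eq_mul]; ring) fun z => one_smul ℝ _
  refine ((((hrho.smul hform).congr_right fun z => one_smul ℝ _).add
    hsub).const_mul_left ((q₀ : ℂ) ^ 2)⁻¹).congr' ?_ EventuallyEq.rfl
  filter_upwards [hl.eventually] with z hz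
  obtain ⟨hz₀, hz'⟩ := not_mem_exceptional_iff.1 hz.1
  simp only [scatCoeff, rhoHat, smul_eq_mul]
  field_simp
  ring

end

end ScatteringAsymptotics

section Coefficients

variable {q₀ σ t : ℝ} {q : ℝ → ℝ → Vec2} {qm qp : Vec2}

theorem tendsto_const_div_cobounded {𝕜 : Type*} [NormedDivisionRing 𝕜] {a : 𝕜} (ha : a ≠ 0) :
    Tendsto (fun z => a / z) (𝓝[≠] 0) (Bornology.cobounded 𝕜) := by
  simp only [div_eq_mul_inv]
  exact (tendsto_mul_left_cobounded ha).comp tendsto_inv₀_nhdsNE_zero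

theorem eventually_cofinite_mem_realSpectrum (q₀ : ℝ) : ∀ᶠ z in cofinite, z ∈ realSpectrum q₀ :=
  ((finite_exceptional q₀).preimage ofReal_injective.injOn).eventually_cofinite_notMem

theorem eventually_mem_and_not_mem_exceptional {l : Filter ℂ} {s : Set ℂ}
    (hl : l ≤ cofinite ⊓ 𝓟 s) (q₀ : ℝ) : ∀ᶠ z in l, z ∈ s ∧ z ∉ exceptional q₀ :=
  (Eventually.filter_mono (le_inf_iff.1 hl).2 (mem_principal_self s)).and
    ((eventually_cofinite_not_mem_exceptional q₀).filter_mono (le_inf_iff.1 hl).1)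

theorem cobounded_inf_le_cofinite_inf (s : Set ℂ) :
    Bornology.cobounded ℂ ⊓ 𝓟 s ≤ cofinite ⊓ 𝓟 s :=
  inf_le_inf_right _ (Bornology.le_cofinite ℂ)

theorem nhdsWithin_diff_le_cofinite_inf (s : Set ℂ) : 𝓝[s \ {0}] 0 ≤ cofinite ⊓ 𝓟 s :=
  le_inf ((nhdsWithin_mono _ fun _ hz => hz.2).trans (nhdsNE_le_cofinite 0))
    (le_principal_iff.2 (mem_of_superset self_mem_nhdsWithin Set.sdiff_subset))

theorem mapsTo_star_im_nonpos :
    Set.MapsTo (star : ℂ → ℂ) {z | z.im ≤ 0} {z | 0 ≤ z.im} := fun z (hz : z.im ≤ 0) => by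
  simpa only [Set.mem_ofPred_eq, RCLike.star_def, conj_im, neg_nonneg] using hz

theorem mapsTo_star_im_nonneg :
    Set.MapsTo (star : ℂ → ℂ) {z | 0 ≤ z.im} {z | z.im ≤ 0} := fun z (hz : 0 ≤ z.im) => by
  simpa only [Set.mem_ofPred_eq, RCLike.star_def, conj_im, neg_nonpos] using hz

theorem tendsto_sq_div_nhdsWithin_im_nonpos (hq : q₀ ≠ 0) :
    Tendsto (fun z : ℂ => (q₀ : ℂ) ^ 2 / z) (𝓝[{z : ℂ | z.im ≤ 0} \ {0}] 0)
      (Bornology.cobounded ℂ ⊓ 𝓟 {z : ℂ | 0 ≤ z.im}) := by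
  have hlim : Tendsto (fun z : ℂ => (q₀ : ℂ) ^ 2 / z) (𝓝[≠] 0) (Bornology.cobounded ℂ) :=
    tendsto_const_div_cobounded (pow_ne_zero 2 (ofReal_ne_zero.2 hq))
  refine tendsto_inf.2 ⟨hlim.mono_left (nhdsWithin_mono _ fun z hz => hz.2),
    tendsto_principal.2 (eventually_mem_nhdsWithin.mono fun z hz => ?_)⟩
  have him : 0 ≤ (-z).im := neg_nonneg.2 hz.1
  have hdiv := im_sq_div_nonpos (q₀ := q₀) him
  rwa [div_neg, neg_im, neg_nonpos] at hdiv

theorem tendsto_star_nhdsWithin_im_nonneg :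
    Tendsto (star : ℂ → ℂ) (𝓝[{z : ℂ | 0 ≤ z.im} \ {0}] 0) (𝓝[{z : ℂ | z.im ≤ 0} \ {0}] 0) := by
  have hstar := (continuous_star (R := ℂ)).continuousWithinAt.tendsto_nhdsWithin
    (s := {z : ℂ | 0 ≤ z.im} \ {0}) (x := 0) (t := {z : ℂ | z.im ≤ 0} \ {0})
    fun z hz => ⟨mapsTo_star_im_nonneg hz.1, star_ne_zero.2 hz.2⟩
  rwa [star_zero] at hstar

theorem isBigO_star_comp_star_sub {F f g : ℂ → ℂ} {l l' : Filter ℂ}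
    (h : (fun z => F z - f z) =O[l] g) (hl : Tendsto star l' l) :
    (fun z => star (F (star z)) - star (f (star z))) =O[l'] fun z => star (g (star z)) :=
  IsBigO.of_norm_norm ((h.comp_tendsto hl).norm_norm.congr
    (fun z => by rw [Function.comp_apply, ← star_sub, norm_star])
    fun z => by rw [Function.comp_apply, norm_star])

namespace ScatteringData

section Symmetry

variable (D : ScatteringData q₀ σ q t qm qp)

include D

theorem isBigO_H_apply_self {g : ℝ → ℝ} {l : Filter ℝ} (hq : q₀ ≠ 0) (hqm : ‖qm‖ = q₀)
    (hqp : ‖qp‖ = q₀) (hl : l ≤ cofinite) {j : Fin 3} (h : (fun z => D.S z j j) =O[l] g) :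
    (fun z => D.H z j j) =O[l] g := by
  refine IsBigO.of_norm_left (h.norm_left.congr' ?_ EventuallyEq.rfl)
  filter_upwards [hl (eventually_cofinite_mem_realSpectrum q₀)] with z hz
  rw [D.isScattering.H_apply_self hq hqm hqp hz, norm_star]

theorem h₃₃_eq (hq : q₀ ≠ 0) (hqm : ‖qm‖ = q₀) (hqp : ‖qp‖ = q₀) {z : ℂ} (hz : z.im ≤ 0)
    (hz' : z ∉ exceptional q₀) : D.h₃₃ z = star (D.s₃₃ (star z)) :=
  D.h₃₃_ext.unique (D.s₃₃_ext.conj.congr fun _ hx =>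
    (D.isScattering.H_apply_self hq hqm hqp hx 2).symm) hz hz'

theorem h₁₁_eq (hq : q₀ ≠ 0) (hqm : ‖qm‖ = q₀) (hqp : ‖qp‖ = q₀) {z : ℂ} (hz : 0 ≤ z.im)
    (hz' : z ∉ exceptional q₀) : D.h₁₁ z = star (D.s₁₁ (star z)) :=
  D.h₁₁_ext.unique (D.s₁₁_ext.conj.congr fun _ hx =>
    (D.isScattering.H_apply_self hq hqm hqp hx 0).symm) hz hz'

end Symmetry

variable (D : ScatteringData q₀ σ q t qm qp) (hm : LeftPotential q₀ (q · t) qm)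
  (hp : LeftPotential q₀ (reflectPot (q · t)) (-qp))

include hm hp

theorem s₃₃_eq {z : ℂ} (hz : 0 ≤ z.im) (hz' : z ∉ exceptional q₀) :
    D.s₃₃ z = scatCoeff q₀ (q · t) qm qp z :=
  D.s₃₃_ext.unique (D.isScattering.extends hm hp).2.1 hz hz'

theorem s₁₁_eq {z : ℂ} (hz : z.im ≤ 0) (hz' : z ∉ exceptional q₀) :
    D.s₁₁ z = scatCoeff q₀ (q · t) qm qp ((q₀ : ℂ) ^ 2 / z) :=
  D.s₁₁_ext.unique (D.isScattering.extends hm hp).1 hz hz'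

variable (horth : inner ℂ qp qm = 0)

include horth

theorem isBigO_S_one_one_cobounded :
    (fun z : ℝ => D.S z 1 1) =O[Bornology.cobounded ℝ] fun z => 1 / z := by
  have h := isBigO_map.1 (isBigO_scatForm_one hm hp horth (isAdmissibleAtInfinity_real 1))
  refine (IsBigO.of_norm_right ((h.const_mul_left ((q₀ : ℂ) ^ 2)⁻¹).congr_right fun z => ?_)).congr'
    ?_ EventuallyEq.rfl
  · rw [Function.comp_apply, norm_real, norm_div, norm_one, one_div]
  · filter_upwards [Bornology.le_cofinite ℝ (eventually_cofinite_mem_realSpectrum q₀)] with z hz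
    rw [D.isScattering.S_one_one hm hp hz, Function.comp_apply, inv_mul_eq_div]

theorem isBigO_S_one_one_nhdsNE : (fun z : ℝ => D.S z 1 1) =O[𝓝[≠] 0] fun z => z := by
  have h := (D.isBigO_S_one_one_cobounded hm hp horth).comp_tendsto
    (tendsto_const_div_cobounded (pow_ne_zero 2 hm.pos.ne'))
  refine (h.congr' ?_ (Eventually.of_forall fun z => ?_)).trans
    (isBigO_const_mul_self (q₀ ^ 2)⁻¹ (fun z : ℝ => z) _)
  · filter_upwards [nhdsNE_le_cofinite 0 (eventually_cofinite_mem_realSpectrum q₀)] with z hz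
    exact D.isScattering.S_one_one_sq_div hm hp hz
  · rw [Function.comp_apply, one_div_div, div_eq_inv_mul]

theorem isBigO_s₃₃_sub :
    (fun z => D.s₃₃ z - I * thetaOne q t qm qp / ((q₀ : ℂ) ^ 2 * z))
      =O[Bornology.cobounded ℂ ⊓ 𝓟 {z : ℂ | 0 ≤ z.im}] fun z => 1 / z ^ 2 := by
  refine (isBigO_scatCoeff_sub hm hp horth isAdmissibleAtInfinity_upper).congr' ?_ EventuallyEq.rfl
  filter_upwards [eventually_mem_and_not_mem_exceptional (cobounded_inf_le_cofinite_inf _) q₀]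
    with z hz
  rw [D.s₃₃_eq hm hp hz.1 hz.2, thetaOne]

theorem isBigO_h₃₃_sub :
    (fun z => D.h₃₃ z - -(I * star (thetaOne q t qm qp) / ((q₀ : ℂ) ^ 2 * z)))
      =O[Bornology.cobounded ℂ ⊓ 𝓟 {z : ℂ | z.im ≤ 0}] fun z => 1 / z ^ 2 := by
  refine (isBigO_star_comp_star_sub (D.isBigO_s₃₃_sub hm hp horth) (tendsto_star_cobounded.inf
    (tendsto_principal_principal.2 mapsTo_star_im_nonpos))).congr' ?_
    (Eventually.of_forall fun z => by simp only [star_div₀, star_one, star_pow, star_star])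
  filter_upwards [eventually_mem_and_not_mem_exceptional (cobounded_inf_le_cofinite_inf _) q₀]
    with z hz
  rw [D.h₃₃_eq hm.pos.ne' hm.norm_eq ((norm_neg qp).symm.trans hp.norm_eq) hz.1 hz.2]
  simp only [star_div₀, star_mul', star_pow, RCLike.star_def, conj_I, conj_ofReal,
    conj_conj]
  ring

theorem isBigO_s₁₁_sub :
    (fun z => D.s₁₁ z - I * thetaOne q t qm qp / (q₀ : ℂ) ^ 4 * z)
      =O[𝓝[{z : ℂ | z.im ≤ 0} \ {0}] 0] fun z => z ^ 2 := by
  have hq : (q₀ : ℂ) ≠ 0 := ofReal_ne_zero.2 hm.pos.ne'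
  have h := (isBigO_scatCoeff_sub hm hp horth isAdmissibleAtInfinity_upper).comp_tendsto
    (tendsto_sq_div_nhdsWithin_im_nonpos hm.pos.ne')
  refine (h.congr' ?_ (Eventually.of_forall fun z => ?_)).trans
    (isBigO_const_mul_self (((q₀ : ℂ) ^ 4)⁻¹) (fun z : ℂ => z ^ 2) _)
  · filter_upwards [eventually_mem_and_not_mem_exceptional (nhdsWithin_diff_le_cofinite_inf _) q₀]
      with z hz
    have : z ≠ 0 := (not_mem_exceptional_iff.1 hz.2).1
    rw [D.s₁₁_eq hm hp hz.1 hz.2, Function.comp_apply, thetaOne]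
    field_simp
  · rw [Function.comp_apply, div_pow, one_div_div]
    ring

theorem isBigO_h₁₁_sub :
    (fun z => D.h₁₁ z - -(I * star (thetaOne q t qm qp) / (q₀ : ℂ) ^ 4 * z))
      =O[𝓝[{z : ℂ | 0 ≤ z.im} \ {0}] 0] fun z => z ^ 2 := by
  refine (isBigO_star_comp_star_sub (D.isBigO_s₁₁_sub hm hp horth)
    tendsto_star_nhdsWithin_im_nonneg).congr' ?_
    (Eventually.of_forall fun z => by simp only [star_pow, star_star])
  filter_upwards [eventually_mem_and_not_mem_exceptional (nhdsWithin_diff_le_cofinite_inf _) q₀]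
    with z hz
  rw [D.h₁₁_eq hm.pos.ne' hm.norm_eq ((norm_neg qp).symm.trans hp.norm_eq) hz.1 hz.2]
  simp only [star_div₀, star_mul', star_pow, RCLike.star_def, conj_I, conj_ofReal,
    conj_conj]
  ring

end ScatteringData

end Coefficients

end CoupledHirota

end

theorem proposition14 (q₀ σ t : ℝ) (hq₀ : 0 < q₀)
    (q : ℝ → ℝ → CoupledHirota.Vec2) (qm qp : CoupledHirota.Vec2)
    (hqm : ‖qm‖ = q₀) (hqp : ‖qp‖ = q₀)
    -- boundary conditions
    (hlim_m : Tendsto (fun x => q x t) atBot (𝓝 qm))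
    (hlim_p : Tendsto (fun x => q x t) atTop (𝓝 qp))
    -- `q - q₋ ∈ L^{1,1}(ℝ⁻)`, `q - q₊ ∈ L^{1,1}(ℝ⁺)`, `q_x ∈ L¹(ℝ)`
    (hint_m : IntegrableOn (fun x => (1 + |x|) • (q x t - qm)) (Set.Iic 0))
    (hint_p : IntegrableOn (fun x => (1 + |x|) • (q x t - qp)) (Set.Ici 0))
    (hdiff : Differentiable ℝ (fun x => q x t))
    (hderiv : Integrable (deriv (fun x => q x t)))
    -- orthogonality `q₊† q₋ = 0`
    (horth : inner ℂ qp qm = 0) :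
    (∃ ϑ : ℝ, qp = Complex.exp (-(I * ϑ)) • CoupledHirota.perp qm) ∧
    Integrable (fun x : ℝ => inner ℂ qp (q x t) * inner ℂ (q x t) qm) ∧
    CoupledHirota.thetaOne q t qm qp =
      inner ℂ qp (CoupledHirota.perp qm) / (q₀ : ℂ) ^ 2 *
        ∫ x : ℝ, inner ℂ (CoupledHirota.perp qm) (q x t) * inner ℂ (q x t) qm ∧
    Nonempty (CoupledHirota.ScatteringData q₀ σ q t qm qp) ∧
    ∀ D : CoupledHirota.ScatteringData q₀ σ q t qm qp,
      -- `z → ∞`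
      ((fun z : ℂ => D.s₃₃ z - I * CoupledHirota.thetaOne q t qm qp / ((q₀ : ℂ) ^ 2 * z))
        =O[Bornology.cobounded ℂ ⊓ 𝓟 {z : ℂ | 0 ≤ z.im}] fun z => 1 / z ^ 2) ∧
      ((fun z : ℂ => D.h₃₃ z -
          -(I * star (CoupledHirota.thetaOne q t qm qp) / ((q₀ : ℂ) ^ 2 * z)))
        =O[Bornology.cobounded ℂ ⊓ 𝓟 {z : ℂ | z.im ≤ 0}] fun z => 1 / z ^ 2) ∧
      ((fun z : ℝ => D.S z 1 1) =O[Bornology.cobounded ℝ] fun z => 1 / z) ∧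
      ((fun z : ℝ => D.H z 1 1) =O[Bornology.cobounded ℝ] fun z => 1 / z) ∧
      -- `z → 0`
      ((fun z : ℂ => D.s₁₁ z - I * CoupledHirota.thetaOne q t qm qp / (q₀ : ℂ) ^ 4 * z)
        =O[𝓝[{z : ℂ | z.im ≤ 0} \ {0}] 0] fun z => z ^ 2) ∧
      ((fun z : ℂ => D.h₁₁ z -
          -(I * star (CoupledHirota.thetaOne q t qm qp) / (q₀ : ℂ) ^ 4 * z))
        =O[𝓝[{z : ℂ | 0 ≤ z.im} \ {0}] 0] fun z => z ^ 2) ∧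
      ((fun z : ℝ => D.S z 1 1) =O[𝓝[≠] 0] fun z => z) ∧
      ((fun z : ℝ => D.H z 1 1) =O[𝓝[≠] 0] fun z => z) := by
  have hm : CoupledHirota.LeftPotential q₀ (fun x => q x t) qm :=
    ⟨hq₀, hqm, hlim_m, hint_m, hdiff, hderiv.integrableOn⟩
  have hp := CoupledHirota.leftPotential_reflectPot hq₀ hqp hlim_p hint_p hdiff
    hderiv.integrableOn
  have hqm₀ : qm ≠ 0 := norm_pos_iff.1 (hqm ▸ hq₀)
  have hperp := CoupledHirota.integral_inner_mul_inner_eq_perp (fun x => q x t) hqm₀ horth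
  rw [hqm] at hperp
  refine ⟨CoupledHirota.exists_eq_exp_smul_perp hqm₀ (hqp.trans hqm.symm) horth,
    CoupledHirota.integrable_inner_mul_inner hm hp horth, hperp,
    CoupledHirota.nonempty_scatteringData hm hp, fun D => ?_⟩
  have hS_infty := D.isBigO_S_one_one_cobounded hm hp horth
  have hS_zero := D.isBigO_S_one_one_nhdsNE hm hp horth
  exact ⟨D.isBigO_s₃₃_sub hm hp horth, D.isBigO_h₃₃_sub hm hp horth, hS_infty,
    D.isBigO_H_apply_self hq₀.ne' hqm hqp (Bornology.le_cofinite ℝ) hS_infty,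
    D.isBigO_s₁₁_sub hm hp horth, D.isBigO_h₁₁_sub hm hp horth, hS_zero,
    D.isBigO_H_apply_self hq₀.ne' hqm hqp (nhdsNE_le_cofinite 0) hS_zero⟩
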